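/- All algebras are associative algebras over $\mathbb C$, not necessarily unital; $\iota$ denotes identity maps and $\otimes=\otimes_{\mathbb C}$. For an algebra $A$ with non-degenerate product, $M(A)$ is its multiplier algebra; $A\subseteq M(A)$ and $A\otimes A\subseteq M(A)\otimes M(A)\subseteq M(A\otimes A)$. Products of subspaces such as $\Delta(A)(A\otimes A)$ or $BA$ denote linear spans of products. Leg numbering ($E_{12}=E\otimes1$, $E_{23}=1\otimes E$, $\Delta_{13}(a)$) refers to $M(A\otimes A\otimes A)$. **Setting.** Let $A$ be a non-degenerate algebra with $A=A^2$. A *coproduct* on $A$ is a homomorphism $\Delta:A\to M(A\otimes A)$ such that $\Delta(a)(1\otimes b)$ and $(c\otimes1)\Delta(a)$ lie in $A\otimes A$ and $$(c\otimes1\otimes1)(\Delta\otimes\iota)(\Delta(a)(1\otimes b))=(\iota\otimes\Delta)((c\otimes1)\Delta(a))(1\otimes1\otimes b)$$ for all $a,b,c\in A$. It is *regular* if also $\Delta(a)(b\otimes1)$ and $(1\otimes c)\Delta(a)$ lie in $A\otimes A$. It is *full* if, for subspaces $V,W\subseteq A$, $\Delta(A)(1\otimes A)\subseteq V\otimes A$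 implies $V=A$ and $(A\otimes1)\Delta(A)\subseteq A\otimes W$ implies $W=A$. An idempotent $E\in M(A\otimes A)$ is the *canonical idempotent* of $\Delta$ if $\Delta(A)(A\otimes A)=E(A\otimes A)$ and $(A\otimes A)\Delta(A)=(A\otimes A)E$. In that case $\Delta\otimes\iota$ is extended to the unique homomorphism $M(A\otimes A)\to M(A\otimes A\otimes A)$ with $(\Delta\otimes\iota)(m)=(E\otimes1)(\Delta\otimes\iota)(m)=(\Delta\otimes\iota)(m)(E\otimes1)$, and similarly $\iota\otimes\Delta$ with $1\otimes E$. Let $B,C\subseteq M(A)$ be subalgebras with $BA=AB=A$ and $CA=AC=A$, so that $M(B),M(C)\subseteq M(A)$ and $M(B\otimes C)\subseteq M(A\otimes A)$. An idempotent $E\in M(B\otimes C)$ is a *regular separability idempotent* if $E(1\otimes c)$, $(b\otimes 1)E$, $(1\otimes c)E$, $E(b\otimes1)$ lie in $B\otimes C$ for all $b\in B$, $c\in C$; if it is full (for subspaces $V\subseteq B$, $W\subseteq C$: $E(1\otimes C)\subseteq V\otimes C$ implies $V=B$, and $(B\otimes1)E\subseteq B\otimes W$ implies $W=C$); and if $E(B\otimes1)=E(1\otimes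 C)$ and $(B\otimes1)E=(1\otimes C)E$. A *left integral* is a non-zero linear functional $\varphi$ on $A$ with $(\iota\otimes\varphi)\Delta(a)\in M(C)$ for all $a\in A$; a *right integral* is a non-zero linear functional $\psi$ on $A$ with $(\psi\otimes\iota)\Delta(a)\in M(B)$ for all $a\in A$. There is a *faithful set of left integrals* if, for $a\in A$, we have $a=0$ whenever $\varphi(ab)=0$ for all $b\in A$ and all left integrals $\varphi$, and also $a=0$ whenever $\varphi(ba)=0$ for all such $b$ and $\varphi$; similarly for right integrals. A pair $(A,\Delta)$ is a *weak multiplier Hopf algebra* if $A$ is non-degenerate with $A=A^2$, $\Delta$ is a full coproduct, there is a counit (a linear functional $\varepsilon$ on $A$ with $(\varepsilon\otimes\iota)(\Delta(a)(1\otimes b))=ab=(\iota\otimes\varepsilon)((a\otimes1)\Delta(b))$ for all $a,b$), and there is an idempotent $E\in M(A\otimes A)$ such that, with $T_1(a\otimes b)=\Delta(a)(1\otimes b)$ and $T_2(a\otimes b)=(a\otimes1)\Delta(b)$, 1. $T_1(A\otimes A)=E(A\otimes A)$ and $T_2(A\otimes A)=(A\otimes A)E$; 2. $(\Delta\otimes\iota)E=(\iota\otimes\Delta)E=(1\otimes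 E)(E\otimes1)=(E\otimes1)(1\otimes E)$; 3. $\operatorname{Ker}T_1=(1-G_1)(A\otimes A)$ and $\operatorname{Ker}T_2=(1-G_2)(A\otimes A)$, where $G_1,G_2:A\otimes A\to A\otimes A$ are linear maps with $$(G_1\otimes\iota)(\Delta_{13}(a)(1\otimes b\otimes c))=\Delta_{13}(a)(1\otimes E)(1\otimes b\otimes c),\qquad(\iota\otimes G_2)((a\otimes b\otimes1)\Delta_{13}(c))=(a\otimes b\otimes1)(E\otimes1)\Delta_{13}(c)$$ for all $a,b,c\in A$. It is *regular* if $\Delta$ is regular and $(A,\Delta^{\mathrm{cop}})$, with $\Delta^{\mathrm{cop}}$ the composition of $\Delta$ with the flip, is also a weak multiplier Hopf algebra. **Theorem.** Let $A$ be a non-degenerate algebra with $A=A^2$ and let $\Delta$ be a full and regular coproduct on $A$. Assume that the canonical idempotent $E\in M(A\otimes A)$ of $\Delta$ exists and satisfies $$(\Delta\otimes\iota)E=(1\otimes E)(E\otimes1)=(E\otimes1)(1\otimes E),$$ and that there are subalgebras $B,C$ of $M(A)$ with $BA=AB=A$ and $CA=AC=A$ such that $E$ is a regular separability idempotent in $M(B\otimes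 C)$. If there are a faithful set of left integrals and a faithful set of right integrals, then $(A,\Delta)$ is a regular weak multiplier Hopf algebra. -/

import Mathlib

open scoped TensorProduct

noncomputable section

namespace WeakMultiplierHopf

section Multipliers

variable (A : Type*) [NonUnitalRing A] [Module ℂ A] [IsScalarTower ℂ A A] [SMulCommClass ℂ A A]

/-- The product of `A` is non-degenerate as a bilinear map. -/
def IsNondegenerateAlg : Prop :=
  (∀ a : A, (∀ b, a * b = 0) → a = 0) ∧ (∀ a : A, (∀ b, b * a = 0) → a = 0)

/-- `A = A²`: every element of `A` is a sum of products of two elements. -/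
def IsIdempotentAlg : Prop :=
  Submodule.span ℂ (Set.range fun p : A × A ↦ p.1 * p.2) = ⊤

/-- The multiplier algebra `M(A)`: pairs `(L, R)` of linear maps of `A` into itself with
`a (L b) = (R a) b`; here `L a` is thought of as `m a` and `R a` as `a m`. (For a non-degenerate
algebra `L` is then automatically a right module map and `R` a left module map.) The product is
composition in the first component and composition in the opposite order in the second one. -/
def multiplierAlgebra : Subalgebra ℂ (Module.End ℂ A × (Module.End ℂ A)ᵐᵒᵖ) where
  carrier := {m | ∀ a b : A, a * m.1 b = m.2.unop a * b}
  mul_mem' := by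
    intro m n hm hn a b
    change a * m.1 (n.1 b) = n.2.unop (m.2.unop a) * b
    rw [hm, hn]
  add_mem' := by
    intro m n hm hn a b
    change a * (m.1 b + n.1 b) = (m.2.unop a + n.2.unop a) * b
    rw [mul_add, add_mul, hm, hn]
  algebraMap_mem' := by
    intro r a b
    change a * (r • b) = (r • a) * b
    rw [mul_smul_comm, smul_mul_assoc]

/-- The multiplier algebra `M(A)` as a type (a unital complex algebra). -/
def Mult : Type _ := ↥(multiplierAlgebra A)

instance : Ring (Mult A) := inferInstanceAs (Ring ↥(multiplierAlgebra A))

instance : Algebra ℂ (Mult A) := inferInstanceAs (Algebra ℂ ↥(multiplierAlgebra A))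

variable {A}

/-- `m.lact a` is the element `m a` of `A`. -/
def Mult.lact (m : Mult A) : A →ₗ[ℂ] A := m.1.1

/-- `m.ract a` is the element `a m` of `A`. -/
def Mult.ract (m : Mult A) : A →ₗ[ℂ] A := m.1.2.unop

theorem Mult.compat (m : Mult A) (a b : A) : a * m.lact b = m.ract a * b := m.2 a b

variable (A)

/-- The canonical map of `A` into its multiplier algebra, injective when `A` is non-degenerate. -/
def toMult : A →ₗ[ℂ] Mult A where
  toFun a := ⟨(LinearMap.mulLeft ℂ a, MulOpposite.op (LinearMap.mulRight ℂ a)), by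
    intro x y
    change x * (a * y) = (x * a) * y
    rw [mul_assoc]⟩
  map_add' a b := by
    apply Subtype.ext
    refine Prod.ext ?_ (MulOpposite.unop_injective ?_)
    · ext x; exact add_mul a b x
    · ext x; exact mul_add x a b
  map_smul' r a := by
    apply Subtype.ext
    refine Prod.ext ?_ (MulOpposite.unop_injective ?_)
    · ext x; exact smul_mul_assoc r a x
    · ext x; exact mul_smul_comm r x a

variable {A}
variable {B : Type*} [NonUnitalRing B] [Module ℂ B] [IsScalarTower ℂ B B] [SMulCommClass ℂ B B]

/-- The inclusion `M(A) ⊗ M(B) ⊆ M(A ⊗ B)` as a bilinear map: `tens x y` is `x ⊗ y`. -/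
def tens : Mult A →ₗ[ℂ] Mult B →ₗ[ℂ] Mult (A ⊗[ℂ] B) :=
  LinearMap.mk₂ ℂ
    (fun x y ↦ ⟨(TensorProduct.map x.lact y.lact,
        MulOpposite.op (TensorProduct.map x.ract y.ract)), by
      intro s t
      change s * TensorProduct.map x.lact y.lact t = TensorProduct.map x.ract y.ract s * t
      induction s using TensorProduct.induction_on with
      | zero => simp
      | add s₁ s₂ h₁ h₂ => rw [add_mul, h₁, h₂, map_add, add_mul]
      | tmul a b =>
        induction t using TensorProduct.induction_on with
        | zero => simp
        | add t₁ t₂ h₁ h₂ => rw [map_add, mul_add, h₁, h₂, mul_add]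
        | tmul c d =>
          rw [TensorProduct.map_tmul, TensorProduct.map_tmul,
            Algebra.TensorProduct.tmul_mul_tmul, Algebra.TensorProduct.tmul_mul_tmul,
            x.compat, y.compat]⟩)
    (fun x x' y ↦ by
      apply Subtype.ext
      exact Prod.ext (TensorProduct.map_add_left x.lact x'.lact y.lact)
        (MulOpposite.unop_injective (TensorProduct.map_add_left x.ract x'.ract y.ract)))
    (fun r x y ↦ by
      apply Subtype.ext
      exact Prod.ext (TensorProduct.map_smul_left r x.lact y.lact)
        (MulOpposite.unop_injective (TensorProduct.map_smul_left r x.ract y.ract)))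
    (fun x y y' ↦ by
      apply Subtype.ext
      exact Prod.ext (TensorProduct.map_add_right x.lact y.lact y'.lact)
        (MulOpposite.unop_injective (TensorProduct.map_add_right x.ract y.ract y'.ract)))
    (fun r x y ↦ by
      apply Subtype.ext
      exact Prod.ext (TensorProduct.map_smul_right r x.lact y.lact)
        (MulOpposite.unop_injective (TensorProduct.map_smul_right r x.ract y.ract)))

/-- A multiplicative linear bijection `A → B`, extended to the multiplier algebras. -/
def transport (e : A ≃ₗ[ℂ] B) (he : ∀ x y, e (x * y) = e x * e y) : Mult A →ₐ[ℂ] Mult B :=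
  AlgHom.ofLinearMap
    { toFun := fun m ↦ ⟨(e.conj m.lact, MulOpposite.op (e.conj m.ract)), by
        intro a b
        change a * e (m.lact (e.symm b)) = e (m.ract (e.symm a)) * b
        have h := congrArg e (m.compat (e.symm a) (e.symm b))
        rwa [he, he, e.apply_symm_apply, e.apply_symm_apply] at h⟩
      map_add' := fun m n ↦ by
        apply Subtype.ext
        exact Prod.ext (map_add e.conj m.lact n.lact)
          (MulOpposite.unop_injective (map_add e.conj m.ract n.ract))
      map_smul' := fun r m ↦ by
        apply Subtype.ext
        exact Prod.ext (map_smul e.conj r m.lact)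
          (MulOpposite.unop_injective (map_smul e.conj r m.ract)) }
    (by
      apply Subtype.ext
      exact Prod.ext e.conj_id (MulOpposite.unop_injective e.conj_id))
    (fun m n ↦ by
      apply Subtype.ext
      exact Prod.ext (e.conj_comp n.lact m.lact)
        (MulOpposite.unop_injective (e.conj_comp m.ract n.ract)))

end Multipliers

section Legs

variable (A : Type*) [NonUnitalRing A] [Module ℂ A] [IsScalarTower ℂ A A] [SMulCommClass ℂ A A]

theorem comm_mul (s t : A ⊗[ℂ] A) :
    TensorProduct.comm ℂ A A (s * t) = TensorProduct.comm ℂ A A s * TensorProduct.comm ℂ A A t := by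
  induction s using TensorProduct.induction_on with
  | zero => simp
  | add s₁ s₂ h₁ h₂ => rw [add_mul, map_add, h₁, h₂, map_add, add_mul]
  | tmul a b =>
    induction t using TensorProduct.induction_on with
    | zero => simp
    | add t₁ t₂ h₁ h₂ => rw [mul_add, map_add, h₁, h₂, map_add, mul_add]
    | tmul c d => simp

theorem rightComm_mul (s t : (A ⊗[ℂ] A) ⊗[ℂ] A) :
    TensorProduct.rightComm ℂ A A A (s * t) =
      TensorProduct.rightComm ℂ A A A s * TensorProduct.rightComm ℂ A A A t := by
  have key : ∀ (u v : A ⊗[ℂ] A) (a b : A),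
      TensorProduct.rightComm ℂ A A A ((u ⊗ₜ a) * (v ⊗ₜ b)) =
      TensorProduct.rightComm ℂ A A A (u ⊗ₜ a) * TensorProduct.rightComm ℂ A A A (v ⊗ₜ b) := by
    intro u v a b
    induction u using TensorProduct.induction_on with
    | zero => simp
    | add s₁ s₂ h₁ h₂ => rw [TensorProduct.add_tmul, add_mul, map_add, h₁, h₂, map_add, add_mul]
    | tmul x y =>
      induction v using TensorProduct.induction_on with
      | zero => simp
      | add t₁ t₂ h₁ h₂ => rw [TensorProduct.add_tmul, mul_add, map_add, h₁, h₂, map_add, mul_add]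
      | tmul c d => simp
  induction s using TensorProduct.induction_on with
  | zero => simp
  | add s₁ s₂ h₁ h₂ => rw [add_mul, map_add, h₁, h₂, map_add, add_mul]
  | tmul a b =>
    induction t using TensorProduct.induction_on with
    | zero => simp
    | add t₁ t₂ h₁ h₂ => rw [mul_add, map_add, h₁, h₂, map_add, mul_add]
    | tmul c d => exact key a c b d

theorem assoc_symm_mul (s t : A ⊗[ℂ] (A ⊗[ℂ] A)) :
    (TensorProduct.assoc ℂ A A A).symm (s * t) =
      (TensorProduct.assoc ℂ A A A).symm s * (TensorProduct.assoc ℂ A A A).symm t := by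
  have key : ∀ (u v : A ⊗[ℂ] A) (a b : A),
      (TensorProduct.assoc ℂ A A A).symm ((a ⊗ₜ u) * (b ⊗ₜ v)) =
      (TensorProduct.assoc ℂ A A A).symm (a ⊗ₜ u) *
        (TensorProduct.assoc ℂ A A A).symm (b ⊗ₜ v) := by
    intro u v a b
    induction u using TensorProduct.induction_on with
    | zero => simp
    | add s₁ s₂ h₁ h₂ => rw [TensorProduct.tmul_add, add_mul, map_add, h₁, h₂, map_add, add_mul]
    | tmul x y =>
      induction v using TensorProduct.induction_on with
      | zero => simp
      | add t₁ t₂ h₁ h₂ => rw [TensorProduct.tmul_add, mul_add, map_add, h₁, h₂, map_add, mul_add]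
      | tmul c d => simp
  induction s using TensorProduct.induction_on with
  | zero => simp
  | add s₁ s₂ h₁ h₂ => rw [add_mul, map_add, h₁, h₂, map_add, add_mul]
  | tmul a b =>
    induction t using TensorProduct.induction_on with
    | zero => simp
    | add t₁ t₂ h₁ h₂ => rw [mul_add, map_add, h₁, h₂, map_add, mul_add]
    | tmul c d => exact key b d a c

variable {A}

/-- The flip `ζ` of `M(A ⊗ A)`. -/
def flipMult : Mult (A ⊗[ℂ] A) →ₐ[ℂ] Mult (A ⊗[ℂ] A) :=
  transport (TensorProduct.comm ℂ A A) (comm_mul A)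

/-- The identification of `M(A ⊗ (A ⊗ A))` with `M((A ⊗ A) ⊗ A)`. The latter is used as the
standard model of `M(A ⊗ A ⊗ A)`. -/
def reassoc : Mult (A ⊗[ℂ] (A ⊗[ℂ] A)) →ₐ[ℂ] Mult ((A ⊗[ℂ] A) ⊗[ℂ] A) :=
  transport (TensorProduct.assoc ℂ A A A).symm (assoc_symm_mul A)

/-- `m₁₂ = m ⊗ 1`. -/
def leg₁₂ (m : Mult (A ⊗[ℂ] A)) : Mult ((A ⊗[ℂ] A) ⊗[ℂ] A) := tens m 1

/-- `m₂₃ = 1 ⊗ m`. -/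
def leg₂₃ (m : Mult (A ⊗[ℂ] A)) : Mult ((A ⊗[ℂ] A) ⊗[ℂ] A) := reassoc (tens 1 m)

/-- `m₁₃`: the first leg of `m` sits in the first factor, the second leg in the third factor. -/
def leg₁₃ (m : Mult (A ⊗[ℂ] A)) : Mult ((A ⊗[ℂ] A) ⊗[ℂ] A) :=
  transport (A := (A ⊗[ℂ] A) ⊗[ℂ] A) (B := (A ⊗[ℂ] A) ⊗[ℂ] A)
    (TensorProduct.rightComm ℂ A A A) (by exact rightComm_mul A) (tens m 1)

/-- `a ⊗ 1` in `M(A ⊗ A)`. -/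
def inl (a : A) : Mult (A ⊗[ℂ] A) := tens (toMult A a) 1

/-- `1 ⊗ a` in `M(A ⊗ A)`. -/
def inr (a : A) : Mult (A ⊗[ℂ] A) := tens 1 (toMult A a)

/-- The element `a ⊗ b ⊗ 1` of `M(A ⊗ A ⊗ A)`. -/
def in₁₂ (a b : A) : Mult ((A ⊗[ℂ] A) ⊗[ℂ] A) := leg₁₂ (toMult (A ⊗[ℂ] A) (a ⊗ₜ b))

/-- The element `1 ⊗ b ⊗ c` of `M(A ⊗ A ⊗ A)`. -/
def in₂₃ (b c : A) : Mult ((A ⊗[ℂ] A) ⊗[ℂ] A) := leg₂₃ (toMult (A ⊗[ℂ] A) (b ⊗ₜ c))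

/-- The slice map `ω ⊗ ι : A ⊗ A → A`. -/
def sliceFst (ω : A →ₗ[ℂ] ℂ) : A ⊗[ℂ] A →ₗ[ℂ] A :=
  (TensorProduct.lid ℂ A).toLinearMap ∘ₗ ω.rTensor A

/-- The slice map `ι ⊗ ω : A ⊗ A → A`. -/
def sliceSnd (ω : A →ₗ[ℂ] ℂ) : A ⊗[ℂ] A →ₗ[ℂ] A :=
  (TensorProduct.rid ℂ A).toLinearMap ∘ₗ ω.lTensor A

end Legs

section Coproducts

variable {A : Type*} [NonUnitalRing A] [Module ℂ A] [IsScalarTower ℂ A A] [SMulCommClass ℂ A A]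
variable (Δ : A →ₙₐ[ℂ] Mult (A ⊗[ℂ] A))

/-- The canonical map `T₁(a ⊗ b) = Δ(a)(1 ⊗ b)`. -/
def canT₁ : A ⊗[ℂ] A →ₗ[ℂ] Mult (A ⊗[ℂ] A) :=
  LinearMap.mul' ℂ _ ∘ₗ TensorProduct.map (Δ : A →ₗ[ℂ] _) (tens 1 ∘ₗ toMult A)

/-- The canonical map `T₂(c ⊗ a) = (c ⊗ 1)Δ(a)`. -/
def canT₂ : A ⊗[ℂ] A →ₗ[ℂ] Mult (A ⊗[ℂ] A) :=
  LinearMap.mul' ℂ _ ∘ₗ TensorProduct.map ((tens.flip 1) ∘ₗ toMult A) (Δ : A →ₗ[ℂ] _)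

/-- The map `Δ ⊗ ι : A ⊗ A → M(A ⊗ A ⊗ A)`. -/
def deltaId : A ⊗[ℂ] A →ₗ[ℂ] Mult ((A ⊗[ℂ] A) ⊗[ℂ] A) :=
  TensorProduct.lift (tens.compl₁₂ (Δ : A →ₗ[ℂ] _) (toMult A))

/-- The map `ι ⊗ Δ : A ⊗ A → M(A ⊗ A ⊗ A)`. -/
def idDelta : A ⊗[ℂ] A →ₗ[ℂ] Mult ((A ⊗[ℂ] A) ⊗[ℂ] A) :=
  reassoc.toLinearMap ∘ₗ TensorProduct.lift (tens.compl₁₂ (toMult A) (Δ : A →ₗ[ℂ] _))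

/-- A coproduct on `A`: a homomorphism `Δ : A → M(A ⊗ A)` such that `Δ(a)(1 ⊗ b)` and
`(c ⊗ 1)Δ(a)` belong to `A ⊗ A`, and which is coassociative in the sense that
`(c ⊗ 1 ⊗ 1)(Δ ⊗ ι)(Δ(a)(1 ⊗ b)) = (ι ⊗ Δ)((c ⊗ 1)Δ(a))(1 ⊗ 1 ⊗ b)`. In the last condition `t` and
`u` are the elements `Δ(a)(1 ⊗ b)` and `(c ⊗ 1)Δ(a)` of `A ⊗ A`. -/
structure IsCoproduct : Prop where
  mem₁ : ∀ a b : A, Δ a * inr b ∈ LinearMap.range (toMult (A ⊗[ℂ] A))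
  mem₂ : ∀ c a : A, inl c * Δ a ∈ LinearMap.range (toMult (A ⊗[ℂ] A))
  coassoc : ∀ (a b c : A) (t u : A ⊗[ℂ] A),
    toMult (A ⊗[ℂ] A) t = Δ a * inr b → toMult (A ⊗[ℂ] A) u = inl c * Δ a →
      leg₁₂ (inl c) * deltaId Δ t = idDelta Δ u * leg₂₃ (inr b)

/-- Regularity of a coproduct: also `Δ(a)(b ⊗ 1)` and `(1 ⊗ c)Δ(a)` belong to `A ⊗ A`. -/
structure IsRegularCoproduct : Prop extends IsCoproduct Δ where
  mem₃ : ∀ c a : A, inr c * Δ a ∈ LinearMap.range (toMult (A ⊗[ℂ] A))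
  mem₄ : ∀ a b : A, Δ a * inl b ∈ LinearMap.range (toMult (A ⊗[ℂ] A))

/-- The coproduct is full: if `Δ(A)(1 ⊗ A) ⊆ V ⊗ A` then `V = A`, and if `(A ⊗ 1)Δ(A) ⊆ A ⊗ W` then
`W = A`, for all subspaces `V`, `W` of `A`. -/
structure IsFull : Prop where
  left : ∀ V : Submodule ℂ A,
    (∀ a b : A, Δ a * inr b ∈
      (Submodule.map₂ (TensorProduct.mk ℂ A A) V ⊤).map (toMult (A ⊗[ℂ] A))) → V = ⊤
  right : ∀ W : Submodule ℂ A,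
    (∀ c a : A, inl c * Δ a ∈
      (Submodule.map₂ (TensorProduct.mk ℂ A A) ⊤ W).map (toMult (A ⊗[ℂ] A))) → W = ⊤

/-- A counit: `(ε ⊗ ι)(Δ(a)(1 ⊗ b)) = ab` and `(ι ⊗ ε)((a ⊗ 1)Δ(b)) = ab`. -/
structure IsCounit (ε : A →ₗ[ℂ] ℂ) : Prop where
  left : ∀ (a b : A) (t : A ⊗[ℂ] A), toMult (A ⊗[ℂ] A) t = Δ a * inr b → sliceFst ε t = a * b
  right : ∀ (a b : A) (t : A ⊗[ℂ] A), toMult (A ⊗[ℂ] A) t = inl a * Δ b → sliceSnd ε t = a * b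

/-- `E` is the canonical idempotent of `Δ`: it is idempotent, `Δ(A)(A ⊗ A) = E(A ⊗ A)` and
`(A ⊗ A)Δ(A) = (A ⊗ A)E`, where the left hand sides denote linear spans of products. -/
structure IsCanonicalIdempotent (E : Mult (A ⊗[ℂ] A)) : Prop where
  idem : E * E = E
  left : Submodule.span ℂ (Set.range fun p : A × (A ⊗[ℂ] A) ↦ (Δ p.1).lact p.2) =
    LinearMap.range E.lact
  right : Submodule.span ℂ (Set.range fun p : A × (A ⊗[ℂ] A) ↦ (Δ p.1).ract p.2) =
    LinearMap.range E.ract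

/-- `X = (Δ ⊗ ι)(m)`, the value at the multiplier `m` of the extension of the homomorphism `Δ ⊗ ι`
to `M(A ⊗ A)`, where `E` is the canonical idempotent. This extension is determined by multiplicativity,
`(Δ ⊗ ι)(m)(Δ ⊗ ι)(t) = (Δ ⊗ ι)(mt)` and `(Δ ⊗ ι)(t)(Δ ⊗ ι)(m) = (Δ ⊗ ι)(tm)` for `t ∈ A ⊗ A`,
together with the normalization `(Δ ⊗ ι)(m) = (E ⊗ 1)(Δ ⊗ ι)(m) = (Δ ⊗ ι)(m)(E ⊗ 1)`. -/
structure IsDeltaIdValue (E m : Mult (A ⊗[ℂ] A)) (X : Mult ((A ⊗[ℂ] A) ⊗[ℂ] A)) : Prop where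
  unit_mul : leg₁₂ E * X = X
  mul_unit : X * leg₁₂ E = X
  mul_apply : ∀ t : A ⊗[ℂ] A, X * deltaId Δ t = deltaId Δ (m.lact t)
  apply_mul : ∀ t : A ⊗[ℂ] A, deltaId Δ t * X = deltaId Δ (m.ract t)

/-- `X = (ι ⊗ Δ)(m)`, the value at the multiplier `m` of the extension of the homomorphism `ι ⊗ Δ`
to `M(A ⊗ A)` with `(ι ⊗ Δ)(m) = (1 ⊗ E)(ι ⊗ Δ)(m) = (ι ⊗ Δ)(m)(1 ⊗ E)`. -/
structure IsIdDeltaValue (E m : Mult (A ⊗[ℂ] A)) (X : Mult ((A ⊗[ℂ] A) ⊗[ℂ] A)) : Prop where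
  unit_mul : leg₂₃ E * X = X
  mul_unit : X * leg₂₃ E = X
  mul_apply : ∀ t : A ⊗[ℂ] A, X * idDelta Δ t = idDelta Δ (m.lact t)
  apply_mul : ∀ t : A ⊗[ℂ] A, idDelta Δ t * X = idDelta Δ (m.ract t)

/-- The opposite coproduct `Δᶜᵒᵖ = ζ ∘ Δ`. -/
def coopposite : A →ₙₐ[ℂ] Mult (A ⊗[ℂ] A) :=
  ((flipMult (A := A) : Mult (A ⊗[ℂ] A) →ₐ[ℂ] Mult (A ⊗[ℂ] A)) :
    Mult (A ⊗[ℂ] A) →ₙₐ[ℂ] Mult (A ⊗[ℂ] A)).comp Δ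

end Coproducts

section Separability

variable {A : Type*} [NonUnitalRing A] [Module ℂ A] [IsScalarTower ℂ A A] [SMulCommClass ℂ A A]

/-- The subalgebra `B` of `M(A)` sits in `M(A)` in a non-degenerate way: `BA = A = AB`. -/
structure SitsNondegenerately (B : NonUnitalSubalgebra ℂ (Mult A)) : Prop where
  left : Submodule.span ℂ {x : A | ∃ b ∈ B, ∃ a : A, b.lact a = x} = ⊤
  right : Submodule.span ℂ {x : A | ∃ b ∈ B, ∃ a : A, b.ract a = x} = ⊤

/-- The subspace `V ⊗ W` of `M(A) ⊗ M(A) ⊆ M(A ⊗ A)`, for subspaces `V` and `W` of `M(A)`. -/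
def tensSub (V W : Submodule ℂ (Mult A)) : Submodule ℂ (Mult (A ⊗[ℂ] A)) :=
  Submodule.map₂ tens V W

/-- The multiplier algebra of a subalgebra `S` of `R`, for `R` the multiplier algebra of an algebra in
which `S` sits non-degenerately. It is considered as a part of `R`: the elements `x` of `R` with
`xS ⊆ S` and `Sx ⊆ S`. -/
def multipliersIn {R : Type*} [Ring R] [Algebra ℂ R] (S : Submodule ℂ R) : Set R :=
  {x | ∀ s ∈ S, x * s ∈ S ∧ s * x ∈ S}

/-- `E` is a regular separability idempotent in `M(B ⊗ C) ⊆ M(A ⊗ A)`: an idempotent in `M(B ⊗ C)`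
such that `E(1 ⊗ c)`, `(b ⊗ 1)E`, `(1 ⊗ c)E`, `E(b ⊗ 1)` all belong to `B ⊗ C`, which is full (the left
leg is all of `B` and the right leg is all of `C`), and such that `E(B ⊗ 1) = E(1 ⊗ C)` and
`(B ⊗ 1)E = (1 ⊗ C)E`. -/
structure IsRegularSeparabilityIdempotent (B C : NonUnitalSubalgebra ℂ (Mult A))
    (E : Mult (A ⊗[ℂ] A)) : Prop where
  idem : E * E = E
  mem : E ∈ multipliersIn (tensSub B.toSubmodule C.toSubmodule)
  mul_right_mem : ∀ c ∈ C, E * tens 1 c ∈ tensSub B.toSubmodule C.toSubmodule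
  left_mul_mem : ∀ b ∈ B, tens b 1 * E ∈ tensSub B.toSubmodule C.toSubmodule
  right_mul_mem : ∀ c ∈ C, tens 1 c * E ∈ tensSub B.toSubmodule C.toSubmodule
  mul_left_mem : ∀ b ∈ B, E * tens b 1 ∈ tensSub B.toSubmodule C.toSubmodule
  full_left : ∀ V : Submodule ℂ (Mult A), V ≤ B.toSubmodule →
    (∀ c ∈ C, E * tens 1 c ∈ tensSub V C.toSubmodule) → V = B.toSubmodule
  full_right : ∀ W : Submodule ℂ (Mult A), W ≤ C.toSubmodule →
    (∀ b ∈ B, tens b 1 * E ∈ tensSub B.toSubmodule W) → W = C.toSubmodule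
  mul_eq : {x | ∃ b ∈ B, x = E * tens b 1} = {x | ∃ c ∈ C, x = E * tens 1 c}
  eq_mul : {x | ∃ b ∈ B, x = tens b 1 * E} = {x | ∃ c ∈ C, x = tens 1 c * E}

end Separability

section Integrals

variable {A : Type*} [NonUnitalRing A] [Module ℂ A] [IsScalarTower ℂ A A] [SMulCommClass ℂ A A]
variable (Δ : A →ₙₐ[ℂ] Mult (A ⊗[ℂ] A))

/-- `y = (ι ⊗ φ)Δ(a)` in `M(A)`: `yc = (ι ⊗ φ)(Δ(a)(c ⊗ 1))` and `cy = (ι ⊗ φ)((c ⊗ 1)Δ(a))` for all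
`c ∈ A`. -/
def IsSliceSnd (φ : A →ₗ[ℂ] ℂ) (a : A) (y : Mult A) : Prop :=
  ∀ (c : A) (t : A ⊗[ℂ] A),
    (toMult (A ⊗[ℂ] A) t = Δ a * inl c → y.lact c = sliceSnd φ t) ∧
    (toMult (A ⊗[ℂ] A) t = inl c * Δ a → y.ract c = sliceSnd φ t)

/-- `x = (ψ ⊗ ι)Δ(a)` in `M(A)`: `xc = (ψ ⊗ ι)(Δ(a)(1 ⊗ c))` and `cx = (ψ ⊗ ι)((1 ⊗ c)Δ(a))` for all
`c ∈ A`. -/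
def IsSliceFst (ψ : A →ₗ[ℂ] ℂ) (a : A) (x : Mult A) : Prop :=
  ∀ (c : A) (t : A ⊗[ℂ] A),
    (toMult (A ⊗[ℂ] A) t = Δ a * inr c → x.lact c = sliceFst ψ t) ∧
    (toMult (A ⊗[ℂ] A) t = inr c * Δ a → x.ract c = sliceFst ψ t)

/-- A left integral: a non-zero functional `φ` with `(ι ⊗ φ)Δ(a) ∈ A_t = M(C)` for all `a`. -/
structure IsLeftIntegral (C : NonUnitalSubalgebra ℂ (Mult A)) (φ : A →ₗ[ℂ] ℂ) : Prop where
  ne_zero : φ ≠ 0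
  invariant : ∀ a : A, ∃ y ∈ multipliersIn C.toSubmodule, IsSliceSnd Δ φ a y

/-- A right integral: a non-zero functional `ψ` with `(ψ ⊗ ι)Δ(a) ∈ A_s = M(B)` for all `a`. -/
structure IsRightIntegral (B : NonUnitalSubalgebra ℂ (Mult A)) (ψ : A →ₗ[ℂ] ℂ) : Prop where
  ne_zero : ψ ≠ 0
  invariant : ∀ a : A, ∃ x ∈ multipliersIn B.toSubmodule, IsSliceFst Δ ψ a x

/-- A set `S` of functionals on `A` is faithful: `a = 0` as soon as `φ(ab) = 0` for all `b ∈ A` and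
`φ ∈ S`, and also as soon as `φ(ba) = 0` for all `b ∈ A` and `φ ∈ S`. -/
def IsFaithfulSet (S : Set (A →ₗ[ℂ] ℂ)) : Prop :=
  (∀ a : A, (∀ φ ∈ S, ∀ b, φ (a * b) = 0) → a = 0) ∧
  (∀ a : A, (∀ φ ∈ S, ∀ b, φ (b * a) = 0) → a = 0)

end Integrals

section WeakMultiplierHopfAlgebras

variable {A : Type*} [NonUnitalRing A] [Module ℂ A] [IsScalarTower ℂ A A] [SMulCommClass ℂ A A]
variable (Δ : A →ₙₐ[ℂ] Mult (A ⊗[ℂ] A))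

/-- The linear map `G` of `A ⊗ A` into itself is the map `G₁` associated with `Δ` and `E`:
`(G₁ ⊗ ι)(Δ₁₃(a)(1 ⊗ b ⊗ c)) = Δ₁₃(a)(1 ⊗ E)(1 ⊗ b ⊗ c)`. Here `w` is the element
`Δ₁₃(a)(1 ⊗ b ⊗ c)` of `A ⊗ A ⊗ A`. -/
def IsG₁ (E : Mult (A ⊗[ℂ] A)) (G : A ⊗[ℂ] A →ₗ[ℂ] A ⊗[ℂ] A) : Prop :=
  ∀ (a b c : A) (w : (A ⊗[ℂ] A) ⊗[ℂ] A),
    toMult _ w = leg₁₃ (Δ a) * in₂₃ b c →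
      toMult _ (G.rTensor A w) = leg₁₃ (Δ a) * leg₂₃ E * in₂₃ b c

/-- The linear map `G` of `A ⊗ A` into itself is the map `G₂` associated with `Δ` and `E`:
`(ι ⊗ G₂)((a ⊗ b ⊗ 1)Δ₁₃(c)) = (a ⊗ b ⊗ 1)(E ⊗ 1)Δ₁₃(c)`. Here `w` is the element
`(a ⊗ b ⊗ 1)Δ₁₃(c)` of `A ⊗ A ⊗ A`. -/
def IsG₂ (E : Mult (A ⊗[ℂ] A)) (G : A ⊗[ℂ] A →ₗ[ℂ] A ⊗[ℂ] A) : Prop :=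
  ∀ (a b c : A) (w : (A ⊗[ℂ] A) ⊗[ℂ] A),
    toMult _ w = in₁₂ a b * leg₁₃ (Δ c) →
      toMult _ ((TensorProduct.assoc ℂ A A A).symm
        (G.lTensor A (TensorProduct.assoc ℂ A A A w))) = in₁₂ a b * leg₁₂ E * leg₁₃ (Δ c)

/-- `(A, Δ)` is a weak multiplier Hopf algebra (Van Daele and Wang): `A` is a non-degenerate idempotent
algebra with a full coproduct `Δ`, there is a counit, and there is an idempotent `E ∈ M(A ⊗ A)` with
* `T₁(A ⊗ A) = E(A ⊗ A)` and `T₂(A ⊗ A) = (A ⊗ A)E`,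
* `(Δ ⊗ ι)E = (ι ⊗ Δ)E = (1 ⊗ E)(E ⊗ 1) = (E ⊗ 1)(1 ⊗ E)`,
* `Ker T₁ = (1 - G₁)(A ⊗ A)` and `Ker T₂ = (1 - G₂)(A ⊗ A)`, with `G₁`, `G₂` as above. -/
structure IsWeakMultiplierHopfAlgebra : Prop where
  nondegenerate : IsNondegenerateAlg A
  idempotent : IsIdempotentAlg A
  coproduct : IsCoproduct Δ
  full : IsFull Δ
  counit : ∃ ε : A →ₗ[ℂ] ℂ, IsCounit Δ ε
  canonical : ∃ E : Mult (A ⊗[ℂ] A), E * E = E ∧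
    LinearMap.range (canT₁ Δ) = (LinearMap.range E.lact).map (toMult (A ⊗[ℂ] A)) ∧
    LinearMap.range (canT₂ Δ) = (LinearMap.range E.ract).map (toMult (A ⊗[ℂ] A)) ∧
    leg₂₃ E * leg₁₂ E = leg₁₂ E * leg₂₃ E ∧
    IsDeltaIdValue Δ E E (leg₂₃ E * leg₁₂ E) ∧
    IsIdDeltaValue Δ E E (leg₂₃ E * leg₁₂ E) ∧
    (∃ G₁ : A ⊗[ℂ] A →ₗ[ℂ] A ⊗[ℂ] A, IsG₁ Δ E G₁ ∧
      LinearMap.ker (canT₁ Δ) = LinearMap.range (LinearMap.id - G₁)) ∧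
    (∃ G₂ : A ⊗[ℂ] A →ₗ[ℂ] A ⊗[ℂ] A, IsG₂ Δ E G₂ ∧
      LinearMap.ker (canT₂ Δ) = LinearMap.range (LinearMap.id - G₂))

/-- `(A, Δ)` is a regular weak multiplier Hopf algebra: the coproduct is regular and both `(A, Δ)` and
`(A, Δᶜᵒᵖ)` are weak multiplier Hopf algebras. -/
structure IsRegularWeakMultiplierHopfAlgebra : Prop where
  regular : IsRegularCoproduct Δ
  isWMHA : IsWeakMultiplierHopfAlgebra Δ
  isWMHA_cop : IsWeakMultiplierHopfAlgebra (coopposite Δ)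

end WeakMultiplierHopfAlgebras

end WeakMultiplierHopf

end

/-!
A regular weak multiplier Hopf algebra is described by the four maps `Δ(a)(1 ⊗ b)`, `Δ(a)(b ⊗ 1)`,
`(b ⊗ 1)Δ(a)` and `(1 ⊗ b)Δ(a)`. All that has to be shown about one of them is shown once, for an
abstract `OneSidedDatum`, which records what is visible of `Δ`, `E`, `B` and `C` when everything is
multiplied from one side. Its product is an explicit bilinear map, and the notion is closed under
passage to the opposite coproduct (`OneSidedDatum.cop`); so left multiplications
(`SeparableSetting.left`), right multiplications (`SeparableSetting.right`) and their opposites cover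
all four maps.

Two facts on a regular separability idempotent carry the argument. There is an anti-isomorphism
`σ : B → C` with `E(b ⊗ 1) = E(1 ⊗ σ(b))` (`SeparabilityDatum.antipode`), and a functional `φ_C` on `C`
with `(ι ⊗ φ_C)E = 1` (`SeparabilityDatum.functionalC`). That the legs of `E` behave well under the
coproduct, `Δ(bx) = (1 ⊗ b)Δ(x)` and the like, follows from the value of `(Δ ⊗ ι)E` and fullness of `E`
(`SeparableSetting.coproduct_lact_left` and the three lemmas after it).

*The range of `T₁`.* For a left integral `φ` put `Y(a) = (ι ⊗ φ)Δ(a)`, which acts as an element of `C`.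
Coassociativity gives `(ι ⊗ Y)Δ(a) = Δ(Y(a)) = (Y(a) ⊗ 1)E`, whence `φ = φ_C ∘ Y`
(`OneSidedDatum.functionalC_slice`). It follows that `E(x ⊗ z)` belongs to `Δ(A)(1 ⊗ A)` for
`x = (ι ⊗ φ)(Δ(a)(1 ⊗ b))`. Such elements span `A` by faithfulness of the left integrals and fullness of
`Δ`, so that `T₁(A ⊗ A) = E(A ⊗ A)` (`OneSidedDatum.range_E_le`).

*The kernel of `T₁`.* The map `G₁` is `x ⊗ by ↦ ∑ xσ⁻¹(v) ⊗ uy`, where `E(b ⊗ 1) = ∑ u ⊗ v`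
(`OneSidedDatum.exists_G`). Clearly `T₁ G₁ = T₁`. Conversely, for a right integral `ψ` the slice
`(ψ(a ·) ⊗ ι)G₁(t)` is a function of `T₁(t)`, because `ψ` too is recovered from a distinguished
functional; so `T₁(t) = 0` forces `G₁(t) = 0` by faithfulness of the right integrals
(`OneSidedDatum.ker_can`).

*The counit.* The product factors as `μ ∘ T₁`, as it is invariant under `G₁`. The map `ε_t` given by
`ε_t(x)z = μ(E(x ⊗ z))` takes values in `C`, and `φ_C ∘ ε_t` is a left counit
(`OneSidedDatum.exists_counit`); by coassociativity and fullness it is a right counit as well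
(`CanonicalMaps.exists_isCounit`).

The remaining condition, on the value of `(ι ⊗ Δ)E`, comes from that of `(Δ ⊗ ι)E` by coassociativity
(`CoproductSetting.idDelta_value`). No antipode of `A` is needed.
-/


noncomputable section

namespace WeakMultiplierHopf

/-! ### Slice maps and linear algebra of tensor products -/

section LinearAlgebra

variable {U V W X : Type*} [AddCommGroup U] [Module ℂ U] [AddCommGroup V] [Module ℂ V]
  [AddCommGroup W] [Module ℂ W] [AddCommGroup X] [Module ℂ X]

/-- The slice map `f ⊗ ι : V ⊗ W → W`, for a functional `f` on `V`. -/
def slice₁ (f : V →ₗ[ℂ] ℂ) : V ⊗[ℂ] W →ₗ[ℂ] W :=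
  (TensorProduct.lid ℂ W).toLinearMap ∘ₗ f.rTensor W

/-- The slice map `ι ⊗ g : V ⊗ W → V`, for a functional `g` on `W`. -/
def slice₂ (g : W →ₗ[ℂ] ℂ) : V ⊗[ℂ] W →ₗ[ℂ] V :=
  (TensorProduct.rid ℂ V).toLinearMap ∘ₗ g.lTensor V

@[simp] theorem slice₁_tmul (f : V →ₗ[ℂ] ℂ) (v : V) (w : W) : slice₁ f (v ⊗ₜ[ℂ] w) = f v • w := by
  simp [slice₁]

@[simp] theorem slice₂_tmul (g : W →ₗ[ℂ] ℂ) (v : V) (w : W) : slice₂ g (v ⊗ₜ[ℂ] w) = g w • v := by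
  simp [slice₂]

/-- Two linear maps out of a tensor product agree at `t` when they agree on pure tensors. -/
theorem tensor_congr {F G : V ⊗[ℂ] W →ₗ[ℂ] X} (h : ∀ v w, F (v ⊗ₜ w) = G (v ⊗ₜ w))
    (t : V ⊗[ℂ] W) : F t = G t :=
  LinearMap.congr_fun (TensorProduct.ext' h) t

@[simp] theorem slice₁_zero_left (t : V ⊗[ℂ] W) : slice₁ (0 : V →ₗ[ℂ] ℂ) t = 0 := by
  simp [slice₁]

theorem slice₁_add_left (f g : V →ₗ[ℂ] ℂ) (t : V ⊗[ℂ] W) :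
    slice₁ (f + g) t = slice₁ f t + slice₁ g t := by
  simp [slice₁, LinearMap.rTensor_add]

theorem slice₁_smul_left (r : ℂ) (f : V →ₗ[ℂ] ℂ) (t : V ⊗[ℂ] W) :
    slice₁ (r • f) t = r • slice₁ f t := by
  simp [slice₁, LinearMap.rTensor_smul]

theorem slice₁_comm (f : V →ₗ[ℂ] ℂ) (t : W ⊗[ℂ] V) :
    slice₁ f (TensorProduct.comm ℂ W V t) = slice₂ f t :=
  tensor_congr (F := slice₁ f ∘ₗ (TensorProduct.comm ℂ W V).toLinearMap) (by simp) t

theorem slice₂_comm (f : V →ₗ[ℂ] ℂ) (t : V ⊗[ℂ] W) :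
    slice₂ f (TensorProduct.comm ℂ V W t) = slice₁ f t :=
  tensor_congr (F := slice₂ f ∘ₗ (TensorProduct.comm ℂ V W).toLinearMap) (by simp) t

theorem slice₁_rTensor (f : U →ₗ[ℂ] ℂ) (h : V →ₗ[ℂ] U) (t : V ⊗[ℂ] W) :
    slice₁ f (h.rTensor W t) = slice₁ (f ∘ₗ h) t :=
  tensor_congr (F := slice₁ f ∘ₗ h.rTensor W) (by simp) t

theorem slice₁_lTensor (f : V →ₗ[ℂ] ℂ) (h : W →ₗ[ℂ] U) (t : V ⊗[ℂ] W) :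
    slice₁ f (h.lTensor V t) = h (slice₁ f t) :=
  tensor_congr (F := slice₁ f ∘ₗ h.lTensor V) (G := h ∘ₗ slice₁ f) (by simp) t

theorem slice₂_lTensor (f : U →ₗ[ℂ] ℂ) (h : W →ₗ[ℂ] U) (t : V ⊗[ℂ] W) :
    slice₂ f (h.lTensor V t) = slice₂ (f ∘ₗ h) t :=
  tensor_congr (F := slice₂ f ∘ₗ h.lTensor V) (by simp) t

theorem slice₂_rTensor (f : W →ₗ[ℂ] ℂ) (h : V →ₗ[ℂ] U) (t : V ⊗[ℂ] W) :
    slice₂ f (h.rTensor W t) = h (slice₂ f t) :=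
  tensor_congr (F := slice₂ f ∘ₗ h.rTensor W) (G := h ∘ₗ slice₂ f) (by simp) t

theorem comm_rTensor (h : V →ₗ[ℂ] U) (t : V ⊗[ℂ] W) :
    TensorProduct.comm ℂ U W (h.rTensor W t) = h.lTensor W (TensorProduct.comm ℂ V W t) := by
  simp [LinearMap.rTensor_def, LinearMap.lTensor_def, TensorProduct.map_comm]

theorem comm_lTensor (h : V →ₗ[ℂ] U) (t : W ⊗[ℂ] V) :
    TensorProduct.comm ℂ W U (h.lTensor W t) = h.rTensor W (TensorProduct.comm ℂ W V t) := by
  simp [LinearMap.rTensor_def, LinearMap.lTensor_def, TensorProduct.map_comm]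

theorem comm_comm (t : V ⊗[ℂ] W) :
    TensorProduct.comm ℂ W V (TensorProduct.comm ℂ V W t) = t :=
  (TensorProduct.comm ℂ V W).symm_apply_apply t

theorem apply_slice₁ (f : V →ₗ[ℂ] ℂ) (g : W →ₗ[ℂ] ℂ) (t : V ⊗[ℂ] W) :
    g (slice₁ f t) = f (slice₂ g t) :=
  tensor_congr (F := g ∘ₗ slice₁ f) (G := f ∘ₗ slice₂ g) (by simp [mul_comm]) t

theorem eq_zero_of_dual {v : V} (h : ∀ f : V →ₗ[ℂ] ℂ, f v = 0) : v = 0 :=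
  (Module.forall_dual_apply_eq_zero_iff ℂ v).mp h

/-- An element of `V ⊗ W` is determined by its slices, as functionals on `W` separate points. -/
theorem eq_zero_of_slice₂ {t : V ⊗[ℂ] W} (h : ∀ g : W →ₗ[ℂ] ℂ, slice₂ g t = 0) : t = 0 := by
  let b := Module.Free.chooseBasis ℂ W
  apply (TensorProduct.equivFinsuppOfBasisRight (M := V) b).injective
  ext i
  rw [TensorProduct.equivFinsuppOfBasisRight_apply, map_zero]
  exact h (b.coord i)

theorem eq_zero_of_slice₁ {t : V ⊗[ℂ] W} (h : ∀ f : V →ₗ[ℂ] ℂ, slice₁ f t = 0) : t = 0 := by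
  apply (TensorProduct.comm ℂ V W).injective
  rw [map_zero]
  exact eq_zero_of_slice₂ fun g ↦ by rw [slice₂_comm]; exact h g

theorem slice₁_jointly_injective {I : Type*} {h : I → V →ₗ[ℂ] ℂ}
    (H : ∀ v, (∀ i, h i v = 0) → v = 0) {t : V ⊗[ℂ] W} (ht : ∀ i, slice₁ (h i) t = 0) : t = 0 :=
  eq_zero_of_slice₂ fun g ↦ H _ fun i ↦ by rw [← apply_slice₁, ht, map_zero]

/-- If linear maps `h i` are jointly injective, then so are the maps `h i ⊗ ι`. -/
theorem rTensor_jointly_injective {I : Type*} {h : I → V →ₗ[ℂ] U}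
    (H : ∀ v, (∀ i, h i v = 0) → v = 0) {t : V ⊗[ℂ] W} (ht : ∀ i, (h i).rTensor W t = 0) : t = 0 :=
  eq_zero_of_slice₂ fun g ↦ H _ fun i ↦ by rw [← slice₂_rTensor, ht, map_zero]

/-- If linear maps `h i` are jointly injective, then so are the maps `ι ⊗ h i`. -/
theorem lTensor_jointly_injective {I : Type*} {h : I → W →ₗ[ℂ] U}
    (H : ∀ w, (∀ i, h i w = 0) → w = 0) {t : V ⊗[ℂ] W} (ht : ∀ i, (h i).lTensor V t = 0) : t = 0 :=
  eq_zero_of_slice₁ fun g ↦ H _ fun i ↦ by rw [← slice₁_lTensor, ht, map_zero]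

/-- A linear map that vanishes on the kernel of `f` factors through `f`. -/
theorem exists_comp_eq_of_ker_le {f : V →ₗ[ℂ] W} {g : V →ₗ[ℂ] U}
    (h : LinearMap.ker f ≤ LinearMap.ker g) : ∃ k : W →ₗ[ℂ] U, k ∘ₗ f = g := by
  obtain ⟨k, hk⟩ := LinearMap.exists_extend
    ((LinearMap.ker f).liftQ g h ∘ₗ (f.quotKerEquivRange.symm : LinearMap.range f →ₗ[ℂ] V ⧸ LinearMap.ker f))
  refine ⟨k, LinearMap.ext fun v ↦ ?_⟩
  have := LinearMap.congr_fun hk ⟨f v, LinearMap.mem_range_self f v⟩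
  simp only [LinearMap.comp_apply, Submodule.subtype_apply, LinearEquiv.coe_coe,
    LinearMap.quotKerEquivRange_symm_apply_image, Submodule.mkQ_apply, Submodule.liftQ_apply] at this
  exact this

/-- A linear map with values in the range of an injective linear map lifts along it. -/
theorem exists_comp_eq_of_mem_range {f : V →ₗ[ℂ] W} {g : U →ₗ[ℂ] W} (hf : Function.Injective f)
    (h : ∀ u, ∃ v, f v = g u) : ∃ k : U →ₗ[ℂ] V, ∀ u, f (k u) = g u := by
  choose k hk using h
  refine ⟨⟨⟨k, fun a b ↦ hf ?_⟩, fun r a ↦ hf ?_⟩, hk⟩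
  · simp [hk]
  · simp [hk]

/-- A proper subspace is annihilated by a non-zero functional. -/
theorem eq_top_of_forall_dual {N : Submodule ℂ V}
    (h : ∀ f : V →ₗ[ℂ] ℂ, (∀ v ∈ N, f v = 0) → f = 0) : N = ⊤ := by
  by_contra hN
  obtain ⟨f, hf, hle⟩ := N.exists_le_ker_of_lt_top (lt_top_iff_ne_top.mpr hN)
  exact hf (h f fun v hv ↦ hle hv)

theorem mem_of_forall_dual {N : Submodule ℂ V} {v : V}
    (h : ∀ f : V →ₗ[ℂ] ℂ, (∀ x ∈ N, f x = 0) → f v = 0) : v ∈ N := by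
  by_contra hv
  obtain ⟨f, hf, hle⟩ := Submodule.exists_le_ker_of_notMem hv
  exact hf (h f fun x hx ↦ hle hx)

/-- If all slices of `t` in the first leg belong to `N`, then `t` comes from `N ⊗ W`. -/
theorem exists_rTensor_subtype {N : Submodule ℂ V} {t : V ⊗[ℂ] W}
    (h : ∀ g : W →ₗ[ℂ] ℂ, slice₂ g t ∈ N) : ∃ s : N ⊗[ℂ] W, N.subtype.rTensor W s = t := by
  have hex := rTensor_exact W (LinearMap.exact_subtype_mkQ N) N.mkQ_surjective
  refine (hex t).mp (eq_zero_of_slice₂ fun g ↦ ?_)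
  rw [slice₂_rTensor]
  simpa using h g

theorem exists_lTensor_subtype {N : Submodule ℂ W} {t : V ⊗[ℂ] W}
    (h : ∀ g : V →ₗ[ℂ] ℂ, slice₁ g t ∈ N) : ∃ s : V ⊗[ℂ] N, N.subtype.lTensor V s = t := by
  have hex := lTensor_exact V (LinearMap.exact_subtype_mkQ N) N.mkQ_surjective
  refine (hex t).mp (eq_zero_of_slice₁ fun g ↦ ?_)
  rw [slice₁_lTensor]
  simpa using h g

end LinearAlgebra

end WeakMultiplierHopf

end

noncomputable section

namespace WeakMultiplierHopf

/-! ### One-sided separability data -/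

/-- The left action of a regular separability idempotent `E` on `B ⊗ C`, in terms of the maps
`EB b = E(b ⊗ 1)` and `EC c = E(1 ⊗ c)`. The products of `B` and `C` are explicit bilinear maps
`mB`, `mC`, so that the right action of `E` is covered as well, by the opposite products. -/
structure SeparabilityDatum (B C : Type*) [AddCommGroup B] [Module ℂ B] [AddCommGroup C]
    [Module ℂ C] where
  mB : B →ₗ[ℂ] B →ₗ[ℂ] B
  mC : C →ₗ[ℂ] C →ₗ[ℂ] C
  EB : B →ₗ[ℂ] B ⊗[ℂ] C
  EC : C →ₗ[ℂ] B ⊗[ℂ] C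
  mB_assoc : ∀ x y z, mB (mB x y) z = mB x (mB y z)
  mC_assoc : ∀ x y z, mC (mC x y) z = mC x (mC y z)
  mB_nondeg : ∀ b, (∀ x, mB x b = 0) → b = 0
  mC_nondeg : ∀ c, (∀ x, mC x c = 0) → c = 0
  mB_nondeg' : ∀ b, (∀ x, mB b x = 0) → b = 0
  mC_nondeg' : ∀ c, (∀ x, mC c x = 0) → c = 0
  EB_mul : ∀ b b', EB (mB b b') = (mB.flip b').rTensor C (EB b)
  EC_mul : ∀ c c', EC (mC c c') = (mC.flip c').lTensor B (EC c)
  EB_EC : ∀ b c, (mC.flip c).lTensor B (EB b) = (mB.flip b).rTensor C (EC c)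
  /-- `E E(b ⊗ 1) = E(b ⊗ 1)`. -/
  idem : ∀ b, TensorProduct.lift (LinearMap.mk₂ ℂ (fun u v ↦ (mC.flip v).lTensor B (EB u))
    (fun u u' v ↦ by simp) (fun r u v ↦ by simp)
    (fun u v v' ↦ by simp [LinearMap.lTensor_add]) (fun r u v ↦ by simp [LinearMap.lTensor_smul]))
    (EB b) = EB b
  full_B : ∀ f : B →ₗ[ℂ] ℂ, (∀ c, slice₁ f (EC c) = 0) → f = 0
  full_C : ∀ f : C →ₗ[ℂ] ℂ, (∀ b, slice₂ f (EB b) = 0) → f = 0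
  exists_EC : ∀ b, ∃ c, EB b = EC c
  exists_EB : ∀ c, ∃ b, EB b = EC c

namespace SeparabilityDatum

variable {B C : Type*} [AddCommGroup B] [Module ℂ B] [AddCommGroup C] [Module ℂ C]
variable (S : SeparabilityDatum B C)

/-- `E(u ⊗ v)`, as a linear map of `u ⊗ v`. -/
def act : B ⊗[ℂ] C →ₗ[ℂ] B ⊗[ℂ] C :=
  TensorProduct.lift (LinearMap.mk₂ ℂ (fun u v ↦ (S.mC.flip v).lTensor B (S.EB u))
    (fun u u' v ↦ by simp) (fun r u v ↦ by simp)
    (fun u v v' ↦ by simp [LinearMap.lTensor_add]) (fun r u v ↦ by simp [LinearMap.lTensor_smul]))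

@[simp] theorem act_tmul (u : B) (v : C) :
    S.act (u ⊗ₜ v) = (S.mC.flip v).lTensor B (S.EB u) := rfl

theorem act_EB (b : B) : S.act (S.EB b) = S.EB b := S.idem b

theorem act_EC (c : C) : S.act (S.EC c) = S.EC c := by
  obtain ⟨b, hb⟩ := S.exists_EB c
  rw [← hb, S.act_EB]

theorem EB_injective : Function.Injective S.EB := by
  refine (injective_iff_map_eq_zero S.EB).mpr fun b hb ↦ S.mB_nondeg b fun x ↦ ?_
  refine eq_zero_of_dual fun f ↦ ?_
  have : f ∘ₗ S.mB.flip b = 0 := S.full_B _ fun c ↦ by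
    rw [← slice₁_rTensor, ← S.EB_EC, hb, map_zero, map_zero]
  exact LinearMap.congr_fun this x

theorem EC_injective : Function.Injective S.EC := by
  refine (injective_iff_map_eq_zero S.EC).mpr fun c hc ↦ S.mC_nondeg c fun x ↦ ?_
  refine eq_zero_of_dual fun f ↦ ?_
  have : f ∘ₗ S.mC.flip c = 0 := S.full_C _ fun b ↦ by
    rw [← slice₂_lTensor, S.EB_EC, hc, map_zero, map_zero]
  exact LinearMap.congr_fun this x

/-- The separability datum with the legs of `E` exchanged. -/
def swap : SeparabilityDatum C B where
  mB := S.mC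
  mC := S.mB
  EB := (TensorProduct.comm ℂ B C).toLinearMap ∘ₗ S.EC
  EC := (TensorProduct.comm ℂ B C).toLinearMap ∘ₗ S.EB
  mB_assoc := S.mC_assoc
  mC_assoc := S.mB_assoc
  mB_nondeg := S.mC_nondeg
  mC_nondeg := S.mB_nondeg
  mB_nondeg' := S.mC_nondeg'
  mC_nondeg' := S.mB_nondeg'
  EB_mul b b' := by
    simp only [LinearMap.comp_apply, LinearEquiv.coe_coe, S.EC_mul]
    exact tensor_congr (F := (TensorProduct.comm ℂ B C).toLinearMap ∘ₗ (S.mC.flip b').lTensor B)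
      (G := (S.mC.flip b').rTensor B ∘ₗ (TensorProduct.comm ℂ B C).toLinearMap) (by simp) _
  EC_mul b b' := by
    simp only [LinearMap.comp_apply, LinearEquiv.coe_coe, S.EB_mul]
    exact tensor_congr (F := (TensorProduct.comm ℂ B C).toLinearMap ∘ₗ (S.mB.flip b').rTensor C)
      (G := (S.mB.flip b').lTensor C ∘ₗ (TensorProduct.comm ℂ B C).toLinearMap) (by simp) _
  EB_EC c b := by
    have h := congrArg (TensorProduct.comm ℂ B C) (S.EB_EC b c).symm
    simpa only [LinearMap.comp_apply, LinearEquiv.coe_coe, LinearMap.rTensor_def,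
      LinearMap.lTensor_def, TensorProduct.map_comm] using h
  idem c := by
    have h := congrArg (TensorProduct.comm ℂ B C) (S.act_EC c)
    refine Eq.trans ?_ h
    refine tensor_congr (F := TensorProduct.lift _ ∘ₗ (TensorProduct.comm ℂ B C).toLinearMap)
      (G := (TensorProduct.comm ℂ B C).toLinearMap ∘ₗ S.act) (fun u v ↦ ?_) (S.EC c)
    have h := congrArg (TensorProduct.comm ℂ B C) (S.EB_EC u v).symm
    simpa [LinearMap.rTensor_def, LinearMap.lTensor_def, TensorProduct.map_comm] using h
  full_B f h := S.full_C f fun b ↦ by simpa [slice₁_comm] using h b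
  full_C f h := S.full_B f fun b ↦ by simpa [slice₂_comm] using h b
  exists_EC b := (S.exists_EB b).imp fun c hc ↦ by simp [hc]
  exists_EB b := (S.exists_EC b).imp fun c hc ↦ by simp [hc]

theorem bijective_aux : ∃ s : B ≃ₗ[ℂ] C, ∀ b, S.EB b = S.EC (s b) := by
  obtain ⟨s, hs⟩ := exists_comp_eq_of_mem_range (g := S.EB) S.EC_injective
    fun b ↦ (S.exists_EC b).imp fun c hc ↦ hc.symm
  refine ⟨LinearEquiv.ofBijective s ⟨fun a b h ↦ S.EB_injective ?_, fun c ↦ ?_⟩, fun b ↦ ?_⟩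
  · rw [← hs, ← hs, h]
  · obtain ⟨b, hb⟩ := S.exists_EB c
    exact ⟨b, S.EC_injective (by rw [hs, hb])⟩
  · exact (hs b).symm

/-- The antipodal map `B → C`, determined by `E(b ⊗ 1) = E(1 ⊗ σ(b))`. -/
def antipode : B ≃ₗ[ℂ] C := S.bijective_aux.choose

theorem EB_eq (b : B) : S.EB b = S.EC (S.antipode b) := S.bijective_aux.choose_spec b

theorem EC_eq (c : C) : S.EC c = S.EB (S.antipode.symm c) := by
  rw [S.EB_eq, LinearEquiv.apply_symm_apply]

theorem antipode_swap (c : C) : S.swap.antipode c = S.antipode.symm c := by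
  apply S.EB_injective
  rw [← S.EC_eq]
  exact (TensorProduct.comm ℂ B C).injective (S.swap.EB_eq c).symm

/-- The linear map `u ⊗ v ↦ σ⁻¹(v) u`. -/
def contract : B ⊗[ℂ] C →ₗ[ℂ] B :=
  TensorProduct.lift (S.mB.comp S.antipode.symm.toLinearMap).flip

@[simp] theorem contract_tmul (u : B) (v : C) :
    S.contract (u ⊗ₜ v) = S.mB (S.antipode.symm v) u := rfl

/-- Writing `E(b ⊗ 1) = ∑ u ⊗ v`, one has `b = ∑ σ⁻¹(v) u`, because
`E(σ⁻¹(v)u ⊗ 1) = E(u ⊗ v)`. -/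
theorem contract_EB (b : B) : S.contract (S.EB b) = b := by
  apply S.EB_injective
  conv_rhs => rw [← S.act_EB]
  refine tensor_congr (F := S.EB ∘ₗ S.contract) (fun u v ↦ ?_) _
  simp [S.EB_mul, S.EB_EC, ← S.EC_eq]

/-- The map `σ` is anti-multiplicative: `E(zb ⊗ 1) = E(b ⊗ σ(z))`. -/
theorem EB_mul_eq (z b : B) :
    S.EB (S.mB z b) = (S.mC.flip (S.antipode z)).lTensor B (S.EB b) := by
  rw [S.EB_mul, S.EB_EC, ← S.EB_eq]

theorem antipode_mul (z b : B) :
    S.antipode (S.mB z b) = S.mC (S.antipode b) (S.antipode z) := by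
  apply S.EC_injective
  rw [← S.EB_eq, S.EB_mul_eq, S.EB_eq, S.EC_mul]

/-- Every element of `B` has a left unit: `E(b ⊗ 1)` lies in `Bb ⊗ C`, and `Bb` is a left ideal. -/
theorem exists_left_unit (b : B) : ∃ p, S.mB p b = b := by
  let N := LinearMap.range (S.mB.flip b)
  have h : ∀ g : C →ₗ[ℂ] ℂ, slice₂ g (S.EB b) ∈ N := by
    intro g
    refine mem_of_forall_dual fun f hf ↦ ?_
    rw [← apply_slice₁]
    have : slice₁ f (S.EB b) = 0 := S.mC_nondeg' _ fun c ↦ by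
      have h1 := slice₁_lTensor f (S.mC.flip c) (S.EB b)
      rw [S.EB_EC, slice₁_rTensor] at h1
      have h2 : f ∘ₗ S.mB.flip b = 0 := LinearMap.ext fun x ↦ hf _ ⟨x, rfl⟩
      rw [h2, slice₁_zero_left] at h1
      exact h1.symm
    rw [this, map_zero]
  obtain ⟨s, hs⟩ := exists_rTensor_subtype h
  -- `b` is recovered from `E(b ⊗ 1)` by `u ⊗ v ↦ σ⁻¹(v) u`, which maps `N ⊗ C` into `N`.
  have key : ∀ s : N ⊗[ℂ] C, S.contract (N.subtype.rTensor C s) ∈ N := by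
    intro s
    induction s using TensorProduct.induction_on with
    | zero => simp
    | add s t hs ht => rw [map_add, map_add]; exact N.add_mem hs ht
    | tmul x v =>
      obtain ⟨_, y, rfl⟩ := x
      exact ⟨S.mB (S.antipode.symm v) y, by simp [S.mB_assoc]⟩
  have := key s
  rwa [hs, S.contract_EB] at this

/-- Finitely many elements of `B` have a common left unit: if `p` is one for all elements but `b`, and
`q(b - pb) = b - pb`, then `p + q - qp` is one for all of them. -/
theorem exists_left_unit_list (l : List B) : ∃ p, ∀ b ∈ l, S.mB p b = b := by
  induction l with
  | nil => exact ⟨0, by simp⟩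
  | cons b l ih =>
    obtain ⟨p, hp⟩ := ih
    obtain ⟨q, hq⟩ := S.exists_left_unit (b - S.mB p b)
    refine ⟨p + q - S.mB q p, fun x hx ↦ ?_⟩
    rcases List.mem_cons.mp hx with rfl | hx
    · simp only [map_add, map_sub, LinearMap.add_apply, LinearMap.sub_apply, S.mB_assoc] at hq ⊢
      rw [add_sub_assoc, hq]; abel
    · simp [S.mB_assoc, hp x hx]

theorem exists_left_unit_tensor {W : Type*} [AddCommGroup W] [Module ℂ W] (s : B ⊗[ℂ] W) :
    ∃ p, (S.mB p).rTensor W s = s := by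
  suffices h : ∃ l : List B, ∀ p, (∀ b ∈ l, S.mB p b = b) → (S.mB p).rTensor W s = s by
    obtain ⟨l, hl⟩ := h
    exact (S.exists_left_unit_list l).imp hl
  induction s using TensorProduct.induction_on with
  | zero => exact ⟨[], by simp⟩
  | tmul b w => exact ⟨[b], fun p hp ↦ by simp [hp b (by simp)]⟩
  | add s t hs ht =>
    obtain ⟨l, hl⟩ := hs
    obtain ⟨k, hk⟩ := ht
    refine ⟨l ++ k, fun p hp ↦ ?_⟩
    rw [map_add, hl p fun b hb ↦ hp b (by simp [hb]), hk p fun b hb ↦ hp b (by simp [hb])]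

/-- The distinguished functional `φ_C` on `C`, with `(ι ⊗ φ_C)E = 1`. It is the functional that sends
`(ω ⊗ ι)(E(b ⊗ 1))` to `ω(b)`; that it is well-defined follows from fullness and from the existence
of local units. -/
theorem exists_functional : ∃ g : C →ₗ[ℂ] ℂ, ∀ b, slice₂ g (S.EB b) = b := by
  let F : B ⊗[ℂ] (B →ₗ[ℂ] ℂ) →ₗ[ℂ] C :=
    TensorProduct.lift (LinearMap.mk₂ ℂ (fun b f ↦ slice₁ f (S.EB b))
      (fun b b' f ↦ by simp) (fun r b f ↦ by simp)
      (fun b f f' ↦ by rw [slice₁_add_left]) (fun r b f ↦ by rw [slice₁_smul_left]))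
  let ev : B ⊗[ℂ] (B →ₗ[ℂ] ℂ) →ₗ[ℂ] ℂ := TensorProduct.lift LinearMap.id.flip
  have hF : ∀ b f, F (b ⊗ₜ f) = slice₁ f (S.EB b) := fun _ _ ↦ rfl
  have hker : LinearMap.ker F ≤ LinearMap.ker ev := by
    intro s hs
    rw [LinearMap.mem_ker] at hs ⊢
    -- For `s = ∑ b ⊗ ω`, the functional `G s = ∑ ω(· b)` vanishes by fullness, and at a common
    -- left unit `p` it takes the value `∑ ω(b)`.
    obtain ⟨p, hp⟩ := S.exists_left_unit_tensor s
    let G : B ⊗[ℂ] (B →ₗ[ℂ] ℂ) →ₗ[ℂ] B →ₗ[ℂ] ℂ :=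
      TensorProduct.lift (LinearMap.mk₂ ℂ (fun b f ↦ f ∘ₗ S.mB.flip b)
        (fun b b' f ↦ by ext; simp) (fun r b f ↦ by ext; simp)
        (fun b f f' ↦ by ext; simp) (fun r b f ↦ by ext; simp))
    have h1 : ∀ (s) (c : C), slice₁ (G s) (S.EC c) = S.mC (F s) c := by
      intro s c
      induction s using TensorProduct.induction_on with
      | zero => simp
      | add s t hs ht => rw [map_add, slice₁_add_left, hs, ht, map_add, map_add,
          LinearMap.add_apply]
      | tmul b f =>
        have hG : G (b ⊗ₜ f) = f ∘ₗ S.mB.flip b := rfl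
        rw [hF, hG, ← slice₁_rTensor, ← S.EB_EC, slice₁_lTensor, LinearMap.flip_apply]
    have h2 : G s = 0 := S.full_B _ fun c ↦ by rw [h1, hs, map_zero, LinearMap.zero_apply]
    have h3 : ev ((S.mB p).rTensor _ s) = G s p :=
      tensor_congr (F := ev ∘ₗ (S.mB p).rTensor _) (G := (LinearMap.applyₗ p) ∘ₗ G)
        (fun b f ↦ rfl) s
    rw [← hp, h3, h2, LinearMap.zero_apply]
  obtain ⟨g, hg⟩ := exists_comp_eq_of_ker_le hker
  refine ⟨g, fun b ↦ sub_eq_zero.mp (eq_zero_of_dual fun f ↦ ?_)⟩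
  have h : g (F (b ⊗ₜ f)) = ev (b ⊗ₜ f) := LinearMap.congr_fun hg _
  rw [map_sub, ← apply_slice₁, sub_eq_zero]
  exact h

/-- The distinguished functional `φ_C` on `C`. -/
def functionalC : C →ₗ[ℂ] ℂ := S.exists_functional.choose

theorem slice₂_functionalC_EB (b : B) : slice₂ S.functionalC (S.EB b) = b :=
  S.exists_functional.choose_spec b

theorem slice₂_functionalC_EC (c : C) : slice₂ S.functionalC (S.EC c) = S.antipode.symm c := by
  rw [S.EC_eq, S.slice₂_functionalC_EB]

/-- The distinguished functionals of `B` and `C` correspond to each other under the antipodal map,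
as both sides are obtained by slicing `E(b ⊗ 1)` in both legs. -/
theorem functionalC_antipode (b : B) : S.functionalC (S.antipode b) = S.swap.functionalC b := by
  have h1 := S.swap.slice₂_functionalC_EB (S.antipode b)
  have h2 : S.swap.EB (S.antipode b) = TensorProduct.comm ℂ B C (S.EB b) := by
    rw [S.EB_eq]; rfl
  rw [h2, slice₂_comm] at h1
  rw [← h1, apply_slice₁, S.slice₂_functionalC_EB]

end SeparabilityDatum

end WeakMultiplierHopf

end

noncomputable section

namespace WeakMultiplierHopf

/-! ### One-sided weak bialgebra data -/

/-- The map `a ↦ (k ⊗ l ↦ Δ(a)(k ⊗ l))`, expressed by the product `mul` of `A` and by the map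
`T a l = Δ(a)(1 ⊗ l)`. -/
def coproductAct {A : Type*} [AddCommGroup A] [Module ℂ A] (mul : A →ₗ[ℂ] A →ₗ[ℂ] A)
    (T : A →ₗ[ℂ] A →ₗ[ℂ] A ⊗[ℂ] A) : A →ₗ[ℂ] A ⊗[ℂ] A →ₗ[ℂ] A ⊗[ℂ] A where
  toFun a := TensorProduct.lift (((LinearMap.rTensorHom A).comp mul.flip).compl₂ (T a))
  map_add' a b := TensorProduct.ext' fun k l ↦ by simp
  map_smul' r a := TensorProduct.ext' fun k l ↦ by simp

@[simp] theorem coproductAct_tmul {A : Type*} [AddCommGroup A] [Module ℂ A]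
    (mul : A →ₗ[ℂ] A →ₗ[ℂ] A) (T : A →ₗ[ℂ] A →ₗ[ℂ] A ⊗[ℂ] A) (a k l : A) :
    coproductAct mul T a (k ⊗ₜ l) = (mul.flip k).rTensor A (T a l) := rfl

/-- The part of a regular coproduct with a canonical separability idempotent that is visible from
one side: the maps `T a b = Δ(a)(1 ⊗ b)` and `K a b = Δ(a)(b ⊗ 1)`, the left action of `E` on
`A ⊗ A`, and the actions `lB`, `rB`, `lC`, `rC` of the legs `B` and `C` of `E` on `A` (`lB b a = ba`,
`rB b a = ab`). All products are explicit bilinear maps, so that the same notion describes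
`(1 ⊗ b)Δ(a)` and `(b ⊗ 1)Δ(a)`, by the opposite product of `A` and the flip. Coassociativity is
recorded after slicing one of the outer legs. -/
structure OneSidedDatum (A B C : Type*) [AddCommGroup A] [Module ℂ A] [AddCommGroup B] [Module ℂ B]
    [AddCommGroup C] [Module ℂ C] where
  sep : SeparabilityDatum B C
  mul : A →ₗ[ℂ] A →ₗ[ℂ] A
  lB : B →ₗ[ℂ] A →ₗ[ℂ] A
  rB : B →ₗ[ℂ] A →ₗ[ℂ] A
  lC : C →ₗ[ℂ] A →ₗ[ℂ] A
  rC : C →ₗ[ℂ] A →ₗ[ℂ] A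
  T : A →ₗ[ℂ] A →ₗ[ℂ] A ⊗[ℂ] A
  K : A →ₗ[ℂ] A →ₗ[ℂ] A ⊗[ℂ] A
  E : A ⊗[ℂ] A →ₗ[ℂ] A ⊗[ℂ] A
  mul_assoc : ∀ x y z, mul (mul x y) z = mul x (mul y z)
  nondeg : ∀ a, (∀ p, mul a p = 0) → a = 0
  lB_inj : ∀ b, (∀ a, lB b a = 0) → b = 0
  lC_inj : ∀ c, (∀ a, lC c a = 0) → c = 0
  lB_mB : ∀ b b' a, lB (sep.mB b b') a = lB b (lB b' a)
  lC_mC : ∀ c c' a, lC (sep.mC c c') a = lC c (lC c' a)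
  lB_mul : ∀ b a a', lB b (mul a a') = mul (lB b a) a'
  lC_mul : ∀ c a a', lC c (mul a a') = mul (lC c a) a'
  mul_rB : ∀ b a a', mul a (rB b a') = rB b (mul a a')
  mul_rC : ∀ c a a', mul a (rC c a') = rC c (mul a a')
  rB_mul : ∀ b a a', mul (rB b a) a' = mul a (lB b a')
  rC_mul : ∀ c a a', mul (rC c a) a' = mul a (lC c a')
  span_lB : LinearMap.range (TensorProduct.lift lB) = ⊤
  span_lC : LinearMap.range (TensorProduct.lift lC) = ⊤
  span_rB : LinearMap.range (TensorProduct.lift rB) = ⊤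
  span_rC : LinearMap.range (TensorProduct.lift rC) = ⊤
  /-- The left leg of `Δ` is all of `A`, in terms of functionals. -/
  full_T : ∀ f : A →ₗ[ℂ] ℂ, (∀ a b, slice₁ f (T a b) = 0) → f = 0
  /-- The right leg of `Δ` is all of `A`, in terms of functionals. -/
  full_K : ∀ f : A →ₗ[ℂ] ℂ, (∀ a b, slice₂ f (K a b) = 0) → f = 0
  /-- Both sides are `Δ(a)(p ⊗ b)`. -/
  T_K : ∀ a b p, (mul.flip p).rTensor A (T a b) = (mul.flip b).lTensor A (K a p)
  T_mul : ∀ a b p, T a (mul b p) = (mul.flip p).lTensor A (T a b)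
  K_mul : ∀ a b p, K a (mul b p) = (mul.flip p).rTensor A (K a b)
  mul_T : ∀ a b p, T (mul a b) p = coproductAct mul T a (T b p)
  mul_K : ∀ a b p, K (mul a b) p = coproductAct mul T a (K b p)
  E_T : ∀ a b, E (T a b) = T a b
  E_K : ∀ a b, E (K a b) = K a b
  /-- `E(A ⊗ A)` is contained in `Δ(A)(A ⊗ A)`. -/
  E_mem : ∀ t, E t ∈ Submodule.span ℂ
    {s | ∃ a b p, s = (mul.flip p).rTensor A (T a b)}
  E_lB : ∀ b p q, E (lB b p ⊗ₜ q) = TensorProduct.map (lB.flip p) (lC.flip q) (sep.EB b)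
  E_lC : ∀ c p q, E (p ⊗ₜ lC c q) = TensorProduct.map (lB.flip p) (lC.flip q) (sep.EC c)
  /-- `Δ(a)(1 ⊗ cq) = Δ(a)(b ⊗ q)` if `E(b ⊗ 1) = E(1 ⊗ c)`, as `Δ(a) = Δ(a)E`. -/
  T_lC_eq : ∀ b c, sep.EB b = sep.EC c → ∀ a q, T a (lC c q) = (rB b).rTensor A (T a q)
  K_lB_eq : ∀ b c, sep.EB b = sep.EC c → ∀ a p, K a (lB b p) = (rC c).lTensor A (K a p)
  /-- `Δ(ab) = Δ(a)(1 ⊗ b)` for `b ∈ B`. -/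
  T_rB : ∀ b a q, T (rB b a) q = T a (lB b q)
  /-- `Δ(ac) = Δ(a)(c ⊗ 1)` for `c ∈ C`. -/
  K_rC : ∀ c a p, K (rC c a) p = K a (lC c p)
  /-- `Δ(ca) = (c ⊗ 1)Δ(a)` for `c ∈ C`, here and in the next field. -/
  T_lC : ∀ c a q, T (lC c a) q = (lC c).rTensor A (T a q)
  K_lC : ∀ c a p, K (lC c a) p = (lC c).rTensor A (K a p)
  /-- `Δ(ba) = (1 ⊗ b)Δ(a)` for `b ∈ B`, here and in the next field. -/
  T_lB : ∀ b a q, T (lB b a) q = (lB b).lTensor A (T a q)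
  K_lB : ∀ b a p, K (lB b a) p = (lB b).lTensor A (K a p)
  /-- Coassociativity `(Δ ⊗ ι)Δ(a) = (ι ⊗ Δ)Δ(a)`, multiplied by `r ⊗ 1 ⊗ z` from the right and
  sliced by `φ` in the third leg. -/
  coassoc₂ : ∀ (φ : A →ₗ[ℂ] ℂ) a z r,
    K (slice₂ φ (T a z)) r = (slice₂ φ ∘ₗ T.flip z).lTensor A (K a r)
  /-- The same identity, sliced by `f` in the first leg. -/
  coassoc₁ : ∀ (f : A →ₗ[ℂ] ℂ) a z r,
    T (slice₁ f (K a r)) z = (slice₁ f ∘ₗ K.flip r).rTensor A (T a z)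

namespace OneSidedDatum

variable {A B C : Type*} [AddCommGroup A] [Module ℂ A] [AddCommGroup B] [Module ℂ B]
  [AddCommGroup C] [Module ℂ C]
variable (D : OneSidedDatum A B C)

theorem coproductAct_comm (a : A) (w : A ⊗[ℂ] A) :
    coproductAct D.mul (D.K.compr₂ (TensorProduct.comm ℂ A A).toLinearMap) a
        (TensorProduct.comm ℂ A A w) =
      TensorProduct.comm ℂ A A (coproductAct D.mul D.T a w) := by
  refine tensor_congr (F := coproductAct D.mul _ a ∘ₗ (TensorProduct.comm ℂ A A).toLinearMap)
    (G := (TensorProduct.comm ℂ A A).toLinearMap ∘ₗ coproductAct D.mul D.T a) (fun k l ↦ ?_) w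
  simp [D.T_K, comm_lTensor]

/-- The datum for the opposite coproduct: the legs of `A ⊗ A` are exchanged, hence so are `T` and `K`
as well as `B` and `C`. -/
def cop : OneSidedDatum A C B where
  sep := D.sep.swap
  mul := D.mul
  lB := D.lC
  rB := D.rC
  lC := D.lB
  rC := D.rB
  T := D.K.compr₂ (TensorProduct.comm ℂ A A).toLinearMap
  K := D.T.compr₂ (TensorProduct.comm ℂ A A).toLinearMap
  E := (TensorProduct.comm ℂ A A).toLinearMap ∘ₗ D.E ∘ₗ (TensorProduct.comm ℂ A A).toLinearMap
  mul_assoc := D.mul_assoc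
  nondeg := D.nondeg
  lB_inj := D.lC_inj
  lC_inj := D.lB_inj
  lB_mB := D.lC_mC
  lC_mC := D.lB_mB
  lB_mul := D.lC_mul
  lC_mul := D.lB_mul
  mul_rB := D.mul_rC
  mul_rC := D.mul_rB
  rB_mul := D.rC_mul
  rC_mul := D.rB_mul
  span_lB := D.span_lC
  span_lC := D.span_lB
  span_rB := D.span_rC
  span_rC := D.span_rB
  full_T f h := D.full_K f fun a b ↦ by simpa [slice₁_comm] using h a b
  full_K f h := D.full_T f fun a b ↦ by simpa [slice₂_comm] using h a b
  T_K a b p := by simp [← comm_lTensor, ← comm_rTensor, D.T_K]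
  T_mul a b p := by simp [← comm_rTensor, D.K_mul]
  K_mul a b p := by simp [← comm_lTensor, D.T_mul]
  mul_T a b p := by
    simpa [D.mul_K] using (D.coproductAct_comm a (D.K b p)).symm
  mul_K a b p := by
    simpa [D.mul_T] using (D.coproductAct_comm a (D.T b p)).symm
  E_T a b := by simp [D.E_K]
  E_K a b := by simp [D.E_T]
  E_mem t := by
    have h := Submodule.mem_map_of_mem (f := (TensorProduct.comm ℂ A A).toLinearMap)
      (D.E_mem (TensorProduct.comm ℂ A A t))
    rw [Submodule.map_span] at h
    refine Submodule.span_mono ?_ h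
    rintro _ ⟨_, ⟨a, b, p, rfl⟩, rfl⟩
    exact ⟨a, p, b, by simp [D.T_K, comm_lTensor]⟩
  E_lB c p q := by
    simpa [TensorProduct.map_comm, SeparabilityDatum.swap] using
      congrArg (TensorProduct.comm ℂ A A) (D.E_lC c q p)
  E_lC b p q := by
    simpa [TensorProduct.map_comm, SeparabilityDatum.swap] using
      congrArg (TensorProduct.comm ℂ A A) (D.E_lB b q p)
  T_lC_eq c b h a q := by
    simp [← comm_lTensor,
      D.K_lB_eq b c ((TensorProduct.comm ℂ B C).injective h.symm)]
  K_lB_eq c b h a q := by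
    simp [← comm_rTensor,
      D.T_lC_eq b c ((TensorProduct.comm ℂ B C).injective h.symm)]
  T_rB := by simp [D.K_rC]
  K_rC := by simp [D.T_rB]
  T_lC := by simp [D.K_lB, comm_lTensor]
  K_lC := by simp [D.T_lB, comm_lTensor]
  T_lB := by simp [D.K_lC, comm_rTensor]
  K_lB := by simp [D.T_lC, comm_rTensor]
  coassoc₂ φ a z r := by
    have h := congrArg (TensorProduct.comm ℂ A A) (D.coassoc₁ φ a r z)
    rw [comm_rTensor] at h
    simp only [LinearMap.compr₂_apply, LinearEquiv.coe_coe, slice₂_comm, h]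
    congr 2
    ext x
    simp [slice₂_comm]
  coassoc₁ φ a z r := by
    have h := congrArg (TensorProduct.comm ℂ A A) (D.coassoc₂ φ a r z)
    rw [comm_lTensor] at h
    simp only [LinearMap.compr₂_apply, LinearEquiv.coe_coe, slice₁_comm, h]
    congr 2
    ext x
    simp [slice₁_comm]

end OneSidedDatum

end WeakMultiplierHopf

end

noncomputable section

namespace WeakMultiplierHopf

namespace OneSidedDatum

variable {A B C : Type*} [AddCommGroup A] [Module ℂ A] [AddCommGroup B] [Module ℂ B]
  [AddCommGroup C] [Module ℂ C]
variable (D : OneSidedDatum A B C)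

/-! ### Slices of coassociativity -/

/-- The linear map `k ⊗ l ↦ (ι ⊗ φ)(T a l) ⊗ k`. -/
def sliceT (φ : A →ₗ[ℂ] ℂ) (a : A) : A ⊗[ℂ] A →ₗ[ℂ] A ⊗[ℂ] A :=
  (slice₂ φ ∘ₗ D.T a).rTensor A ∘ₗ (TensorProduct.comm ℂ A A).toLinearMap

@[simp] theorem sliceT_tmul (φ : A →ₗ[ℂ] ℂ) (a k l : A) :
    D.sliceT φ a (k ⊗ₜ l) = slice₂ φ (D.T a l) ⊗ₜ k := rfl

/-- The canonical map `a ⊗ b ↦ Δ(a)(1 ⊗ b)`. -/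
def can : A ⊗[ℂ] A →ₗ[ℂ] A ⊗[ℂ] A := TensorProduct.lift D.T

@[simp] theorem can_tmul (a b : A) : D.can (a ⊗ₜ b) = D.T a b := rfl

/-- Coassociativity `(ι ⊗ Δ)Δ(a) = (Δ ⊗ ι)Δ(a)`, multiplied by `1 ⊗ Δ(b)(z ⊗ 1)` and sliced by `φ` in the
third leg. It says that `(ι ⊗ (ι ⊗ φ)Δ)Δ(a)` is in the range of the canonical map. -/
theorem lTensor_K_flip_T (φ : A →ₗ[ℂ] ℂ) (a b z : A) :
    (slice₂ φ ∘ₗ D.K.flip z).lTensor A (D.T a b) = D.can (D.sliceT φ a (D.K b z)) := by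
  rw [← sub_eq_zero]
  refine rTensor_jointly_injective (h := fun p ↦ D.mul.flip p) (fun v hv ↦ D.nondeg v hv)
    fun p ↦ ?_
  have key : ∀ w, (slice₂ φ ∘ₗ (coproductAct D.mul D.T).flip w).lTensor A (D.K a p) =
      (D.mul.flip p).rTensor A (D.can (D.sliceT φ a w)) := by
    intro w
    induction w using TensorProduct.induction_on with
    | zero => simp
    | add w w' h h' => simp only [map_add, LinearMap.comp_add, LinearMap.lTensor_add,
        LinearMap.add_apply, h, h']
    | tmul k l =>
      rw [sliceT_tmul, can_tmul, D.T_K, D.coassoc₂, ← LinearMap.lTensor_comp_apply]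
      congr 2
      ext x
      simp [slice₂_rTensor]
  rw [map_sub, ← key, sub_eq_zero, ← LinearMap.comp_apply, LinearMap.rTensor_comp_lTensor,
    ← LinearMap.lTensor_comp_rTensor, LinearMap.comp_apply, D.T_K, ← LinearMap.lTensor_comp_apply]
  congr 2
  ext x
  simp [D.mul_K]

/-- The linear map `r ⊗ s ↦ (ι ⊗ (ι ⊗ φ)K(·, s))(K a r)`, that is, multiplication by `Δ(Y(a))` where
`Y(a) = (ι ⊗ φ)Δ(a)`. -/
def sliceK (φ : A →ₗ[ℂ] ℂ) (a : A) : A ⊗[ℂ] A →ₗ[ℂ] A ⊗[ℂ] A :=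
  TensorProduct.lift (LinearMap.mk₂ ℂ (fun r s ↦ (slice₂ φ ∘ₗ D.K.flip s).lTensor A (D.K a r))
    (fun r r' s ↦ by simp) (fun c r s ↦ by simp)
    (fun r s s' ↦ by simp [LinearMap.comp_add, LinearMap.lTensor_add])
    (fun c r s ↦ by simp [LinearMap.comp_smul, LinearMap.lTensor_smul]))

@[simp] theorem sliceK_tmul (φ : A →ₗ[ℂ] ℂ) (a r s : A) :
    D.sliceK φ a (r ⊗ₜ s) = (slice₂ φ ∘ₗ D.K.flip s).lTensor A (D.K a r) := rfl

/-- `Δ(Y(a)x)(1 ⊗ q) = Δ(Y(a)) Δ(x)(1 ⊗ q)` for `Y(a) = (ι ⊗ φ)Δ(a)`, where coassociativity gives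
the value of `Δ(Y(a))`. -/
theorem T_slice_K (φ : A →ₗ[ℂ] ℂ) (a x q : A) :
    D.T (slice₂ φ (D.K a x)) q = D.sliceK φ a (D.T x q) := by
  rw [← sub_eq_zero]
  refine eq_zero_of_slice₁ fun f ↦ ?_
  rw [map_sub, sub_eq_zero]
  have h1 := congrArg (TensorProduct.comm ℂ A A) (D.cop.lTensor_K_flip_T f a x q)
  rw [comm_lTensor] at h1
  simp only [cop, LinearMap.compr₂_apply, LinearEquiv.coe_coe, comm_comm] at h1
  have h2 := slice₂_rTensor φ (slice₁ f ∘ₗ D.T.flip q) (D.K a x)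
  rw [LinearMap.comp_apply, LinearMap.flip_apply] at h2
  rw [← h2]
  refine Eq.trans (congrArg (slice₂ φ) (Eq.trans ?_ h1)) ?_
  · congr 2
    ext y
    simp [slice₂_comm]
  · refine tensor_congr (F := slice₂ φ ∘ₗ (TensorProduct.comm ℂ A A).toLinearMap ∘ₗ D.cop.can ∘ₗ
      D.cop.sliceT f a ∘ₗ (TensorProduct.comm ℂ A A).toLinearMap)
      (G := slice₁ f ∘ₗ D.sliceK φ a) (fun r s ↦ ?_) _
    simp only [LinearMap.comp_apply, LinearEquiv.coe_coe, TensorProduct.comm_tmul, sliceT_tmul,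
      can_tmul, sliceK_tmul, slice₁_lTensor]
    simp [cop, slice₂_comm]

/-! ### Integrals -/

/-- A functional `φ` with `(ι ⊗ φ)Δ(a) ∈ C` for all `a`. -/
def IsInvariant (φ : A →ₗ[ℂ] ℂ) : Prop :=
  ∀ a, ∃ c, ∀ p, slice₂ φ (D.K a p) = D.lC c p

theorem lC_injective : Function.Injective D.lC :=
  (injective_iff_map_eq_zero D.lC).mpr fun c h ↦ D.lC_inj c fun a ↦ by rw [h]; rfl

theorem IsInvariant.exists_slice {D : OneSidedDatum A B C} {φ : A →ₗ[ℂ] ℂ} (h : D.IsInvariant φ) :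
    ∃ Y : A →ₗ[ℂ] C, ∀ a p, slice₂ φ (D.K a p) = D.lC (Y a) p := by
  obtain ⟨Y, hY⟩ := exists_comp_eq_of_mem_range (g := D.K.compr₂ (slice₂ φ)) D.lC_injective
    fun a ↦ (h a).imp fun c hc ↦ LinearMap.ext fun p ↦ (hc p).symm
  exact ⟨Y, fun a p ↦ (LinearMap.congr_fun (hY a) p).symm⟩

variable {D} {φ : A →ₗ[ℂ] ℂ} {Y : A →ₗ[ℂ] C}

theorem slice_rC (hY : ∀ a p, slice₂ φ (D.K a p) = D.lC (Y a) p) (c : C) (a : A) :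
    Y (D.rC c a) = D.sep.mC (Y a) c := by
  refine D.lC_injective (LinearMap.ext fun p ↦ ?_)
  rw [← hY, D.K_rC, hY, D.lC_mC]

theorem slice_lC (hY : ∀ a p, slice₂ φ (D.K a p) = D.lC (Y a) p) (c : C) (a : A) :
    Y (D.lC c a) = D.sep.mC c (Y a) := by
  refine D.lC_injective (LinearMap.ext fun p ↦ ?_)
  rw [← hY, D.K_lC, slice₂_rTensor, hY, D.lC_mC]

/-- An identity that is linear in `q ∈ A` may be checked at `q = c q₀`, as `CA = A`. -/
theorem induction_lC (D : OneSidedDatum A B C) {U : Type*} [AddCommGroup U] [Module ℂ U]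
    {F G : A →ₗ[ℂ] U} (h : ∀ c q, F (D.lC c q) = G (D.lC c q)) (q : A) : F q = G q := by
  have hq : q ∈ LinearMap.range (TensorProduct.lift D.lC) := D.span_lC ▸ Submodule.mem_top
  obtain ⟨t, rfl⟩ := hq
  exact tensor_congr (F := F ∘ₗ TensorProduct.lift D.lC) (G := G ∘ₗ TensorProduct.lift D.lC)
    (fun c q ↦ h c q) t

theorem induction_rC (D : OneSidedDatum A B C) {U : Type*} [AddCommGroup U] [Module ℂ U]
    {F G : A →ₗ[ℂ] U} (h : ∀ c q, F (D.rC c q) = G (D.rC c q)) (q : A) : F q = G q := by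
  have hq : q ∈ LinearMap.range (TensorProduct.lift D.rC) := D.span_rC ▸ Submodule.mem_top
  obtain ⟨t, rfl⟩ := hq
  exact tensor_congr (F := F ∘ₗ TensorProduct.lift D.rC) (G := G ∘ₗ TensorProduct.lift D.rC)
    (fun c q ↦ h c q) t

/-- As `Δ(a)(u ⊗ 1) = Δ(a)(1 ⊗ σ(u))` for `u ∈ B`, the map `sliceK` is balanced over the legs of `E`;
writing `E(1 ⊗ v) = ∑ u ⊗ v'`, one has `∑ σ(u)v' = v`. -/
theorem sliceK_E (φ : A →ₗ[ℂ] ℂ) (a : A) (t : A ⊗[ℂ] A) :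
    D.sliceK φ a (D.E t) = D.sliceK φ a t := by
  refine tensor_congr (F := D.sliceK φ a ∘ₗ D.E) (fun r s ↦ ?_) t
  refine D.induction_lC (F := D.sliceK φ a ∘ₗ D.E ∘ₗ TensorProduct.mk ℂ A A r)
    (G := D.sliceK φ a ∘ₗ TensorProduct.mk ℂ A A r) (fun v s ↦ ?_) s
  simp only [LinearMap.comp_apply, TensorProduct.mk_apply, D.E_lC]
  have key : ∀ w : B ⊗[ℂ] C,
      D.sliceK φ a (TensorProduct.map (D.lB.flip r) (D.lC.flip s) w) =
      D.sliceK φ a (r ⊗ₜ D.lC (D.sep.swap.contract (TensorProduct.comm ℂ B C w)) s) :=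
    tensor_congr (F := D.sliceK φ a ∘ₗ TensorProduct.map (D.lB.flip r) (D.lC.flip s))
      (G := D.sliceK φ a ∘ₗ TensorProduct.mk ℂ A A r ∘ₗ D.lC.flip s ∘ₗ D.sep.swap.contract ∘ₗ
        (TensorProduct.comm ℂ B C).toLinearMap) fun u v ↦ by
      have h1 : D.sep.swap.antipode.symm u = D.sep.antipode u := by
        rw [LinearEquiv.symm_apply_eq, D.sep.antipode_swap, LinearEquiv.symm_apply_apply]
      simp only [LinearMap.comp_apply, TensorProduct.map_tmul, LinearMap.flip_apply, sliceK_tmul,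
        LinearEquiv.coe_coe, TensorProduct.comm_tmul, SeparabilityDatum.contract_tmul,
        TensorProduct.mk_apply, h1, D.K_lB_eq u _ (D.sep.EB_eq u)]
      rw [← LinearMap.lTensor_comp_apply]
      congr 2
      ext y
      change slice₂ φ (D.K (D.rC _ y) (D.lC v s)) =
        slice₂ φ (D.K y (D.lC (D.sep.mC (D.sep.antipode u) v) s))
      rw [D.K_rC, D.lC_mC]
  rw [key]
  have h2 : D.sep.swap.contract (TensorProduct.comm ℂ B C (D.sep.EC v)) = v :=
    D.sep.swap.contract_EB v
  rw [h2]

theorem sliceK_mul (φ : A →ₗ[ℂ] ℂ) (a p : A) (t : A ⊗[ℂ] A) :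
    D.sliceK φ a ((D.mul.flip p).rTensor A t) = (D.mul.flip p).rTensor A (D.sliceK φ a t) := by
  refine tensor_congr (F := D.sliceK φ a ∘ₗ (D.mul.flip p).rTensor A)
    (G := (D.mul.flip p).rTensor A ∘ₗ D.sliceK φ a) (fun r s ↦ ?_) t
  simp only [LinearMap.comp_apply, LinearMap.rTensor_tmul, LinearMap.flip_apply, sliceK_tmul,
    D.K_mul]
  rw [← LinearMap.comp_apply, LinearMap.lTensor_comp_rTensor, ← LinearMap.rTensor_comp_lTensor,
    LinearMap.comp_apply]

/-- For a left integral `φ` with `Y(a) = (ι ⊗ φ)Δ(a)`: one has `(ι ⊗ Y)Δ(a) = (Y(a) ⊗ 1)E`, because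
the left hand side is `Δ(Y(a))`. -/
theorem sliceK_eq (hY : ∀ a p, slice₂ φ (D.K a p) = D.lC (Y a) p) (a : A) (t : A ⊗[ℂ] A) :
    D.sliceK φ a t = (D.lC (Y a)).rTensor A (D.E t) := by
  rw [← sliceK_E]
  have h := D.E_mem t
  generalize D.E t = s at h ⊢
  induction h using Submodule.span_induction with
  | zero => simp
  | add x y _ _ hx hy => rw [map_add, hx, hy, map_add]
  | smul r x _ hx => rw [map_smul, hx, map_smul]
  | mem x hx =>
    obtain ⟨x, q, p, rfl⟩ := hx
    rw [sliceK_mul, ← T_slice_K, hY, D.T_lC, ← LinearMap.rTensor_comp_apply,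
      ← LinearMap.rTensor_comp_apply]
    congr 2
    ext y
    exact (D.lC_mul _ _ _).symm

/-- A left integral `φ` is recovered from `Y(a) = (ι ⊗ φ)Δ(a)` by the distinguished functional on `C`,
because `(ι ⊗ Y)Δ(a) = (Y(a) ⊗ 1)E` and `(ι ⊗ φ_C)E = 1`. -/
theorem functionalC_slice (hY : ∀ a p, slice₂ φ (D.K a p) = D.lC (Y a) p) (a : A) :
    φ a = D.sep.functionalC (Y a) := by
  refine D.induction_rC (F := φ) (G := D.sep.functionalC ∘ₗ Y) (fun v a ↦ ?_) a
  suffices h : φ ∘ₗ D.rC v - D.sep.functionalC ∘ₗ Y ∘ₗ D.rC v = 0 from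
    sub_eq_zero.mp (LinearMap.congr_fun h a)
  -- By fullness it suffices to apply both functionals to the second leg of `Δ(a)(r ⊗ 1)`.
  refine D.full_K _ fun a r ↦ ?_
  have h1 : (Y ∘ₗ D.rC v).lTensor A (D.K a r) =
      (D.lC (Y a) ∘ₗ D.lB.flip r).rTensor C (D.sep.EC v) := by
    rw [← sub_eq_zero]
    refine lTensor_jointly_injective (h := fun s ↦ D.lC.flip s) (fun c hc ↦ D.lC_inj c hc)
      fun s ↦ ?_
    rw [map_sub, sub_eq_zero, ← LinearMap.lTensor_comp_apply]
    have h2 := sliceK_eq hY a (r ⊗ₜ D.lC v s)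
    rw [sliceK_tmul, D.E_lC] at h2
    refine Eq.trans ?_ (h2.trans ?_)
    · congr 2
      ext y
      change D.lC (Y (D.rC v y)) s = slice₂ φ (D.K y (D.lC v s))
      rw [hY, slice_rC hY, D.lC_mC]
    · exact tensor_congr
        (F := (D.lC (Y a)).rTensor A ∘ₗ TensorProduct.map (D.lB.flip r) (D.lC.flip s))
        (G := (D.lC.flip s).lTensor A ∘ₗ (D.lC (Y a) ∘ₗ D.lB.flip r).rTensor C)
        (fun u w ↦ by simp) _
  have h2 : ∀ t : A ⊗[ℂ] A, slice₂ (φ ∘ₗ D.rC v - D.sep.functionalC ∘ₗ Y ∘ₗ D.rC v) t =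
      slice₂ φ ((D.rC v).lTensor A t) - slice₂ D.sep.functionalC ((Y ∘ₗ D.rC v).lTensor A t) :=
    tensor_congr (G := slice₂ φ ∘ₗ (D.rC v).lTensor A -
      slice₂ D.sep.functionalC ∘ₗ (Y ∘ₗ D.rC v).lTensor A) fun x y ↦ by simp [sub_smul]
  rw [h2, h1, slice₂_rTensor, D.sep.slice₂_functionalC_EC,
    ← D.K_lB_eq (D.sep.antipode.symm v) v (D.sep.EC_eq v).symm, hY]
  exact sub_self _

/-- `(ι ⊗ Y)(t) = E((ι ⊗ φ)(t) ⊗ 1)` for `t ∈ E(A ⊗ A)`. -/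
theorem lTensor_slice_E (hY : ∀ a p, slice₂ φ (D.K a p) = D.lC (Y a) p) (z : A) (t : A ⊗[ℂ] A) :
    (D.lC.flip z ∘ₗ Y).lTensor A (D.E t) = D.E (slice₂ φ (D.E t) ⊗ₜ z) := by
  refine tensor_congr (F := (D.lC.flip z ∘ₗ Y).lTensor A ∘ₗ D.E)
    (G := D.E ∘ₗ (TensorProduct.mk ℂ A A).flip z ∘ₗ slice₂ φ ∘ₗ D.E) (fun p q ↦ ?_) t
  refine D.induction_lC (F := (D.lC.flip z ∘ₗ Y).lTensor A ∘ₗ D.E ∘ₗ TensorProduct.mk ℂ A A p)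
    (G := D.E ∘ₗ (TensorProduct.mk ℂ A A).flip z ∘ₗ slice₂ φ ∘ₗ D.E ∘ₗ TensorProduct.mk ℂ A A p)
    (fun v q ↦ ?_) q
  simp only [LinearMap.comp_apply, TensorProduct.mk_apply, LinearMap.flip_apply, D.E_lC]
  have h1 : slice₂ φ (TensorProduct.map (D.lB.flip p) (D.lC.flip q) (D.sep.EC v)) =
      D.lB (slice₂ D.sep.functionalC ((D.sep.mC.flip (Y q)).lTensor B (D.sep.EC v))) p :=
    tensor_congr (F := slice₂ φ ∘ₗ TensorProduct.map (D.lB.flip p) (D.lC.flip q))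
      (G := D.lB.flip p ∘ₗ slice₂ D.sep.functionalC ∘ₗ (D.sep.mC.flip (Y q)).lTensor B)
      (fun u w ↦ by simp [functionalC_slice hY, slice_lC hY]) _
  have h2 : (D.lC.flip z ∘ₗ Y).lTensor A
      (TensorProduct.map (D.lB.flip p) (D.lC.flip q) (D.sep.EC v)) =
      TensorProduct.map (D.lB.flip p) (D.lC.flip z) ((D.sep.mC.flip (Y q)).lTensor B
        (D.sep.EC v)) :=
    tensor_congr (F := (D.lC.flip z ∘ₗ Y).lTensor A ∘ₗ
      TensorProduct.map (D.lB.flip p) (D.lC.flip q))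
      (G := TensorProduct.map (D.lB.flip p) (D.lC.flip z) ∘ₗ (D.sep.mC.flip (Y q)).lTensor B)
      (fun u w ↦ by simp [slice_lC hY]) _
  rw [h1, h2, ← D.sep.EC_mul, D.sep.slice₂_functionalC_EC, D.E_lB, ← D.sep.EC_eq]

/-! ### The range of the canonical map -/

/-- `E(x ⊗ z)` is in the range of the canonical map for `x = (ι ⊗ φ)(Δ(a)(1 ⊗ b))`. -/
theorem can_sliceT (hY : ∀ a p, slice₂ φ (D.K a p) = D.lC (Y a) p) (a b z : A) :
    D.can (D.sliceT φ a (D.K b z)) = D.E (slice₂ φ (D.T a b) ⊗ₜ z) := by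
  have h := lTensor_slice_E hY z (D.T a b)
  rw [D.E_T] at h
  rw [← h, ← lTensor_K_flip_T]
  congr 2
  ext y
  exact hY y z

/-- If the left integrals are faithful, then the elements `(ι ⊗ φ)(Δ(a)(1 ⊗ b))` span `A`, by fullness
of the coproduct. -/
theorem span_slice_eq_top (hL : ∀ x, (∀ φ, D.IsInvariant φ → ∀ b, φ (D.mul x b) = 0) → x = 0) :
    Submodule.span ℂ {x | ∃ φ, D.IsInvariant φ ∧ ∃ a b, x = slice₂ φ (D.T a b)} = ⊤ := by
  refine eq_top_of_forall_dual fun f hf ↦ D.full_T f fun a b ↦ hL _ fun φ hφ b' ↦ ?_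
  have h := hf _ (Submodule.subset_span ⟨φ, hφ, a, D.mul b b', rfl⟩)
  rwa [D.T_mul, ← apply_slice₁, slice₁_lTensor] at h

/-- `E(A ⊗ A) = Δ(A)(1 ⊗ A)` if the left integrals are faithful; the other inclusion is `E_T`. -/
theorem range_E_le (hL : ∀ x, (∀ φ, D.IsInvariant φ → ∀ b, φ (D.mul x b) = 0) → x = 0) :
    LinearMap.range D.E ≤ LinearMap.range D.can := by
  rintro _ ⟨t, rfl⟩
  induction t using TensorProduct.induction_on with
  | zero => simp
  | add s t hs ht => rw [map_add]; exact add_mem hs ht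
  | tmul x z =>
    have hx : x ∈ Submodule.span ℂ {x | ∃ φ, D.IsInvariant φ ∧ ∃ a b, x = slice₂ φ (D.T a b)} :=
      D.span_slice_eq_top hL ▸ Submodule.mem_top
    induction hx using Submodule.span_induction with
    | zero => simp
    | add x y _ _ hx hy => rw [TensorProduct.add_tmul, map_add]; exact add_mem hx hy
    | smul r x _ hx => rw [← TensorProduct.smul_tmul', map_smul]; exact Submodule.smul_mem _ r hx
    | mem x hx =>
      obtain ⟨φ, hφ, a, b, rfl⟩ := hx
      obtain ⟨Y, hY⟩ := hφ.exists_slice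
      exact ⟨_, can_sliceT hY a b z⟩

end OneSidedDatum

end WeakMultiplierHopf

end

noncomputable section

namespace WeakMultiplierHopf

namespace OneSidedDatum

variable {A B C : Type*} [AddCommGroup A] [Module ℂ A] [AddCommGroup B] [Module ℂ B]
  [AddCommGroup C] [Module ℂ C]
variable (D : OneSidedDatum A B C)

/-! ### The kernel of the canonical map -/

/-- The linear map `u ⊗ v ↦ x σ⁻¹(v) ⊗ u y`. -/
def insert (y x : A) : B ⊗[ℂ] C →ₗ[ℂ] A ⊗[ℂ] A :=
  TensorProduct.map (D.rB.flip x ∘ₗ D.sep.antipode.symm.toLinearMap) (D.lB.flip y) ∘ₗ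
    (TensorProduct.comm ℂ B C).toLinearMap

@[simp] theorem insert_tmul (x y : A) (u : B) (v : C) :
    D.insert y x (u ⊗ₜ v) = D.rB (D.sep.antipode.symm v) x ⊗ₜ D.lB u y := rfl

/-- `D.insert y x (E(b ⊗ 1))` as a linear map of `x`, depending linearly on `b ⊗ y`. -/
def insertEB : B ⊗[ℂ] A →ₗ[ℂ] A →ₗ[ℂ] A ⊗[ℂ] A :=
  TensorProduct.lift (LinearMap.mk₂ ℂ
    (fun b y ↦
      { toFun := fun x ↦ D.insert y x (D.sep.EB b)
        map_add' := fun x x' ↦ by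
          simp [insert, LinearMap.add_comp, TensorProduct.map_add_left]
        map_smul' := fun r x ↦ by
          simp [insert, LinearMap.smul_comp, TensorProduct.map_smul_left] })
    (fun b b' y ↦ LinearMap.ext fun x ↦ by
      exact (congrArg (D.insert y x) (map_add D.sep.EB b b')).trans (map_add _ _ _))
    (fun r b y ↦ LinearMap.ext fun x ↦ by
      exact (congrArg (D.insert y x) (map_smul D.sep.EB r b)).trans (map_smul _ _ _))
    (fun b y y' ↦ by ext; simp [insert, TensorProduct.map_add_right])
    (fun r b y ↦ by ext; simp [insert, TensorProduct.map_smul_right]))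

theorem insertEB_tmul (b : B) (y x : A) :
    D.insertEB (b ⊗ₜ y) x = D.insert y x (D.sep.EB b) := rfl

theorem insert_slice (θ : A →ₗ[ℂ] ℂ) (a c y : A) (w : B ⊗[ℂ] C) :
    D.insert y (slice₂ θ (D.T a c)) w =
      D.sliceT θ a (TensorProduct.map (D.lB.flip y) (D.lC.flip c) w) := by
  refine tensor_congr (F := D.insert y (slice₂ θ (D.T a c)))
    (G := D.sliceT θ a ∘ₗ TensorProduct.map (D.lB.flip y) (D.lC.flip c)) (fun u v ↦ ?_) w
  simp [D.T_lC_eq _ v (D.sep.EC_eq v).symm, slice₂_rTensor]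

/-- The slices `(ι ⊗ θ)(Δ(a)(1 ⊗ c))` span `A`, as the coproduct is full. -/
theorem eq_of_slice_T {U : Type*} [AddCommGroup U] [Module ℂ U] {F G : A →ₗ[ℂ] U}
    (h : ∀ (θ : A →ₗ[ℂ] ℂ) a c, F (slice₂ θ (D.T a c)) = G (slice₂ θ (D.T a c))) : F = G := by
  refine LinearMap.ext fun x ↦ ?_
  have hx : x ∈ LinearMap.eqLocus F G := by
    refine mem_of_forall_dual fun f hf ↦ ?_
    rw [D.full_T f fun a c ↦ eq_zero_of_dual fun θ ↦ ?_, LinearMap.zero_apply]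
    rw [apply_slice₁]
    exact hf _ (h θ a c)
  exact hx

/-- On slices of `Δ(a)`, the value of `insertEB` at `b ⊗ y` depends only on `by`. This makes the map
`G₁` well-defined. -/
theorem insertEB_slice (θ : A →ₗ[ℂ] ℂ) (a c : A) (s : B ⊗[ℂ] A) :
    D.insertEB s (slice₂ θ (D.T a c)) =
      D.sliceT θ a (D.E (TensorProduct.lift D.lB s ⊗ₜ c)) := by
  refine tensor_congr (F := (LinearMap.applyₗ (slice₂ θ (D.T a c))) ∘ₗ D.insertEB)
    (G := D.sliceT θ a ∘ₗ D.E ∘ₗ (TensorProduct.mk ℂ A A).flip c ∘ₗ TensorProduct.lift D.lB)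
    (fun b y ↦ ?_) s
  simp [insertEB_tmul, D.insert_slice, D.E_lB]

/-- The map `G₁`, which is given by `G₁(x ⊗ by) = ∑ x σ⁻¹(v) ⊗ uy` where `E(b ⊗ 1) = ∑ u ⊗ v`. -/
theorem exists_G : ∃ G : A ⊗[ℂ] A →ₗ[ℂ] A ⊗[ℂ] A,
    (∀ (θ : A →ₗ[ℂ] ℂ) a t, G (D.sliceT θ a t) = D.sliceT θ a (D.E t)) ∧
    ∀ x b y, G (x ⊗ₜ D.lB b y) = D.insert y x (D.sep.EB b) := by
  have hker : LinearMap.ker (TensorProduct.lift D.lB) ≤ LinearMap.ker D.insertEB := by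
    intro s hs
    rw [LinearMap.mem_ker] at hs ⊢
    refine D.eq_of_slice_T fun θ a c ↦ ?_
    rw [insertEB_slice, hs, TensorProduct.zero_tmul, map_zero, map_zero, LinearMap.zero_apply]
  obtain ⟨g, hg⟩ := exists_comp_eq_of_ker_le hker
  have hg' : ∀ s, g (TensorProduct.lift D.lB s) = D.insertEB s := LinearMap.congr_fun hg
  refine ⟨TensorProduct.lift g.flip, fun θ a t ↦ ?_, fun x b y ↦ ?_⟩
  · refine tensor_congr (F := TensorProduct.lift g.flip ∘ₗ D.sliceT θ a)
      (G := D.sliceT θ a ∘ₗ D.E) (fun b c ↦ ?_) t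
    have hb : b ∈ LinearMap.range (TensorProduct.lift D.lB) := D.span_lB ▸ Submodule.mem_top
    obtain ⟨s, rfl⟩ := hb
    simp [hg', insertEB_slice]
  · have := hg' (b ⊗ₜ y)
    rw [TensorProduct.lift.tmul] at this
    rw [TensorProduct.lift.tmul, LinearMap.flip_apply, this, insertEB_tmul]

/-- An identity that is linear in `y ∈ A` may be checked at `y = b y₀`, as `BA = A`. -/
theorem tensor_induction_lB {U : Type*} [AddCommGroup U] [Module ℂ U] {F G : A ⊗[ℂ] A →ₗ[ℂ] U}
    (h : ∀ x b y, F (x ⊗ₜ D.lB b y) = G (x ⊗ₜ D.lB b y)) (t : A ⊗[ℂ] A) : F t = G t :=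
  tensor_congr (fun x y ↦ D.cop.induction_lC (F := F ∘ₗ TensorProduct.mk ℂ A A x)
    (G := G ∘ₗ TensorProduct.mk ℂ A A x) (fun b y ↦ h x b y) y) t

/-- A map that is balanced over `B` is invariant under `G₁`, since `∑ σ⁻¹(v)u = b` when
`E(b ⊗ 1) = ∑ u ⊗ v`. -/
theorem balanced_G {U : Type*} [AddCommGroup U] [Module ℂ U] {F : A ⊗[ℂ] A →ₗ[ℂ] U}
    (hF : ∀ x b y, F (D.rB b x ⊗ₜ y) = F (x ⊗ₜ D.lB b y)) {G : A ⊗[ℂ] A →ₗ[ℂ] A ⊗[ℂ] A}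
    (hG : ∀ x b y, G (x ⊗ₜ D.lB b y) = D.insert y x (D.sep.EB b)) (t : A ⊗[ℂ] A) :
    F (G t) = F t := by
  refine D.tensor_induction_lB (F := F ∘ₗ G) (fun x b y ↦ ?_) t
  rw [LinearMap.comp_apply, hG]
  conv_rhs => rw [← D.sep.contract_EB b]
  refine tensor_congr (F := F ∘ₗ D.insert y x)
    (G := F ∘ₗ TensorProduct.mk ℂ A A x ∘ₗ D.lB.flip y ∘ₗ D.sep.contract) (fun u v ↦ ?_) _
  simp [hF, D.lB_mB]

theorem can_G {G : A ⊗[ℂ] A →ₗ[ℂ] A ⊗[ℂ] A}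
    (hG : ∀ x b y, G (x ⊗ₜ D.lB b y) = D.insert y x (D.sep.EB b)) (t : A ⊗[ℂ] A) :
    D.can (G t) = D.can t :=
  D.balanced_G (fun x b y ↦ by simp [D.T_rB]) hG t

theorem mul_G {G : A ⊗[ℂ] A →ₗ[ℂ] A ⊗[ℂ] A}
    (hG : ∀ x b y, G (x ⊗ₜ D.lB b y) = D.insert y x (D.sep.EB b)) (t : A ⊗[ℂ] A) :
    TensorProduct.lift D.mul (G t) = TensorProduct.lift D.mul t :=
  D.balanced_G (fun x b y ↦ by simp [D.rB_mul]) hG t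

/-- For a right integral `ψ`, the slices `(ψ(a ·) ⊗ ι)(G₁(t))` only depend on the image of `t` under
the canonical map. -/
theorem slice₁_G {ψ : A →ₗ[ℂ] ℂ} {Z : A →ₗ[ℂ] B}
    (hZ : ∀ a q, slice₂ ψ (D.cop.K a q) = D.lB (Z a) q) {G : A ⊗[ℂ] A →ₗ[ℂ] A ⊗[ℂ] A}
    (hG : ∀ x b y, G (x ⊗ₜ D.lB b y) = D.insert y x (D.sep.EB b)) (a : A) (t : A ⊗[ℂ] A) :
    slice₁ (ψ ∘ₗ D.mul a) (G t) = slice₁ ψ (coproductAct D.mul D.T a (D.can t)) := by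
  refine D.tensor_induction_lB (F := slice₁ (ψ ∘ₗ D.mul a) ∘ₗ G)
    (G := slice₁ ψ ∘ₗ coproductAct D.mul D.T a ∘ₗ D.can) (fun x b y ↦ ?_) t
  have h1 : ∀ a q, slice₁ ψ (D.T a q) = D.lB (Z a) q := fun a q ↦ by
    rw [← hZ]; exact (slice₂_comm _ _).symm
  have h2 : ∀ a, ψ a = D.sep.functionalC (D.sep.antipode (Z a)) := fun a ↦ by
    rw [D.sep.functionalC_antipode]
    exact functionalC_slice (D := D.cop) hZ a
  have h3 : ∀ b a, Z (D.rB b a) = D.sep.mB (Z a) b := fun b a ↦ slice_rC (D := D.cop) hZ b a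
  simp only [LinearMap.comp_apply, can_tmul, ← D.mul_T, h1, hG, ← D.lB_mB]
  rw [← D.sep.slice₂_functionalC_EB (D.sep.mB _ b), D.sep.EB_mul_eq]
  refine tensor_congr (F := slice₁ (ψ ∘ₗ D.mul a) ∘ₗ D.insert y x)
    (G := D.lB.flip y ∘ₗ slice₂ D.sep.functionalC ∘ₗ
      (D.sep.mC.flip (D.sep.antipode (Z (D.mul a x)))).lTensor B) (fun u v ↦ ?_) _
  simp [D.mul_rB, h2, h3, D.sep.antipode_mul]

/-- The kernel of the canonical map is `(1 - G₁)(A ⊗ A)` if the right integrals are faithful. -/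
theorem ker_can {G : A ⊗[ℂ] A →ₗ[ℂ] A ⊗[ℂ] A}
    (hR : ∀ x, (∀ ψ, D.cop.IsInvariant ψ → ∀ b, ψ (D.mul b x) = 0) → x = 0)
    (hG : ∀ x b y, G (x ⊗ₜ D.lB b y) = D.insert y x (D.sep.EB b)) :
    LinearMap.ker D.can = LinearMap.range (LinearMap.id - G) := by
  apply le_antisymm
  · intro t ht
    refine ⟨t, ?_⟩
    rw [LinearMap.mem_ker] at ht
    have : G t = 0 := by
      refine slice₁_jointly_injective
        (h := fun i : {ψ // D.cop.IsInvariant ψ} × A ↦ i.1.1 ∘ₗ D.mul i.2)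
        (fun x hx ↦ hR x fun ψ hψ b ↦ hx ⟨⟨ψ, hψ⟩, b⟩) fun i ↦ ?_
      obtain ⟨Z, hZ⟩ := i.1.2.exists_slice
      rw [D.slice₁_G hZ hG, ht, map_zero, map_zero]
    simp [this]
  · rintro _ ⟨t, rfl⟩
    simp [D.can_G hG]

/-! ### The counit -/

/-- As `ker T₁ = (1 - G₁)(A ⊗ A)` is annihilated by the product, there is a map `μ` with
`μ(Δ(a)(1 ⊗ b)) = ab`. The counit is `φ_C ∘ ε_t` where `ε_t(x)z = μ(E(x ⊗ z))`. -/
theorem exists_counit (hL : ∀ x, (∀ φ, D.IsInvariant φ → ∀ b, φ (D.mul x b) = 0) → x = 0)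
    (hR : ∀ x, (∀ ψ, D.cop.IsInvariant ψ → ∀ b, ψ (D.mul b x) = 0) → x = 0) :
    ∃ ε : A →ₗ[ℂ] ℂ, ∀ a b, slice₁ ε (D.T a b) = D.mul a b := by
  obtain ⟨G, -, hG⟩ := D.exists_G
  have hker : LinearMap.ker D.can ≤ LinearMap.ker (TensorProduct.lift D.mul) := by
    rw [D.ker_can hR hG]
    rintro _ ⟨t, rfl⟩
    simp [D.mul_G hG]
  obtain ⟨μ, hμ⟩ := exists_comp_eq_of_ker_le hker
  -- `F x z` is `μ(E(x ⊗ z))`, that is `ε_t(x)z` with the target counital map `ε_t`.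
  let F : A →ₗ[ℂ] A →ₗ[ℂ] A := (TensorProduct.mk ℂ A A).compr₂ (μ ∘ₗ D.E)
  have hF : ∀ {φ : A →ₗ[ℂ] ℂ} {Y : A →ₗ[ℂ] C}, (∀ a p, slice₂ φ (D.K a p) = D.lC (Y a) p) → ∀ a b,
      F (slice₂ φ (D.T a b)) = D.lC (Y (D.mul a b)) := by
    intro φ Y hY a b
    refine LinearMap.ext fun z ↦ ?_
    change μ (D.E (slice₂ φ (D.T a b) ⊗ₜ z)) = _
    rw [← can_sliceT hY]
    have h1 : ∀ t, μ (D.can t) = TensorProduct.lift D.mul t := LinearMap.congr_fun hμ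
    rw [h1, ← hY, D.mul_K]
    exact tensor_congr (F := TensorProduct.lift D.mul ∘ₗ D.sliceT φ a)
      (G := slice₂ φ ∘ₗ coproductAct D.mul D.T a) (fun k l ↦ by simp [slice₂_rTensor]) _
  -- The multiplier `F x` belongs to `C`, since the slices by left integrals span `A`.
  have hmem : ∀ x, ∃ c, D.lC c = F x := by
    have : (LinearMap.range D.lC).comap F = ⊤ := by
      rw [eq_top_iff, ← D.span_slice_eq_top hL, Submodule.span_le]
      rintro _ ⟨φ, hφ, a, b, rfl⟩
      obtain ⟨Y, hY⟩ := hφ.exists_slice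
      exact ⟨_, (hF hY a b).symm⟩
    intro x
    have hx : x ∈ (LinearMap.range D.lC).comap F := this ▸ Submodule.mem_top
    exact hx
  obtain ⟨εt, hεt⟩ := exists_comp_eq_of_mem_range D.lC_injective hmem
  refine ⟨D.sep.functionalC ∘ₗ εt, fun a b ↦ sub_eq_zero.mp (hL _ fun φ hφ b' ↦ ?_)⟩
  obtain ⟨Y, hY⟩ := hφ.exists_slice
  have h1 : D.mul (slice₁ (D.sep.functionalC ∘ₗ εt) (D.T a b)) b' =
      slice₁ (D.sep.functionalC ∘ₗ εt) (D.T a (D.mul b b')) := by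
    rw [D.T_mul, slice₁_lTensor]; rfl
  have h3 : εt (slice₂ φ (D.T a (D.mul b b'))) = Y (D.mul a (D.mul b b')) :=
    D.lC_injective ((hεt _).trans (hF hY _ _))
  rw [map_sub, LinearMap.sub_apply, map_sub, h1, apply_slice₁, LinearMap.comp_apply, h3, D.mul_assoc,
    ← functionalC_slice hY, sub_self]

end OneSidedDatum

end WeakMultiplierHopf

end

noncomputable section

namespace WeakMultiplierHopf

/-! ### Multiplier algebras -/

section Basic

variable {A : Type*} [NonUnitalRing A] [Module ℂ A] [IsScalarTower ℂ A A] [SMulCommClass ℂ A A]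
variable {B : Type*} [NonUnitalRing B] [Module ℂ B] [IsScalarTower ℂ B B] [SMulCommClass ℂ B B]

theorem Mult.mul_lact (m n : Mult A) (a : A) : (m * n).lact a = m.lact (n.lact a) := rfl

theorem Mult.mul_ract (m n : Mult A) (a : A) : (m * n).ract a = n.ract (m.ract a) := rfl

@[simp] theorem toMult_lact (a b : A) : (toMult A a).lact b = a * b := rfl

@[simp] theorem toMult_ract (a b : A) : (toMult A a).ract b = b * a := rfl

/-- The left action of multipliers, as a linear map. -/
def lactHom (A : Type*) [NonUnitalRing A] [Module ℂ A] [IsScalarTower ℂ A A]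
    [SMulCommClass ℂ A A] : Mult A →ₗ[ℂ] A →ₗ[ℂ] A where
  toFun m := m.lact
  map_add' _ _ := rfl
  map_smul' _ _ := rfl

/-- The right action of multipliers, as a linear map. -/
def ractHom (A : Type*) [NonUnitalRing A] [Module ℂ A] [IsScalarTower ℂ A A]
    [SMulCommClass ℂ A A] : Mult A →ₗ[ℂ] A →ₗ[ℂ] A where
  toFun m := m.ract
  map_add' _ _ := rfl
  map_smul' _ _ := rfl

@[simp] theorem lactHom_apply (m : Mult A) (a : A) : lactHom A m a = m.lact a := rfl

@[simp] theorem ractHom_apply (m : Mult A) (a : A) : ractHom A m a = m.ract a := rfl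

theorem Mult.ext {m n : Mult A} (h₁ : m.lact = n.lact) (h₂ : m.ract = n.ract) : m = n :=
  Subtype.ext (Prod.ext h₁ (MulOpposite.unop_injective h₂))

theorem toMult_mul_toMult (a b : A) : toMult A (a * b) = toMult A a * toMult A b :=
  Mult.ext (LinearMap.ext fun c ↦ mul_assoc a b c) (LinearMap.ext fun c ↦ (mul_assoc c a b).symm)

theorem IsNondegenerateAlg.tensor (hA : IsNondegenerateAlg A) (hB : IsNondegenerateAlg B) :
    IsNondegenerateAlg (A ⊗[ℂ] B) := by
  constructor
  · intro t ht
    refine rTensor_jointly_injective (h := fun a : A ↦ LinearMap.mulRight ℂ a)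
      (fun v hv ↦ hA.1 v hv) fun a ↦ ?_
    refine lTensor_jointly_injective (h := fun b : B ↦ LinearMap.mulRight ℂ b)
      (fun v hv ↦ hB.1 v hv) fun b ↦ ?_
    rw [← ht (a ⊗ₜ b)]
    exact tensor_congr (F := (LinearMap.mulRight ℂ b).lTensor A ∘ₗ
      (LinearMap.mulRight ℂ a).rTensor B) (G := LinearMap.mulRight ℂ (a ⊗ₜ b))
      (fun x y ↦ by simp) t
  · intro t ht
    refine rTensor_jointly_injective (h := fun a : A ↦ LinearMap.mulLeft ℂ a)
      (fun v hv ↦ hA.2 v hv) fun a ↦ ?_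
    refine lTensor_jointly_injective (h := fun b : B ↦ LinearMap.mulLeft ℂ b)
      (fun v hv ↦ hB.2 v hv) fun b ↦ ?_
    rw [← ht (a ⊗ₜ b)]
    exact tensor_congr (F := (LinearMap.mulLeft ℂ b).lTensor A ∘ₗ
      (LinearMap.mulLeft ℂ a).rTensor B) (G := LinearMap.mulLeft ℂ (a ⊗ₜ b))
      (fun x y ↦ by simp) t

theorem IsIdempotentAlg.induction (hA : IsIdempotentAlg A) {N : Submodule ℂ A}
    (h : ∀ a b, a * b ∈ N) (a : A) : a ∈ N := by
  have : (⊤ : Submodule ℂ A) ≤ N := by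
    rw [← hA, Submodule.span_le]
    rintro _ ⟨p, rfl⟩
    exact h p.1 p.2
  exact this Submodule.mem_top

theorem IsIdempotentAlg.hom_ext (hA : IsIdempotentAlg A) {U : Type*} [AddCommGroup U] [Module ℂ U]
    {F G : A →ₗ[ℂ] U} (h : ∀ a b, F (a * b) = G (a * b)) (a : A) : F a = G a :=
  hA.induction (N := LinearMap.eqLocus F G) h a

namespace IsNondegenerateAlg

variable (hA : IsNondegenerateAlg A)

include hA

theorem lact_mul (m : Mult A) (a b : A) : m.lact (a * b) = m.lact a * b := by
  refine sub_eq_zero.mp (hA.2 _ fun c ↦ ?_)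
  rw [mul_sub, m.compat, ← mul_assoc, ← mul_assoc, m.compat, sub_self]

theorem ract_mul (m : Mult A) (a b : A) : m.ract (a * b) = a * m.ract b := by
  refine sub_eq_zero.mp (hA.1 _ fun c ↦ ?_)
  rw [sub_mul, ← m.compat, mul_assoc, mul_assoc, ← m.compat, sub_self]

theorem ext_lact {m n : Mult A} (h : ∀ a, m.lact a = n.lact a) : m = n := by
  refine Mult.ext (LinearMap.ext h) (LinearMap.ext fun a ↦ sub_eq_zero.mp (hA.1 _ fun b ↦ ?_))
  rw [sub_mul, ← m.compat, ← n.compat, h, sub_self]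

theorem ext_ract {m n : Mult A} (h : ∀ a, m.ract a = n.ract a) : m = n := by
  refine Mult.ext (LinearMap.ext fun a ↦ sub_eq_zero.mp (hA.2 _ fun b ↦ ?_)) (LinearMap.ext h)
  rw [mul_sub, m.compat, n.compat, h, sub_self]

theorem toMult_injective : Function.Injective (toMult A) :=
  (injective_iff_map_eq_zero _).mpr fun a h ↦ hA.1 a fun b ↦ by
    rw [← toMult_lact, h]; rfl

theorem mul_toMult (m : Mult A) (a : A) : m * toMult A a = toMult A (m.lact a) :=
  hA.ext_lact fun b ↦ hA.lact_mul m a b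

theorem toMult_mul (m : Mult A) (a : A) : toMult A a * m = toMult A (m.ract a) :=
  hA.ext_ract fun b ↦ hA.ract_mul m b a

theorem eq_of_toMult_mul {X Y : Mult A} (h : ∀ w, toMult A w * X = toMult A w * Y) : X = Y :=
  hA.ext_ract fun w ↦ hA.toMult_injective (by rw [← hA.toMult_mul, h, hA.toMult_mul])

end IsNondegenerateAlg

theorem tens_lact (x : Mult A) (y : Mult B) :
    (tens x y).lact = TensorProduct.map x.lact y.lact := rfl

theorem tens_ract (x : Mult A) (y : Mult B) :
    (tens x y).ract = TensorProduct.map x.ract y.ract := rfl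

theorem tens_mul_tens (x x' : Mult A) (y y' : Mult B) :
    tens x y * tens x' y' = tens (x * x') (y * y') :=
  Mult.ext (TensorProduct.ext' fun _ _ ↦ rfl) (TensorProduct.ext' fun _ _ ↦ rfl)

theorem tens_one_one : tens (1 : Mult A) (1 : Mult B) = 1 :=
  Mult.ext TensorProduct.map_id TensorProduct.map_id

theorem tens_toMult (a : A) (b : B) :
    tens (toMult A a) (toMult B b) = toMult (A ⊗[ℂ] B) (a ⊗ₜ b) :=
  Mult.ext (TensorProduct.ext' fun x y ↦ by simp [tens_lact])
    (TensorProduct.ext' fun x y ↦ by simp [tens_ract])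

section

variable (hA : IsNondegenerateAlg A) (hB : IsNondegenerateAlg B)

include hA hB

theorem tens_left_mul_toMult (m : Mult A) (t : A ⊗[ℂ] B) :
    tens m 1 * toMult _ t = toMult _ (m.lact.rTensor B t) :=
  (hA.tensor hB).mul_toMult _ t

theorem tens_right_mul_toMult (m : Mult B) (t : A ⊗[ℂ] B) :
    tens 1 m * toMult _ t = toMult _ (m.lact.lTensor A t) :=
  (hA.tensor hB).mul_toMult _ t

theorem toMult_mul_tens_left (m : Mult A) (t : A ⊗[ℂ] B) :
    toMult _ t * tens m 1 = toMult _ (m.ract.rTensor B t) :=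
  (hA.tensor hB).toMult_mul _ t

theorem toMult_mul_tens_right (m : Mult B) (t : A ⊗[ℂ] B) :
    toMult _ t * tens 1 m = toMult _ (m.ract.lTensor A t) :=
  (hA.tensor hB).toMult_mul _ t

end

theorem transport_toMult (e : A ≃ₗ[ℂ] B) (he : ∀ x y, e (x * y) = e x * e y) (a : A) :
    transport e he (toMult A a) = toMult B (e a) := by
  refine Mult.ext (LinearMap.ext fun b ↦ ?_) (LinearMap.ext fun b ↦ ?_)
  · change e (a * e.symm b) = e a * b
    rw [he, e.apply_symm_apply]
  · change e (e.symm b * a) = b * e a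
    rw [he, e.apply_symm_apply]

theorem transport_lact (e : A ≃ₗ[ℂ] B) (he : ∀ x y, e (x * y) = e x * e y) (m : Mult A) (b : B) :
    (transport e he m).lact b = e (m.lact (e.symm b)) := rfl

theorem transport_ract (e : A ≃ₗ[ℂ] B) (he : ∀ x y, e (x * y) = e x * e y) (m : Mult A) (b : B) :
    (transport e he m).ract b = e (m.ract (e.symm b)) := rfl

theorem transport_injective (e : A ≃ₗ[ℂ] B) (he : ∀ x y, e (x * y) = e x * e y) :
    Function.Injective (transport e he) := by
  intro m n h
  refine Mult.ext (LinearMap.ext fun a ↦ ?_) (LinearMap.ext fun a ↦ ?_)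
  · have := congrArg (fun k ↦ e.symm (k.lact (e a))) h
    simpa [transport_lact] using this
  · have := congrArg (fun k ↦ e.symm (k.ract (e a))) h
    simpa [transport_ract] using this

end Basic

/-! ### Legs of multipliers -/

section Legs

variable {A : Type*} [NonUnitalRing A] [Module ℂ A] [IsScalarTower ℂ A A] [SMulCommClass ℂ A A]

theorem reassoc_tens (x y z : Mult A) : reassoc (tens x (tens y z)) = tens (tens x y) z :=
  Mult.ext (TensorProduct.ext_threefold fun _ _ _ ↦ rfl)
    (TensorProduct.ext_threefold fun _ _ _ ↦ rfl)

theorem reassoc_injective : Function.Injective (reassoc (A := A)) := transport_injective _ _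

theorem reassoc_toMult (t : A ⊗[ℂ] (A ⊗[ℂ] A)) :
    reassoc (toMult _ t) = toMult _ ((TensorProduct.assoc ℂ A A A).symm t) :=
  transport_toMult _ _ t

theorem leg₁₂_mul (m n : Mult (A ⊗[ℂ] A)) : leg₁₂ (m * n) = leg₁₂ m * leg₁₂ n := by
  rw [leg₁₂, leg₁₂, leg₁₂, tens_mul_tens, one_mul]

theorem leg₂₃_mul (m n : Mult (A ⊗[ℂ] A)) : leg₂₃ (m * n) = leg₂₃ m * leg₂₃ n := by
  rw [leg₂₃, leg₂₃, leg₂₃, ← map_mul, tens_mul_tens, one_mul]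

theorem leg₂₃_tens (x y : Mult A) : leg₂₃ (tens x y) = tens (tens 1 x) y :=
  reassoc_tens 1 x y

theorem leg₁₂_tens (x y : Mult A) : leg₁₂ (tens x y) = tens (tens x y) 1 := rfl

theorem leg₁₂_inl (c : A) : leg₁₂ (inl c) = tens (inl c) 1 := rfl

theorem leg₂₃_inr (c : A) : leg₂₃ (inr c) = tens 1 (toMult A c) := by
  rw [inr, leg₂₃_tens, tens_one_one]

theorem inl_mul (a b : A) : inl (a * b) = inl a * inl b := by
  rw [inl, inl, inl, tens_mul_tens, one_mul, toMult_mul_toMult]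

theorem inr_mul (a b : A) : inr (a * b) = inr a * inr b := by
  rw [inr, inr, inr, tens_mul_tens, one_mul, toMult_mul_toMult]

theorem inl_inr_comm (a b : A) : inl a * inr b = inr b * inl a := by
  simp only [inl, inr, tens_mul_tens, one_mul, mul_one]

theorem inl_mul_inr (a b : A) : inl a * inr b = toMult _ (a ⊗ₜ b) := by
  simp only [inl, inr, tens_mul_tens, one_mul, mul_one, tens_toMult]

theorem leg_comm (a b : A) : leg₁₂ (inl a) * leg₂₃ (inr b) = leg₂₃ (inr b) * leg₁₂ (inl a) := by
  simp only [leg₁₂_inl, leg₂₃_inr, tens_mul_tens, one_mul, mul_one]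

section

variable (hA : IsNondegenerateAlg A)

include hA

theorem eq_of_leg₁₂_inl_mul {X Y : Mult ((A ⊗[ℂ] A) ⊗[ℂ] A)}
    (h : ∀ c, leg₁₂ (inl c) * X = leg₁₂ (inl c) * Y) : X = Y := by
  refine ((hA.tensor hA).tensor hA).ext_lact fun w ↦ sub_eq_zero.mp ?_
  refine rTensor_jointly_injective (h := fun c : A ↦ (LinearMap.mulLeft ℂ c).rTensor A)
    (fun v hv ↦ rTensor_jointly_injective (h := fun c : A ↦ LinearMap.mulLeft ℂ c) hA.2 hv)
    fun c ↦ ?_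
  rw [map_sub, sub_eq_zero]
  exact congrArg (fun k ↦ k.lact w) (h c)

theorem eq_of_mul_leg₂₃_inr {X Y : Mult ((A ⊗[ℂ] A) ⊗[ℂ] A)}
    (h : ∀ c, X * leg₂₃ (inr c) = Y * leg₂₃ (inr c)) : X = Y := by
  refine ((hA.tensor hA).tensor hA).ext_ract fun w ↦ sub_eq_zero.mp ?_
  refine lTensor_jointly_injective (h := fun c : A ↦ LinearMap.mulRight ℂ c) hA.1
    fun c ↦ ?_
  rw [map_sub, sub_eq_zero]
  have := congrArg (fun k ↦ k.ract w) (h c)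
  simp only [leg₂₃_inr] at this
  exact this

theorem eq_of_leg₂₃_inr_mul {X Y : Mult ((A ⊗[ℂ] A) ⊗[ℂ] A)}
    (h : ∀ c, leg₂₃ (inr c) * X = leg₂₃ (inr c) * Y) : X = Y := by
  refine ((hA.tensor hA).tensor hA).ext_lact fun w ↦ sub_eq_zero.mp ?_
  refine lTensor_jointly_injective (h := fun c : A ↦ LinearMap.mulLeft ℂ c) hA.2
    fun c ↦ ?_
  rw [map_sub, sub_eq_zero]
  have := congrArg (fun k ↦ k.lact w) (h c)
  simp only [leg₂₃_inr] at this
  exact this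

end

end Legs

/-! ### The maps `Δ ⊗ ι` and `ι ⊗ Δ` -/

section Coproduct

variable {A : Type*} [NonUnitalRing A] [Module ℂ A] [IsScalarTower ℂ A A] [SMulCommClass ℂ A A]
variable (Δ : A →ₙₐ[ℂ] Mult (A ⊗[ℂ] A))

theorem deltaId_tmul (x y : A) : deltaId Δ (x ⊗ₜ y) = tens (Δ x) (toMult A y) := rfl

theorem idDelta_tmul (x y : A) : idDelta Δ (x ⊗ₜ y) = reassoc (tens (toMult A x) (Δ y)) := rfl

/-- A linear map on `Y ⊗ Y` is multiplicative if it is so on pure tensors. -/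
theorem tensor_mul_congr {X Y : Type*} [Ring X] [Algebra ℂ X] [NonUnitalRing Y] [Module ℂ Y]
    [IsScalarTower ℂ Y Y] [SMulCommClass ℂ Y Y] {F : Y ⊗[ℂ] Y →ₗ[ℂ] X}
    (h : ∀ a b c d, F ((a ⊗ₜ b) * (c ⊗ₜ d)) = F (a ⊗ₜ b) * F (c ⊗ₜ d)) (s t : Y ⊗[ℂ] Y) :
    F (s * t) = F s * F t := by
  induction s using TensorProduct.induction_on with
  | zero => simp
  | add s s' h h' => rw [add_mul, map_add, h, h', map_add, add_mul]
  | tmul a b =>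
    induction t using TensorProduct.induction_on with
    | zero => simp
    | add s s' h h' => rw [mul_add, map_add, h, h', map_add, mul_add]
    | tmul c d => exact h a b c d

theorem deltaId_mul (s t : A ⊗[ℂ] A) : deltaId Δ (s * t) = deltaId Δ s * deltaId Δ t :=
  tensor_mul_congr (fun a b c d ↦ by
    simp only [Algebra.TensorProduct.tmul_mul_tmul, deltaId_tmul, tens_mul_tens, map_mul,
      toMult_mul_toMult]) s t

theorem idDelta_mul (s t : A ⊗[ℂ] A) : idDelta Δ (s * t) = idDelta Δ s * idDelta Δ t :=
  tensor_mul_congr (fun a b c d ↦ by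
    simp only [Algebra.TensorProduct.tmul_mul_tmul, idDelta_tmul, ← map_mul, tens_mul_tens,
      toMult_mul_toMult]) s t

end Coproduct

end WeakMultiplierHopf

end

noncomputable section

namespace WeakMultiplierHopf

variable {A : Type*} [NonUnitalRing A] [Module ℂ A] [IsScalarTower ℂ A A] [SMulCommClass ℂ A A]

/-! ### Coassociativity in its various forms -/

/-- The four canonical maps of a regular coproduct, as bilinear maps into `A ⊗ A`: `T a b = Δ(a)(1 ⊗ b)`,
`K a b = Δ(a)(b ⊗ 1)`, `T' c a = (c ⊗ 1)Δ(a)` and `K' c a = (1 ⊗ c)Δ(a)`. -/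
structure CanonicalMaps (Δ : A →ₙₐ[ℂ] Mult (A ⊗[ℂ] A)) where
  T : A →ₗ[ℂ] A →ₗ[ℂ] A ⊗[ℂ] A
  K : A →ₗ[ℂ] A →ₗ[ℂ] A ⊗[ℂ] A
  T' : A →ₗ[ℂ] A →ₗ[ℂ] A ⊗[ℂ] A
  K' : A →ₗ[ℂ] A →ₗ[ℂ] A ⊗[ℂ] A
  toMult_T : ∀ a b, toMult _ (T a b) = Δ a * inr b
  toMult_K : ∀ a b, toMult _ (K a b) = Δ a * inl b
  toMult_T' : ∀ c a, toMult _ (T' c a) = inl c * Δ a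
  toMult_K' : ∀ c a, toMult _ (K' c a) = inr c * Δ a

theorem inl_eq (c : A) : inl c = (tens.flip 1 ∘ₗ toMult A) c := rfl

theorem inr_eq (c : A) : inr c = (tens 1 ∘ₗ toMult A) c := rfl

theorem exists_bilinear_toMult (hA : IsNondegenerateAlg A)
    {G : A → A → Mult (A ⊗[ℂ] A)} (hadd : ∀ a a' b, G (a + a') b = G a b + G a' b)
    (hsmul : ∀ (r : ℂ) a b, G (r • a) b = r • G a b)
    (hadd' : ∀ a b b', G a (b + b') = G a b + G a b')
    (hsmul' : ∀ (r : ℂ) a b, G a (r • b) = r • G a b)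
    (h : ∀ a b, G a b ∈ LinearMap.range (toMult (A ⊗[ℂ] A))) :
    ∃ F : A →ₗ[ℂ] A →ₗ[ℂ] A ⊗[ℂ] A, ∀ a b, toMult _ (F a b) = G a b := by
  choose F hF using h
  have hi := (hA.tensor hA).toMult_injective
  exact ⟨LinearMap.mk₂ ℂ F
    (fun a a' b ↦ hi (by rw [map_add, hF, hF, hF, hadd]))
    (fun r a b ↦ hi (by rw [map_smul, hF, hF, hsmul]))
    (fun a b b' ↦ hi (by rw [map_add, hF, hF, hF, hadd']))
    (fun r a b ↦ hi (by rw [map_smul, hF, hF, hsmul'])), hF⟩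

theorem IsRegularCoproduct.nonempty_canonicalMaps {Δ : A →ₙₐ[ℂ] Mult (A ⊗[ℂ] A)}
    (h : IsRegularCoproduct Δ) (hA : IsNondegenerateAlg A) : Nonempty (CanonicalMaps Δ) := by
  obtain ⟨T, hT⟩ := exists_bilinear_toMult hA (G := fun a b ↦ Δ a * inr b)
    (by simp [add_mul]) (by simp) (by simp [inr_eq, mul_add]) (by simp [inr_eq]) h.mem₁
  obtain ⟨K, hK⟩ := exists_bilinear_toMult hA (G := fun a b ↦ Δ a * inl b)
    (by simp [add_mul]) (by simp) (by simp [inl_eq, mul_add]) (by simp [inl_eq]) h.mem₄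
  obtain ⟨T', hT'⟩ := exists_bilinear_toMult hA (G := fun c a ↦ inl c * Δ a)
    (by simp [inl_eq, add_mul]) (by simp [inl_eq]) (by simp [mul_add]) (by simp) h.mem₂
  obtain ⟨K', hK'⟩ := exists_bilinear_toMult hA (G := fun c a ↦ inr c * Δ a)
    (by simp [inr_eq, add_mul]) (by simp [inr_eq]) (by simp [mul_add]) (by simp) h.mem₃
  exact ⟨⟨T, K, T', K', hT, hK, hT', hK'⟩⟩

variable (Δ : A →ₙₐ[ℂ] Mult (A ⊗[ℂ] A))

section Covers

theorem deltaId_leg₂₃_inr (t : A ⊗[ℂ] A) (z : A) :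
    deltaId Δ t * leg₂₃ (inr z) = deltaId Δ ((LinearMap.mulRight ℂ z).lTensor A t) :=
  tensor_congr (F := LinearMap.mulRight ℂ (leg₂₃ (inr z)) ∘ₗ deltaId Δ)
    (G := deltaId Δ ∘ₗ (LinearMap.mulRight ℂ z).lTensor A) (fun x y ↦ by
      simp [deltaId_tmul, leg₂₃_inr, tens_mul_tens, toMult_mul_toMult]) t

theorem leg₂₃_inr_deltaId (t : A ⊗[ℂ] A) (z : A) :
    leg₂₃ (inr z) * deltaId Δ t = deltaId Δ ((LinearMap.mulLeft ℂ z).lTensor A t) :=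
  tensor_congr (F := LinearMap.mulLeft ℂ (leg₂₃ (inr z)) ∘ₗ deltaId Δ)
    (G := deltaId Δ ∘ₗ (LinearMap.mulLeft ℂ z).lTensor A) (fun x y ↦ by
      simp [deltaId_tmul, leg₂₃_inr, tens_mul_tens, toMult_mul_toMult]) t

theorem leg₁₂_inl_eq (c : A) : leg₁₂ (inl c) = reassoc (tens (toMult A c) 1) := by
  rw [← tens_one_one, reassoc_tens]; rfl

theorem idDelta_leg₁₂_inl (t : A ⊗[ℂ] A) (c : A) :
    idDelta Δ t * leg₁₂ (inl c) = idDelta Δ ((LinearMap.mulRight ℂ c).rTensor A t) :=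
  tensor_congr (F := LinearMap.mulRight ℂ (leg₁₂ (inl c)) ∘ₗ idDelta Δ)
    (G := idDelta Δ ∘ₗ (LinearMap.mulRight ℂ c).rTensor A) (fun x y ↦ by
      simp [idDelta_tmul, leg₁₂_inl_eq, ← map_mul, tens_mul_tens, toMult_mul_toMult]) t

theorem leg₁₂_inl_idDelta (t : A ⊗[ℂ] A) (c : A) :
    leg₁₂ (inl c) * idDelta Δ t = idDelta Δ ((LinearMap.mulLeft ℂ c).rTensor A t) :=
  tensor_congr (F := LinearMap.mulLeft ℂ (leg₁₂ (inl c)) ∘ₗ idDelta Δ)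
    (G := idDelta Δ ∘ₗ (LinearMap.mulLeft ℂ c).rTensor A) (fun x y ↦ by
      simp [idDelta_tmul, leg₁₂_inl_eq, ← map_mul, tens_mul_tens, toMult_mul_toMult]) t

end Covers

namespace CanonicalMaps

variable {Δ} (M : CanonicalMaps Δ)

theorem leg₁₂_inl_deltaId (t : A ⊗[ℂ] A) (c : A) :
    leg₁₂ (inl c) * deltaId Δ t = toMult _ ((M.T' c).rTensor A t) :=
  tensor_congr (F := LinearMap.mulLeft ℂ (leg₁₂ (inl c)) ∘ₗ deltaId Δ)
    (G := toMult _ ∘ₗ (M.T' c).rTensor A) (fun x y ↦ by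
      simp [deltaId_tmul, leg₁₂_inl, tens_mul_tens, ← tens_toMult, M.toMult_T']) t

theorem deltaId_leg₁₂_inl (t : A ⊗[ℂ] A) (c : A) :
    deltaId Δ t * leg₁₂ (inl c) = toMult _ ((M.K.flip c).rTensor A t) :=
  tensor_congr (F := LinearMap.mulRight ℂ (leg₁₂ (inl c)) ∘ₗ deltaId Δ)
    (G := toMult _ ∘ₗ (M.K.flip c).rTensor A) (fun x y ↦ by
      simp [deltaId_tmul, leg₁₂_inl, tens_mul_tens, ← tens_toMult, M.toMult_K]) t

theorem leg₂₃_inr_idDelta (t : A ⊗[ℂ] A) (c : A) :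
    leg₂₃ (inr c) * idDelta Δ t =
      toMult _ ((TensorProduct.assoc ℂ A A A).symm ((M.K' c).lTensor A t)) :=
  tensor_congr (F := LinearMap.mulLeft ℂ (leg₂₃ (inr c)) ∘ₗ idDelta Δ)
    (G := toMult _ ∘ₗ (TensorProduct.assoc ℂ A A A).symm.toLinearMap ∘ₗ (M.K' c).lTensor A)
    (fun x y ↦ by
      simp [idDelta_tmul, leg₂₃, ← map_mul, tens_mul_tens, ← reassoc_toMult, ← tens_toMult,
        M.toMult_K']) t

theorem idDelta_leg₂₃_inr (t : A ⊗[ℂ] A) (c : A) :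
    idDelta Δ t * leg₂₃ (inr c) =
      toMult _ ((TensorProduct.assoc ℂ A A A).symm ((M.T.flip c).lTensor A t)) :=
  tensor_congr (F := LinearMap.mulRight ℂ (leg₂₃ (inr c)) ∘ₗ idDelta Δ)
    (G := toMult _ ∘ₗ (TensorProduct.assoc ℂ A A A).symm.toLinearMap ∘ₗ (M.T.flip c).lTensor A)
    (fun x y ↦ by
      simp [idDelta_tmul, leg₂₃, ← map_mul, tens_mul_tens, ← reassoc_toMult, ← tens_toMult,
        M.toMult_T]) t

variable (hA : IsNondegenerateAlg A)

section

include hA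

theorem toMult_mul_inl (t : A ⊗[ℂ] A) (p : A) :
    toMult _ t * inl p = toMult _ ((LinearMap.mulRight ℂ p).rTensor A t) :=
  toMult_mul_tens_left hA hA _ t

theorem toMult_mul_inr (t : A ⊗[ℂ] A) (p : A) :
    toMult _ t * inr p = toMult _ ((LinearMap.mulRight ℂ p).lTensor A t) :=
  toMult_mul_tens_right hA hA _ t

theorem inl_mul_toMult (t : A ⊗[ℂ] A) (p : A) :
    inl p * toMult _ t = toMult _ ((LinearMap.mulLeft ℂ p).rTensor A t) :=
  tens_left_mul_toMult hA hA _ t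

theorem inr_mul_toMult (t : A ⊗[ℂ] A) (p : A) :
    inr p * toMult _ t = toMult _ ((LinearMap.mulLeft ℂ p).lTensor A t) :=
  tens_right_mul_toMult hA hA _ t

theorem T_mul_left (a b p : A) : (LinearMap.mulRight ℂ p).rTensor A (M.T a b) =
    (LinearMap.mulRight ℂ b).lTensor A (M.K a p) := by
  apply (hA.tensor hA).toMult_injective
  rw [← toMult_mul_inl hA, ← toMult_mul_inr hA, M.toMult_T, M.toMult_K, mul_assoc, mul_assoc,
    inl_inr_comm]

theorem T'_mul_right (c a p : A) : (LinearMap.mulRight ℂ p).rTensor A (M.T' c a) =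
    (LinearMap.mulLeft ℂ c).rTensor A (M.K a p) := by
  apply (hA.tensor hA).toMult_injective
  rw [← toMult_mul_inl hA, ← inl_mul_toMult hA, M.toMult_T', M.toMult_K, mul_assoc]

theorem T'_mul_right' (c a p : A) : (LinearMap.mulRight ℂ p).lTensor A (M.T' c a) =
    (LinearMap.mulLeft ℂ c).rTensor A (M.T a p) := by
  apply (hA.tensor hA).toMult_injective
  rw [← toMult_mul_inr hA, ← inl_mul_toMult hA, M.toMult_T', M.toMult_T, mul_assoc]

theorem T'_mul_left (c a p : A) : (LinearMap.mulLeft ℂ p).lTensor A (M.T' c a) =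
    (LinearMap.mulLeft ℂ c).rTensor A (M.K' p a) := by
  apply (hA.tensor hA).toMult_injective
  rw [← inr_mul_toMult hA, ← inl_mul_toMult hA, M.toMult_T', M.toMult_K', ← mul_assoc, ← mul_assoc,
    inl_inr_comm]

theorem K'_mul_right (c a p : A) : (LinearMap.mulRight ℂ p).lTensor A (M.K' c a) =
    (LinearMap.mulLeft ℂ c).lTensor A (M.T a p) := by
  apply (hA.tensor hA).toMult_injective
  rw [← toMult_mul_inr hA, ← inr_mul_toMult hA, M.toMult_K', M.toMult_T, mul_assoc]

end

variable (hΔ : IsCoproduct Δ)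

section

include hΔ

theorem coassoc (a b c : A) : leg₁₂ (inl c) * deltaId Δ (M.T a b) =
    idDelta Δ (M.T' c a) * leg₂₃ (inr b) :=
  hΔ.coassoc a b c _ _ (M.toMult_T a b) (M.toMult_T' c a)

include hA

theorem coassoc_T' (a b c : A) : TensorProduct.assoc ℂ A A A ((M.T' c).rTensor A (M.T a b)) =
    (M.T.flip b).lTensor A (M.T' c a) := by
  have h := M.coassoc hΔ a b c
  rw [M.leg₁₂_inl_deltaId, M.idDelta_leg₂₃_inr] at h
  rw [((hA.tensor hA).tensor hA).toMult_injective h, LinearEquiv.apply_symm_apply]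

/-- `(Δ ⊗ ι)(Δ(a)(1 ⊗ z))(r ⊗ 1 ⊗ 1) = (ι ⊗ Δ)(Δ(a)(r ⊗ 1))(1 ⊗ 1 ⊗ z)`. -/
theorem coassoc_right (a z r : A) : deltaId Δ (M.T a z) * leg₁₂ (inl r) =
    idDelta Δ (M.K a r) * leg₂₃ (inr z) := by
  refine eq_of_leg₁₂_inl_mul hA fun c ↦ ?_
  rw [← mul_assoc, M.coassoc hΔ, mul_assoc, ← leg_comm, ← mul_assoc, idDelta_leg₁₂_inl,
    M.T'_mul_right hA, ← leg₁₂_inl_idDelta, mul_assoc]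

/-- `(r ⊗ 1 ⊗ 1)(Δ ⊗ ι)((1 ⊗ z)Δ(a)) = (1 ⊗ 1 ⊗ z)(ι ⊗ Δ)((r ⊗ 1)Δ(a))`. -/
theorem coassoc_left (a z r : A) : leg₁₂ (inl r) * deltaId Δ (M.K' z a) =
    leg₂₃ (inr z) * idDelta Δ (M.T' r a) := by
  refine eq_of_mul_leg₂₃_inr hA fun c ↦ ?_
  rw [mul_assoc, deltaId_leg₂₃_inr, M.K'_mul_right hA, ← leg₂₃_inr_deltaId, ← mul_assoc, leg_comm,
    mul_assoc, M.coassoc hΔ, mul_assoc]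

/-- `(1 ⊗ 1 ⊗ c)(ι ⊗ Δ)(Δ(a)(b ⊗ 1)) = (Δ ⊗ ι)((1 ⊗ c)Δ(a))(b ⊗ 1 ⊗ 1)`. -/
theorem coassoc_cop (a b c : A) : leg₂₃ (inr c) * idDelta Δ (M.K a b) =
    deltaId Δ (M.K' c a) * leg₁₂ (inl b) := by
  refine eq_of_mul_leg₂₃_inr hA fun z ↦ ?_
  rw [mul_assoc, ← M.coassoc_right hA hΔ, ← mul_assoc, leg₂₃_inr_deltaId, mul_assoc, leg_comm,
    ← mul_assoc, deltaId_leg₂₃_inr, M.K'_mul_right hA]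

theorem assoc_K_T (a z r : A) : TensorProduct.assoc ℂ A A A ((M.K.flip r).rTensor A (M.T a z)) =
    (M.T.flip z).lTensor A (M.K a r) := by
  have h := M.coassoc_right hA hΔ a z r
  rw [M.deltaId_leg₁₂_inl, M.idDelta_leg₂₃_inr] at h
  rw [((hA.tensor hA).tensor hA).toMult_injective h, LinearEquiv.apply_symm_apply]

theorem assoc_T'_K' (a z r : A) : TensorProduct.assoc ℂ A A A ((M.T' r).rTensor A (M.K' z a)) =
    (M.K' z).lTensor A (M.T' r a) := by
  have h := M.coassoc_left hA hΔ a z r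
  rw [M.leg₁₂_inl_deltaId, M.leg₂₃_inr_idDelta] at h
  rw [((hA.tensor hA).tensor hA).toMult_injective h, LinearEquiv.apply_symm_apply]

end

end CanonicalMaps

/-- Slicing the outer legs of an identity in a threefold tensor product. -/
theorem slice₂_of_assoc {V : Type*} [AddCommGroup V] [Module ℂ V] {P Q : V →ₗ[ℂ] V ⊗[ℂ] V}
    {s t : V ⊗[ℂ] V}
    (h : TensorProduct.assoc ℂ V V V (P.rTensor V s) = Q.lTensor V t) (φ : V →ₗ[ℂ] ℂ) :
    P (slice₂ φ s) = (slice₂ φ ∘ₗ Q).lTensor V t := by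
  rw [LinearMap.lTensor_comp_apply, ← h]
  refine tensor_congr (F := P ∘ₗ slice₂ φ) (G := (slice₂ φ).lTensor V ∘ₗ
    (TensorProduct.assoc ℂ V V V).toLinearMap ∘ₗ P.rTensor V) (fun x y ↦ ?_) s
  simp only [LinearMap.comp_apply, slice₂_tmul, map_smul, LinearMap.rTensor_tmul,
    LinearEquiv.coe_coe]
  exact tensor_congr (F := φ y • LinearMap.id) (G := (slice₂ φ).lTensor V ∘ₗ
    (TensorProduct.assoc ℂ V V V).toLinearMap ∘ₗ (TensorProduct.mk ℂ (V ⊗[ℂ] V) V).flip y)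
    (fun a b ↦ by simp) (P x)

theorem slice₁_of_assoc {V : Type*} [AddCommGroup V] [Module ℂ V] {P Q : V →ₗ[ℂ] V ⊗[ℂ] V}
    {s t : V ⊗[ℂ] V}
    (h : TensorProduct.assoc ℂ V V V (P.rTensor V s) = Q.lTensor V t) (f : V →ₗ[ℂ] ℂ) :
    Q (slice₁ f t) = (slice₁ f ∘ₗ P).rTensor V s := by
  rw [← LinearEquiv.eq_symm_apply] at h
  rw [LinearMap.rTensor_comp_apply, h]
  refine tensor_congr (F := Q ∘ₗ slice₁ f) (G := (slice₁ f).rTensor V ∘ₗ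
    (TensorProduct.assoc ℂ V V V).symm.toLinearMap ∘ₗ Q.lTensor V) (fun x y ↦ ?_) t
  simp only [LinearMap.comp_apply, slice₁_tmul, map_smul, LinearMap.lTensor_tmul,
    LinearEquiv.coe_coe]
  exact tensor_congr (F := f x • LinearMap.id) (G := (slice₁ f).rTensor V ∘ₗ
    (TensorProduct.assoc ℂ V V V).symm.toLinearMap ∘ₗ TensorProduct.mk ℂ V (V ⊗[ℂ] V) x)
    (fun a b ↦ by simp [TensorProduct.smul_tmul']) (Q y)

end WeakMultiplierHopf

end

noncomputable section

namespace WeakMultiplierHopf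

variable {A : Type*} [NonUnitalRing A] [Module ℂ A] [IsScalarTower ℂ A A] [SMulCommClass ℂ A A]
variable {Δ : A →ₙₐ[ℂ] Mult (A ⊗[ℂ] A)} {E : Mult (A ⊗[ℂ] A)}

/-! ### The canonical idempotent and the value of `ι ⊗ Δ` at it -/

namespace IsCanonicalIdempotent

variable (hE : IsCanonicalIdempotent Δ E)

include hE

theorem lact_lact (t : A ⊗[ℂ] A) : E.lact (E.lact t) = E.lact t := by
  rw [← Mult.mul_lact, hE.idem]

theorem ract_ract (t : A ⊗[ℂ] A) : E.ract (E.ract t) = E.ract t := by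
  rw [← Mult.mul_ract, hE.idem]

theorem mul_coproduct (hA : IsNondegenerateAlg A) (a : A) : E * Δ a = Δ a := by
  refine (hA.tensor hA).ext_lact fun t ↦ ?_
  obtain ⟨s, hs⟩ : (Δ a).lact t ∈ LinearMap.range E.lact :=
    hE.left ▸ Submodule.subset_span ⟨(a, t), rfl⟩
  rw [Mult.mul_lact, ← hs, hE.lact_lact]

theorem coproduct_mul (hA : IsNondegenerateAlg A) (a : A) : Δ a * E = Δ a := by
  refine (hA.tensor hA).ext_ract fun t ↦ ?_
  obtain ⟨s, hs⟩ : (Δ a).ract t ∈ LinearMap.range E.ract :=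
    hE.right ▸ Submodule.subset_span ⟨(a, t), rfl⟩
  rw [Mult.mul_ract, ← hs, hE.ract_ract]

/-- `E(A ⊗ A)` is spanned by the elements `Δ(a)(p ⊗ q)`. -/
theorem lact_induction {N : Submodule ℂ (A ⊗[ℂ] A)}
    (h : ∀ a p q, (Δ a).lact (p ⊗ₜ q) ∈ N) (t : A ⊗[ℂ] A) : E.lact t ∈ N := by
  have h1 : LinearMap.range E.lact ≤ N := by
    rw [← hE.left, Submodule.span_le]
    rintro _ ⟨⟨a, s⟩, rfl⟩
    change (Δ a).lact s ∈ N
    induction s using TensorProduct.induction_on with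
    | zero => rw [map_zero]; exact N.zero_mem
    | add s s' hs hs' => rw [map_add]; exact N.add_mem hs hs'
    | tmul p q => exact h a p q
  exact h1 ⟨t, rfl⟩

/-- `(A ⊗ A)E` is spanned by the elements `(p ⊗ q)Δ(a)`. -/
theorem ract_induction {N : Submodule ℂ (A ⊗[ℂ] A)}
    (h : ∀ a p q, (Δ a).ract (p ⊗ₜ q) ∈ N) (t : A ⊗[ℂ] A) : E.ract t ∈ N := by
  have h1 : LinearMap.range E.ract ≤ N := by
    rw [← hE.right, Submodule.span_le]
    rintro _ ⟨⟨a, s⟩, rfl⟩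
    change (Δ a).ract s ∈ N
    induction s using TensorProduct.induction_on with
    | zero => rw [map_zero]; exact N.zero_mem
    | add s s' hs hs' => rw [map_add]; exact N.add_mem hs hs'
    | tmul p q => exact h a p q
  exact h1 ⟨t, rfl⟩

section

variable (hA : IsNondegenerateAlg A)

include hA

theorem leg₁₂_deltaId (t : A ⊗[ℂ] A) : leg₁₂ E * deltaId Δ t = deltaId Δ t :=
  tensor_congr (F := LinearMap.mulLeft ℂ (leg₁₂ E) ∘ₗ deltaId Δ) (fun x y ↦ by
    simp [deltaId_tmul, leg₁₂, tens_mul_tens, hE.mul_coproduct hA]) t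

theorem deltaId_leg₁₂ (t : A ⊗[ℂ] A) : deltaId Δ t * leg₁₂ E = deltaId Δ t :=
  tensor_congr (F := LinearMap.mulRight ℂ (leg₁₂ E) ∘ₗ deltaId Δ) (fun x y ↦ by
    simp [deltaId_tmul, leg₁₂, tens_mul_tens, hE.coproduct_mul hA]) t

theorem leg₂₃_idDelta (t : A ⊗[ℂ] A) : leg₂₃ E * idDelta Δ t = idDelta Δ t :=
  tensor_congr (F := LinearMap.mulLeft ℂ (leg₂₃ E) ∘ₗ idDelta Δ) (fun x y ↦ by
    simp [idDelta_tmul, leg₂₃, ← map_mul, tens_mul_tens, hE.mul_coproduct hA]) t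

theorem idDelta_leg₂₃ (t : A ⊗[ℂ] A) : idDelta Δ t * leg₂₃ E = idDelta Δ t :=
  tensor_congr (F := LinearMap.mulRight ℂ (leg₂₃ E) ∘ₗ idDelta Δ) (fun x y ↦ by
    simp [idDelta_tmul, leg₂₃, ← map_mul, tens_mul_tens, hE.coproduct_mul hA]) t

end

end IsCanonicalIdempotent

/-- The data on which the computation of `(ι ⊗ Δ)E` rests. -/
structure CoproductSetting (Δ : A →ₙₐ[ℂ] Mult (A ⊗[ℂ] A)) (E : Mult (A ⊗[ℂ] A)) : Prop where
  nondeg : IsNondegenerateAlg A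
  idem : IsIdempotentAlg A
  coproduct : IsRegularCoproduct Δ
  canonical : IsCanonicalIdempotent Δ E
  value : IsDeltaIdValue Δ E E (leg₂₃ E * leg₁₂ E)
  comm : leg₂₃ E * leg₁₂ E = leg₁₂ E * leg₂₃ E

namespace CoproductSetting

variable (h : CoproductSetting Δ E)

include h

theorem nondeg₃ : IsNondegenerateAlg ((A ⊗[ℂ] A) ⊗[ℂ] A) :=
  (h.nondeg.tensor h.nondeg).tensor h.nondeg

theorem toMult_threefold_eq_zero {X : Mult ((A ⊗[ℂ] A) ⊗[ℂ] A)}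
    (hX : ∀ w c, toMult ((A ⊗[ℂ] A) ⊗[ℂ] A) w * leg₁₂ (inl c) * X = 0) (w : (A ⊗[ℂ] A) ⊗[ℂ] A) :
    toMult _ w * X = 0 := by
  have : LinearMap.mulRight ℂ X ∘ₗ toMult ((A ⊗[ℂ] A) ⊗[ℂ] A) = 0 := by
    refine TensorProduct.ext_threefold fun x y z ↦ ?_
    refine h.idem.hom_ext (F := LinearMap.mulRight ℂ X ∘ₗ toMult _ ∘ₗ
      (TensorProduct.mk ℂ (A ⊗[ℂ] A) A).flip z ∘ₗ (TensorProduct.mk ℂ A A).flip y) (G := 0)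
      (fun x c ↦ ?_) x
    rw [LinearMap.zero_apply, ← hX ((x ⊗ₜ y) ⊗ₜ z) c, h.nondeg₃.toMult_mul]
    rfl
  exact LinearMap.congr_fun this w

theorem threefold_toMult_eq_zero {X : Mult ((A ⊗[ℂ] A) ⊗[ℂ] A)}
    (hX : ∀ w c, X * (leg₁₂ (inl c) * toMult ((A ⊗[ℂ] A) ⊗[ℂ] A) w) = 0) (w : (A ⊗[ℂ] A) ⊗[ℂ] A) :
    X * toMult _ w = 0 := by
  have : LinearMap.mulLeft ℂ X ∘ₗ toMult ((A ⊗[ℂ] A) ⊗[ℂ] A) = 0 := by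
    refine TensorProduct.ext_threefold fun x y z ↦ ?_
    refine h.idem.hom_ext (F := LinearMap.mulLeft ℂ X ∘ₗ toMult _ ∘ₗ
      (TensorProduct.mk ℂ (A ⊗[ℂ] A) A).flip z ∘ₗ (TensorProduct.mk ℂ A A).flip y) (G := 0)
      (fun c x ↦ ?_) x
    rw [LinearMap.zero_apply, ← hX ((x ⊗ₜ y) ⊗ₜ z) c, h.nondeg₃.mul_toMult]
    rfl
  exact LinearMap.congr_fun this w

variable (M : CanonicalMaps Δ)

theorem ract_mem_K' (t : A ⊗[ℂ] A) :
    E.ract t ∈ Submodule.span ℂ {s | ∃ u c a, s = u * M.K' c a} := by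
  refine h.canonical.ract_induction (fun a p q ↦ ?_) t
  refine h.idem.induction (N := (Submodule.span ℂ {s | ∃ u c a, s = u * M.K' c a}).comap
    ((Δ a).ract ∘ₗ TensorProduct.mk ℂ A A p))
    (fun q c ↦ Submodule.subset_span ⟨p ⊗ₜ q, c, a, ?_⟩) q
  apply (h.nondeg.tensor h.nondeg).toMult_injective
  rw [toMult_mul_toMult, M.toMult_K', LinearMap.comp_apply,
    ← (h.nondeg.tensor h.nondeg).toMult_mul, ← mul_assoc, CanonicalMaps.toMult_mul_inr h.nondeg]
  rfl

theorem ract_mem_T' (t : A ⊗[ℂ] A) :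
    E.ract t ∈ Submodule.span ℂ {s | ∃ u c a, s = u * M.T' c a} := by
  refine h.canonical.ract_induction (fun a p q ↦ ?_) t
  refine h.idem.induction (N := (Submodule.span ℂ {s | ∃ u c a, s = u * M.T' c a}).comap
    ((Δ a).ract ∘ₗ (TensorProduct.mk ℂ A A).flip q))
    (fun p c ↦ Submodule.subset_span ⟨p ⊗ₜ q, c, a, ?_⟩) p
  apply (h.nondeg.tensor h.nondeg).toMult_injective
  rw [toMult_mul_toMult, M.toMult_T', LinearMap.comp_apply,
    ← (h.nondeg.tensor h.nondeg).toMult_mul, ← mul_assoc, CanonicalMaps.toMult_mul_inl h.nondeg]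
  rfl

theorem lact_mem_K (t : A ⊗[ℂ] A) :
    E.lact t ∈ Submodule.span ℂ {s | ∃ a c u, s = M.K a c * u} := by
  refine h.canonical.lact_induction (fun a p q ↦ ?_) t
  refine h.idem.induction (N := (Submodule.span ℂ {s | ∃ a c u, s = M.K a c * u}).comap
    ((Δ a).lact ∘ₗ (TensorProduct.mk ℂ A A).flip q))
    (fun c p ↦ Submodule.subset_span ⟨a, c, p ⊗ₜ q, ?_⟩) p
  apply (h.nondeg.tensor h.nondeg).toMult_injective
  rw [toMult_mul_toMult, M.toMult_K, LinearMap.comp_apply,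
    ← (h.nondeg.tensor h.nondeg).mul_toMult, mul_assoc, CanonicalMaps.inl_mul_toMult h.nondeg]
  rfl

theorem lact_mem_T (t : A ⊗[ℂ] A) :
    E.lact t ∈ Submodule.span ℂ {s | ∃ a c u, s = M.T a c * u} := by
  refine h.canonical.lact_induction (fun a p q ↦ ?_) t
  refine h.idem.induction (N := (Submodule.span ℂ {s | ∃ a c u, s = M.T a c * u}).comap
    ((Δ a).lact ∘ₗ TensorProduct.mk ℂ A A p))
    (fun c q ↦ Submodule.subset_span ⟨a, c, p ⊗ₜ q, ?_⟩) q
  apply (h.nondeg.tensor h.nondeg).toMult_injective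
  rw [toMult_mul_toMult, M.toMult_T, LinearMap.comp_apply,
    ← (h.nondeg.tensor h.nondeg).mul_toMult, mul_assoc, CanonicalMaps.inr_mul_toMult h.nondeg]
  rfl

/-- By coassociativity, `(A ⊗ A ⊗ A)(Δ ⊗ ι)(E)` is contained in the left ideal generated by the elements
`(ι ⊗ Δ)((c ⊗ 1)Δ(a))`. -/
theorem mul_eq_zero_of_T' {X : Mult ((A ⊗[ℂ] A) ⊗[ℂ] A)}
    (hX : ∀ c a, idDelta Δ (M.T' c a) * X = 0) : leg₂₃ E * leg₁₂ E * X = 0 := by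
  set P := leg₂₃ E * leg₁₂ E with hP
  have h3 := h.nondeg₃
  have h1 : ∀ w c a, toMult _ w * (deltaId Δ (M.K' c a) * X) = 0 := fun w c a ↦ by
    refine h.toMult_threefold_eq_zero (fun w r ↦ ?_) w
    rw [mul_assoc, ← mul_assoc (leg₁₂ _), M.coassoc_left h.nondeg h.coproduct.toIsCoproduct,
      mul_assoc (leg₂₃ _), hX, mul_zero, mul_zero]
  have h2 : ∀ w u, toMult _ w * (deltaId Δ u * (P * X)) = 0 := fun w u ↦ by
    rw [← mul_assoc (deltaId Δ u), h.value.apply_mul]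
    have hu := h.ract_mem_K' M u
    generalize E.ract u = v at hu
    induction hu using Submodule.span_induction with
    | zero => simp
    | add x y _ _ hx hy => rw [map_add, add_mul, mul_add, hx, hy, add_zero]
    | smul r x _ hx => rw [map_smul, smul_mul_assoc, mul_smul_comm, hx, smul_zero]
    | mem x hx =>
      obtain ⟨u, c, a, rfl⟩ := hx
      rw [deltaId_mul, mul_assoc, ← mul_assoc (toMult _ w), h3.toMult_mul, h1]
  have h4 : ∀ w, toMult _ w * (P * X) = 0 := fun w ↦ by
    have hPE : P = leg₁₂ E * P := by
      rw [hP, h.comm, ← mul_assoc, ← leg₁₂_mul, h.canonical.idem]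
    rw [hPE, mul_assoc]
    have h5 : LinearMap.mulRight ℂ (leg₁₂ E * (P * X)) ∘ₗ toMult ((A ⊗[ℂ] A) ⊗[ℂ] A) = 0 := by
      refine TensorProduct.ext' fun s y ↦ ?_
      refine h.idem.hom_ext (F := LinearMap.mulRight ℂ (leg₁₂ E * (P * X)) ∘ₗ toMult _ ∘ₗ
        TensorProduct.mk ℂ (A ⊗[ℂ] A) A s) (G := 0) (fun y y' ↦ ?_) y
      change toMult _ (s ⊗ₜ[ℂ] (y * y')) * (leg₁₂ E * (P * X)) = 0
      rw [← mul_assoc, leg₁₂, toMult_mul_tens_left (h.nondeg.tensor h.nondeg) h.nondeg,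
        LinearMap.rTensor_tmul]
      have hs : E.ract s ∈ Submodule.span ℂ
          (Set.range fun p : A × (A ⊗[ℂ] A) ↦ (Δ p.1).ract p.2) := by
        rw [h.canonical.right]; exact ⟨s, rfl⟩
      generalize E.ract s = v at hs
      induction hs using Submodule.span_induction with
      | zero => simp
      | add u v _ _ hu hv => rw [TensorProduct.add_tmul, map_add, add_mul, hu, hv, add_zero]
      | smul r u _ hu => rw [← TensorProduct.smul_tmul', map_smul, smul_mul_assoc, hu, smul_zero]
      | mem x hx =>
        obtain ⟨⟨a, s⟩, rfl⟩ := hx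
        have h6 : toMult _ ((Δ a).ract s ⊗ₜ[ℂ] (y * y')) =
            toMult _ (s ⊗ₜ[ℂ] y) * deltaId Δ (a ⊗ₜ y') := by
          rw [deltaId_tmul, ← tens_toMult, ← tens_toMult, tens_mul_tens,
            (h.nondeg.tensor h.nondeg).toMult_mul, toMult_mul_toMult]
        rw [h6, mul_assoc, h2]
    exact LinearMap.congr_fun h5 w
  exact h3.eq_of_toMult_mul fun w ↦ by rw [h4, mul_zero]

/-- By coassociativity, `(Δ ⊗ ι)(E)(A ⊗ A ⊗ A)` is contained in the right ideal generated by the elements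
`(ι ⊗ Δ)(Δ(a)(c ⊗ 1))`. -/
theorem mul_eq_zero_of_K {X : Mult ((A ⊗[ℂ] A) ⊗[ℂ] A)}
    (hX : ∀ a c, X * idDelta Δ (M.K a c) = 0) : X * (leg₂₃ E * leg₁₂ E) = 0 := by
  set P := leg₂₃ E * leg₁₂ E with hP
  have h3 := h.nondeg₃
  have h1 : ∀ w a c, X * deltaId Δ (M.T a c) * toMult _ w = 0 := fun w a c ↦ by
    refine h.threefold_toMult_eq_zero (fun w r ↦ ?_) w
    rw [← mul_assoc, mul_assoc X, M.coassoc_right h.nondeg h.coproduct.toIsCoproduct,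
      ← mul_assoc X, hX, zero_mul, zero_mul]
  have h2 : ∀ w u, X * P * deltaId Δ u * toMult _ w = 0 := fun w u ↦ by
    rw [mul_assoc X, h.value.mul_apply]
    have hu := h.lact_mem_T M u
    generalize E.lact u = v at hu
    induction hu using Submodule.span_induction with
    | zero => simp
    | add x y _ _ hx hy => rw [map_add, mul_add, add_mul, hx, hy, add_zero]
    | smul r x _ hx => rw [map_smul, mul_smul_comm, smul_mul_assoc, hx, smul_zero]
    | mem x hx =>
      obtain ⟨a, c, u, rfl⟩ := hx
      rw [deltaId_mul, ← mul_assoc, mul_assoc, h3.mul_toMult, h1]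
  have h4 : ∀ w, X * P * toMult _ w = 0 := fun w ↦ by
    have hPE : P = P * leg₁₂ E := by
      rw [hP, mul_assoc, ← leg₁₂_mul, h.canonical.idem]
    rw [hPE, ← mul_assoc X]
    have h5 : LinearMap.mulLeft ℂ (X * P * leg₁₂ E) ∘ₗ toMult ((A ⊗[ℂ] A) ⊗[ℂ] A) = 0 := by
      refine TensorProduct.ext' fun s y ↦ ?_
      refine h.idem.hom_ext (F := LinearMap.mulLeft ℂ (X * P * leg₁₂ E) ∘ₗ toMult _ ∘ₗ
        TensorProduct.mk ℂ (A ⊗[ℂ] A) A s) (G := 0) (fun y y' ↦ ?_) y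
      change X * P * leg₁₂ E * toMult _ (s ⊗ₜ[ℂ] (y * y')) = 0
      rw [mul_assoc, leg₁₂, tens_left_mul_toMult (h.nondeg.tensor h.nondeg) h.nondeg,
        LinearMap.rTensor_tmul]
      have hs : E.lact s ∈ Submodule.span ℂ
          (Set.range fun p : A × (A ⊗[ℂ] A) ↦ (Δ p.1).lact p.2) := by
        rw [h.canonical.left]; exact ⟨s, rfl⟩
      generalize E.lact s = v at hs
      induction hs using Submodule.span_induction with
      | zero => simp
      | add u v _ _ hu hv => rw [TensorProduct.add_tmul, map_add, mul_add, hu, hv, add_zero]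
      | smul r u _ hu => rw [← TensorProduct.smul_tmul', map_smul, mul_smul_comm, hu, smul_zero]
      | mem x hx =>
        obtain ⟨⟨a, s⟩, rfl⟩ := hx
        have h6 : toMult _ ((Δ a).lact s ⊗ₜ[ℂ] (y * y')) =
            deltaId Δ (a ⊗ₜ y) * toMult _ (s ⊗ₜ[ℂ] y') := by
          rw [deltaId_tmul, ← tens_toMult, ← tens_toMult, tens_mul_tens,
            (h.nondeg.tensor h.nondeg).mul_toMult, toMult_mul_toMult]
        rw [h6, ← mul_assoc, h2]
    exact LinearMap.congr_fun h5 w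
  refine h3.ext_lact fun w ↦ h3.toMult_injective ?_
  rw [← h3.mul_toMult, h4]
  exact (map_zero _).symm

/-- `(ι ⊗ Δ)E` has the same value `P` as `(Δ ⊗ ι)E`. The elements `(ι ⊗ Δ)((1 - E)t)` are annihilated by
all `(ι ⊗ Δ)((c ⊗ 1)Δ(a))`, as `Δ(a)(1 - E) = 0`, and hence by `P`; and on `E(A ⊗ A)`, which is spanned
by multiples of the elements `Δ(a)(c ⊗ 1)`, coassociativity reduces the claim to `Δ ⊗ ι`. -/
theorem idDelta_value : IsIdDeltaValue Δ E E (leg₂₃ E * leg₁₂ E) := by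
  obtain ⟨M⟩ := h.coproduct.nonempty_canonicalMaps h.nondeg
  have hc := h.coproduct.toIsCoproduct
  have h2 := h.nondeg.tensor h.nondeg
  constructor
  · rw [← mul_assoc, ← leg₂₃_mul, h.canonical.idem]
  · rw [h.comm, mul_assoc, ← leg₂₃_mul, h.canonical.idem]
  · intro t
    have h4 : leg₂₃ E * leg₁₂ E * idDelta Δ (t - E.lact t) = 0 := by
      refine h.mul_eq_zero_of_T' M fun c a ↦ ?_
      rw [← idDelta_mul]
      convert map_zero (idDelta Δ)
      apply h2.toMult_injective
      rw [toMult_mul_toMult, M.toMult_T', map_sub, ← h2.mul_toMult, mul_sub, mul_assoc,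
        mul_assoc, ← mul_assoc (Δ a), h.canonical.coproduct_mul h.nondeg, sub_self, map_zero]
    rw [map_sub, mul_sub, sub_eq_zero] at h4
    rw [h4]
    have h5 := h.lact_mem_K M t
    generalize E.lact t = s at h5
    induction h5 using Submodule.span_induction with
    | zero => simp
    | add x y _ _ hx hy => rw [map_add, mul_add, hx, hy]
    | smul r x _ hx => rw [map_smul, mul_smul_comm, hx]
    | mem x hx =>
      obtain ⟨a, c, u, rfl⟩ := hx
      rw [idDelta_mul, ← mul_assoc]
      congr 1
      refine eq_of_mul_leg₂₃_inr h.nondeg fun z ↦ ?_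
      rw [mul_assoc, ← M.coassoc_right h.nondeg hc, ← mul_assoc, h.value.mul_apply]
      congr 2
      apply h2.toMult_injective
      rw [← h2.mul_toMult, M.toMult_T, ← mul_assoc, h.canonical.mul_coproduct h.nondeg]
  · intro t
    have h4 : idDelta Δ (t - E.ract t) * (leg₂₃ E * leg₁₂ E) = 0 := by
      refine h.mul_eq_zero_of_K M fun a c ↦ ?_
      rw [← idDelta_mul]
      convert map_zero (idDelta Δ)
      apply h2.toMult_injective
      rw [toMult_mul_toMult, M.toMult_K, map_sub, ← h2.toMult_mul, sub_mul, ← mul_assoc,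
        ← mul_assoc, mul_assoc _ E, h.canonical.mul_coproduct h.nondeg, sub_self, map_zero]
    rw [map_sub, sub_mul, sub_eq_zero] at h4
    rw [h4]
    have h5 := h.ract_mem_T' M t
    generalize E.ract t = s at h5
    induction h5 using Submodule.span_induction with
    | zero => simp
    | add x y _ _ hx hy => rw [map_add, add_mul, hx, hy]
    | smul r x _ hx => rw [map_smul, smul_mul_assoc, hx]
    | mem x hx =>
      obtain ⟨u, c, a, rfl⟩ := hx
      rw [idDelta_mul, mul_assoc]
      congr 1
      refine eq_of_leg₂₃_inr_mul h.nondeg fun z ↦ ?_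
      rw [← mul_assoc, ← M.coassoc_left h.nondeg hc, mul_assoc, h.value.apply_mul]
      congr 2
      apply h2.toMult_injective
      rw [← h2.toMult_mul, M.toMult_K', mul_assoc, h.canonical.coproduct_mul h.nondeg]

theorem deltaId_lact (t : A ⊗[ℂ] A) : deltaId Δ (E.lact t) = leg₂₃ E * deltaId Δ t := by
  rw [← h.value.mul_apply, mul_assoc, h.canonical.leg₁₂_deltaId h.nondeg]

theorem deltaId_ract (t : A ⊗[ℂ] A) : deltaId Δ (E.ract t) = deltaId Δ t * leg₂₃ E := by
  rw [← h.value.apply_mul, h.comm, ← mul_assoc, h.canonical.deltaId_leg₁₂ h.nondeg]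

theorem idDelta_lact (t : A ⊗[ℂ] A) : idDelta Δ (E.lact t) = leg₁₂ E * idDelta Δ t := by
  rw [← h.idDelta_value.mul_apply, h.comm, mul_assoc, h.canonical.leg₂₃_idDelta h.nondeg]

theorem idDelta_ract (t : A ⊗[ℂ] A) : idDelta Δ (E.ract t) = idDelta Δ t * leg₁₂ E := by
  rw [← h.idDelta_value.apply_mul, ← mul_assoc, h.canonical.idDelta_leg₂₃ h.nondeg]

end CoproductSetting

end WeakMultiplierHopf

end

noncomputable section

namespace WeakMultiplierHopf

variable {A : Type*} [NonUnitalRing A] [Module ℂ A] [IsScalarTower ℂ A A] [SMulCommClass ℂ A A]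
variable {Δ : A →ₙₐ[ℂ] Mult (A ⊗[ℂ] A)} {E : Mult (A ⊗[ℂ] A)}
variable {B C : NonUnitalSubalgebra ℂ (Mult A)}

/-! ### The legs of a regular separability idempotent -/

/-- The inclusion of a subalgebra of `M(A)`, as a linear map. -/
def incl (B : NonUnitalSubalgebra ℂ (Mult A)) : B →ₗ[ℂ] Mult A where
  toFun b := b.1
  map_add' _ _ := rfl
  map_smul' _ _ := rfl

@[simp] theorem incl_apply (b : B) : incl B b = b.1 := rfl

/-- The left action of `B` on `A`. -/
def lactOn (B : NonUnitalSubalgebra ℂ (Mult A)) : B →ₗ[ℂ] A →ₗ[ℂ] A := lactHom A ∘ₗ incl B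

/-- The right action of `B` on `A`. -/
def ractOn (B : NonUnitalSubalgebra ℂ (Mult A)) : B →ₗ[ℂ] A →ₗ[ℂ] A := ractHom A ∘ₗ incl B

@[simp] theorem lactOn_apply (b : B) (a : A) : lactOn B b a = b.1.lact a := rfl

@[simp] theorem ractOn_apply (b : B) (a : A) : ractOn B b a = b.1.ract a := rfl

/-- The inclusion `B ⊗ C ⊆ M(A ⊗ A)`. -/
def legHom (B C : NonUnitalSubalgebra ℂ (Mult A)) : B ⊗[ℂ] C →ₗ[ℂ] Mult (A ⊗[ℂ] A) :=
  TensorProduct.lift (tens.compl₁₂ (incl B) (incl C))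

@[simp] theorem legHom_tmul (b : B) (c : C) : legHom B C (b ⊗ₜ c) = tens b.1 c.1 := rfl

theorem legHom_lact (w : B ⊗[ℂ] C) (x y : A) : (legHom B C w).lact (x ⊗ₜ y) =
    TensorProduct.map ((lactOn B).flip x) ((lactOn C).flip y) w :=
  tensor_congr (F := (lactHom (A ⊗[ℂ] A)).flip (x ⊗ₜ y) ∘ₗ legHom B C)
    (G := TensorProduct.map ((lactOn B).flip x) ((lactOn C).flip y)) (fun _ _ ↦ rfl) w

theorem legHom_ract (w : B ⊗[ℂ] C) (x y : A) : (legHom B C w).ract (x ⊗ₜ y) =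
    TensorProduct.map ((ractOn B).flip x) ((ractOn C).flip y) w :=
  tensor_congr (F := (ractHom (A ⊗[ℂ] A)).flip (x ⊗ₜ y) ∘ₗ legHom B C)
    (G := TensorProduct.map ((ractOn B).flip x) ((ractOn C).flip y)) (fun _ _ ↦ rfl) w

theorem eq_zero_of_lactOn (hA : IsNondegenerateAlg A) {b : B} (h : ∀ a, lactOn B b a = 0) :
    b = 0 :=
  Subtype.ext (hA.ext_lact h)

theorem eq_zero_of_ractOn (hA : IsNondegenerateAlg A) {b : B} (h : ∀ a, ractOn B b a = 0) :
    b = 0 :=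
  Subtype.ext (hA.ext_ract h)

theorem legHom_injective (hA : IsNondegenerateAlg A) : Function.Injective (legHom B C) := by
  refine (injective_iff_map_eq_zero _).mpr fun w hw ↦ ?_
  refine rTensor_jointly_injective (h := fun x : A ↦ (lactOn B).flip x)
    (fun b hb ↦ eq_zero_of_lactOn hA hb) fun x ↦ ?_
  refine lTensor_jointly_injective (h := fun y : A ↦ (lactOn C).flip y)
    (fun c hc ↦ eq_zero_of_lactOn hA hc) fun y ↦ ?_
  rw [← LinearMap.comp_apply, LinearMap.lTensor_comp_rTensor, ← legHom_lact, hw]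
  rfl

theorem tensSub_eq_range : tensSub B.toSubmodule C.toSubmodule = LinearMap.range (legHom B C) := by
  apply le_antisymm
  · exact Submodule.map₂_le.mpr fun b hb c hc ↦ ⟨(⟨b, hb⟩ : B) ⊗ₜ (⟨c, hc⟩ : C), rfl⟩
  · rintro _ ⟨w, rfl⟩
    induction w using TensorProduct.induction_on with
    | zero => rw [map_zero]; exact zero_mem _
    | add s t hs ht => rw [map_add]; exact add_mem hs ht
    | tmul b c => exact Submodule.apply_mem_map₂ _ b.2 c.2

namespace SitsNondegenerately

theorem range_lactOn (hB : SitsNondegenerately B) :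
    LinearMap.range (TensorProduct.lift (lactOn B)) = ⊤ := by
  rw [eq_top_iff, ← hB.left, Submodule.span_le]
  rintro _ ⟨b, hb, a, rfl⟩
  exact ⟨(⟨b, hb⟩ : B) ⊗ₜ a, rfl⟩

theorem range_ractOn (hB : SitsNondegenerately B) :
    LinearMap.range (TensorProduct.lift (ractOn B)) = ⊤ := by
  rw [eq_top_iff, ← hB.right, Submodule.span_le]
  rintro _ ⟨b, hb, a, rfl⟩
  exact ⟨(⟨b, hb⟩ : B) ⊗ₜ a, rfl⟩

theorem mul_left_nondeg (hB : SitsNondegenerately B) (hA : IsNondegenerateAlg A) (b : B)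
    (h : ∀ x : B, x * b = 0) : b = 0 := by
  refine eq_zero_of_ractOn hA fun a ↦ ?_
  obtain ⟨t, rfl⟩ : a ∈ LinearMap.range (TensorProduct.lift (ractOn B)) :=
    hB.range_ractOn ▸ Submodule.mem_top
  refine tensor_congr (F := ractOn B b ∘ₗ TensorProduct.lift (ractOn B)) (G := 0) (fun x a ↦ ?_) t
  exact congrArg (fun y : B ↦ y.1.ract a) (h x)

theorem mul_right_nondeg (hB : SitsNondegenerately B) (hA : IsNondegenerateAlg A) (b : B)
    (h : ∀ x : B, b * x = 0) : b = 0 := by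
  refine eq_zero_of_lactOn hA fun a ↦ ?_
  obtain ⟨t, rfl⟩ : a ∈ LinearMap.range (TensorProduct.lift (lactOn B)) :=
    hB.range_lactOn ▸ Submodule.mem_top
  refine tensor_congr (F := lactOn B b ∘ₗ TensorProduct.lift (lactOn B)) (G := 0) (fun x a ↦ ?_) t
  exact congrArg (fun y : B ↦ y.1.lact a) (h x)

end SitsNondegenerately

/-- The elements `E(b ⊗ 1)`, `E(1 ⊗ c)`, `(b ⊗ 1)E` and `(1 ⊗ c)E` of `B ⊗ C`. -/
structure SeparabilityMaps (B C : NonUnitalSubalgebra ℂ (Mult A)) (E : Mult (A ⊗[ℂ] A)) where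
  EB : B →ₗ[ℂ] B ⊗[ℂ] C
  EC : C →ₗ[ℂ] B ⊗[ℂ] C
  EB' : B →ₗ[ℂ] B ⊗[ℂ] C
  EC' : C →ₗ[ℂ] B ⊗[ℂ] C
  legHom_EB : ∀ b, legHom B C (EB b) = E * tens b.1 1
  legHom_EC : ∀ c, legHom B C (EC c) = E * tens 1 c.1
  legHom_EB' : ∀ b, legHom B C (EB' b) = tens b.1 1 * E
  legHom_EC' : ∀ c, legHom B C (EC' c) = tens 1 c.1 * E

theorem IsRegularSeparabilityIdempotent.nonempty_maps
    (hsep : IsRegularSeparabilityIdempotent B C E) (hA : IsNondegenerateAlg A) :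
    Nonempty (SeparabilityMaps B C E) := by
  have key {X : Type _} [AddCommGroup X] [Module ℂ X] (g : X →ₗ[ℂ] Mult (A ⊗[ℂ] A))
      (h : ∀ x, g x ∈ tensSub B.toSubmodule C.toSubmodule) :
      ∃ k : X →ₗ[ℂ] B ⊗[ℂ] C, ∀ x, legHom B C (k x) = g x := by
    rw [tensSub_eq_range] at h
    have hf := legHom_injective (B := B) (C := C) hA
    choose k hk using h
    exact ⟨⟨⟨k, fun a b ↦ hf (by simp [hk])⟩, fun r a ↦ hf (by simp [hk])⟩, hk⟩
  obtain ⟨EB, h1⟩ := key (LinearMap.mulLeft ℂ E ∘ₗ (tens (A := A) (B := A)).flip 1 ∘ₗ incl B)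
    fun b ↦ hsep.mul_left_mem b.1 b.2
  obtain ⟨EC, h2⟩ := key (LinearMap.mulLeft ℂ E ∘ₗ tens (A := A) (B := A) 1 ∘ₗ incl C)
    fun c ↦ hsep.mul_right_mem c.1 c.2
  obtain ⟨EB', h3⟩ := key (LinearMap.mulRight ℂ E ∘ₗ (tens (A := A) (B := A)).flip 1 ∘ₗ incl B)
    fun b ↦ hsep.left_mul_mem b.1 b.2
  obtain ⟨EC', h4⟩ := key (LinearMap.mulRight ℂ E ∘ₗ tens (A := A) (B := A) 1 ∘ₗ incl C)
    fun c ↦ hsep.right_mul_mem c.1 c.2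
  exact ⟨⟨EB, EC, EB', EC', h1, h2, h3, h4⟩⟩

section LegProducts

theorem legHom_mul_left (w : B ⊗[ℂ] C) (b : B) :
    legHom B C ((LinearMap.mulLeft ℂ b).rTensor C w) = tens b.1 1 * legHom B C w :=
  tensor_congr (F := legHom B C ∘ₗ (LinearMap.mulLeft ℂ b).rTensor C)
    (G := LinearMap.mulLeft ℂ (tens b.1 1) ∘ₗ legHom B C)
    (fun u v ↦ by simp [tens_mul_tens]) w

theorem legHom_mul_right (w : B ⊗[ℂ] C) (b : B) :
    legHom B C ((LinearMap.mulRight ℂ b).rTensor C w) = legHom B C w * tens b.1 1 :=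
  tensor_congr (F := legHom B C ∘ₗ (LinearMap.mulRight ℂ b).rTensor C)
    (G := LinearMap.mulRight ℂ (tens b.1 1) ∘ₗ legHom B C)
    (fun u v ↦ by simp [tens_mul_tens]) w

theorem legHom_mul_left' (w : B ⊗[ℂ] C) (c : C) :
    legHom B C ((LinearMap.mulLeft ℂ c).lTensor B w) = tens 1 c.1 * legHom B C w :=
  tensor_congr (F := legHom B C ∘ₗ (LinearMap.mulLeft ℂ c).lTensor B)
    (G := LinearMap.mulLeft ℂ (tens 1 c.1) ∘ₗ legHom B C)
    (fun u v ↦ by simp [tens_mul_tens]) w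

theorem legHom_mul_right' (w : B ⊗[ℂ] C) (c : C) :
    legHom B C ((LinearMap.mulRight ℂ c).lTensor B w) = legHom B C w * tens 1 c.1 :=
  tensor_congr (F := legHom B C ∘ₗ (LinearMap.mulRight ℂ c).lTensor B)
    (G := LinearMap.mulRight ℂ (tens 1 c.1) ∘ₗ legHom B C)
    (fun u v ↦ by simp [tens_mul_tens]) w

theorem tens_comm (x y : Mult A) : tens x 1 * tens 1 y = tens 1 y * tens x 1 := by
  simp only [tens_mul_tens, one_mul, mul_one]

theorem tens_mul_one (x y : Mult A) : tens (x * y) (1 : Mult A) = tens x 1 * tens y 1 := by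
  simp only [tens_mul_tens, one_mul]

theorem tens_one_mul (x y : Mult A) : tens (1 : Mult A) (x * y) = tens 1 x * tens 1 y := by
  simp only [tens_mul_tens, one_mul]

end LegProducts

namespace SeparabilityMaps

variable (S : SeparabilityMaps B C E) (hsep : IsRegularSeparabilityIdempotent B C E)
  (hA : IsNondegenerateAlg A)

section

include hsep

/-- The left leg of `E` is all of `B`, in terms of functionals. -/
theorem full_EC (f : B →ₗ[ℂ] ℂ) (h : ∀ c, slice₁ f (S.EC c) = 0) : f = 0 := by
  have hV := hsep.full_left ((LinearMap.ker f).map (incl B)) (by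
    rintro _ ⟨b, -, rfl⟩
    exact b.2) (fun c hc ↦ by
      obtain ⟨s, hs⟩ := exists_rTensor_subtype (N := LinearMap.ker f) (t := S.EC ⟨c, hc⟩)
        fun g ↦ by rw [LinearMap.mem_ker, ← apply_slice₁, h, map_zero]
      rw [← S.legHom_EC ⟨c, hc⟩, ← hs]
      clear hs
      induction s using TensorProduct.induction_on with
      | zero => rw [map_zero, map_zero]; exact zero_mem _
      | add s t hs ht => rw [map_add, map_add]; exact add_mem hs ht
      | tmul b c => exact Submodule.apply_mem_map₂ _ ⟨b.1, b.2, rfl⟩ c.2)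
  refine LinearMap.ext fun b ↦ ?_
  obtain ⟨b', hb', h'⟩ : b.1 ∈ (LinearMap.ker f).map (incl B) := hV ▸ b.2
  rw [← Subtype.ext (a1 := b') (a2 := b) h']
  exact hb'

/-- The right leg of `E` is all of `C`, in terms of functionals. -/
theorem full_EB' (f : C →ₗ[ℂ] ℂ) (h : ∀ b, slice₂ f (S.EB' b) = 0) : f = 0 := by
  have hV := hsep.full_right ((LinearMap.ker f).map (incl C)) (by
    rintro _ ⟨b, -, rfl⟩
    exact b.2) (fun b hb ↦ by
      obtain ⟨s, hs⟩ := exists_lTensor_subtype (N := LinearMap.ker f) (t := S.EB' ⟨b, hb⟩)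
        fun g ↦ by rw [LinearMap.mem_ker, apply_slice₁, h, map_zero]
      rw [← S.legHom_EB' ⟨b, hb⟩, ← hs]
      clear hs
      induction s using TensorProduct.induction_on with
      | zero => rw [map_zero, map_zero]; exact zero_mem _
      | add s t hs ht => rw [map_add, map_add]; exact add_mem hs ht
      | tmul b c => exact Submodule.apply_mem_map₂ _ b.2 ⟨c.1, c.2, rfl⟩)
  refine LinearMap.ext fun b ↦ ?_
  obtain ⟨b', hb', h'⟩ : b.1 ∈ (LinearMap.ker f).map (incl C) := hV ▸ b.2
  rw [← Subtype.ext (a1 := b') (a2 := b) h']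
  exact hb'

include hA

theorem full_EB (hB : SitsNondegenerately B) (f : C →ₗ[ℂ] ℂ) (h : ∀ b, slice₂ f (S.EB b) = 0) :
    f = 0 := by
  refine S.full_EB' hsep f fun b ↦ hB.mul_right_nondeg hA _ fun x ↦ ?_
  have h1 : (LinearMap.mulRight ℂ x).rTensor C (S.EB' b) =
      (LinearMap.mulLeft ℂ b).rTensor C (S.EB x) := by
    apply legHom_injective hA
    rw [legHom_mul_right, legHom_mul_left, S.legHom_EB', S.legHom_EB, mul_assoc]
  have h2 := congrArg (slice₂ f) h1
  rw [slice₂_rTensor, slice₂_rTensor, h, map_zero] at h2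
  exact h2

theorem full_EC' (hC : SitsNondegenerately C) (f : B →ₗ[ℂ] ℂ) (h : ∀ c, slice₁ f (S.EC' c) = 0) :
    f = 0 := by
  refine S.full_EC hsep f fun c ↦ hC.mul_left_nondeg hA _ fun x ↦ ?_
  have h1 : (LinearMap.mulLeft ℂ x).lTensor B (S.EC c) =
      (LinearMap.mulRight ℂ c).lTensor B (S.EC' x) := by
    apply legHom_injective hA
    rw [legHom_mul_right', legHom_mul_left', S.legHom_EC', S.legHom_EC, mul_assoc]
  have h2 := congrArg (slice₁ f) h1
  rw [slice₁_lTensor, slice₁_lTensor, h, map_zero] at h2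
  exact h2

end

/-- The left action of `E`, as a separability datum. -/
def leftDatum (hB : SitsNondegenerately B) (hC : SitsNondegenerately C) :
    SeparabilityDatum B C where
  mB := LinearMap.mul ℂ B
  mC := LinearMap.mul ℂ C
  EB := S.EB
  EC := S.EC
  mB_assoc := mul_assoc
  mC_assoc := mul_assoc
  mB_nondeg := hB.mul_left_nondeg hA
  mC_nondeg := hC.mul_left_nondeg hA
  mB_nondeg' := hB.mul_right_nondeg hA
  mC_nondeg' := hC.mul_right_nondeg hA
  EB_mul b b' := legHom_injective hA (by
    refine Eq.trans ?_ (legHom_mul_right (S.EB b) b').symm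
    rw [S.legHom_EB, S.legHom_EB, mul_assoc, ← tens_mul_one]; rfl)
  EC_mul b b' := legHom_injective hA (by
    refine Eq.trans ?_ (legHom_mul_right' (S.EC b) b').symm
    rw [S.legHom_EC, S.legHom_EC, mul_assoc, ← tens_one_mul]; rfl)
  EB_EC b c := legHom_injective hA (by
    refine (legHom_mul_right' (S.EB b) c).trans (Eq.trans ?_ (legHom_mul_right (S.EC c) b).symm)
    rw [S.legHom_EC, S.legHom_EB, mul_assoc, mul_assoc, tens_comm])
  idem b := legHom_injective hA (by
    have h1 : ∀ w : B ⊗[ℂ] C, legHom B C (TensorProduct.lift (LinearMap.mk₂ ℂ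
        (fun u v ↦ ((LinearMap.mul ℂ C).flip v).lTensor B (S.EB u))
        (fun u u' v ↦ by simp) (fun r u v ↦ by simp)
        (fun u v v' ↦ by simp [LinearMap.lTensor_add])
        (fun r u v ↦ by simp [LinearMap.lTensor_smul])) w) = E * legHom B C w := fun w ↦
      tensor_congr (F := legHom B C ∘ₗ TensorProduct.lift _)
        (G := LinearMap.mulLeft ℂ E ∘ₗ legHom B C) (fun u v ↦ by
          refine (legHom_mul_right' (S.EB u) v).trans ?_
          rw [S.legHom_EB, mul_assoc, tens_mul_tens]
          simp) w
    rw [h1, S.legHom_EB, ← mul_assoc, hsep.idem])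
  full_B := S.full_EC hsep
  full_C := S.full_EB hsep hA hB
  exists_EC b := by
    have h1 : E * tens b.1 1 ∈ {x | ∃ b ∈ B, x = E * tens b 1} := ⟨b.1, b.2, rfl⟩
    rw [hsep.mul_eq] at h1
    obtain ⟨c, hc, h⟩ := h1
    exact ⟨⟨c, hc⟩, legHom_injective hA (by rw [S.legHom_EB, S.legHom_EC, h])⟩
  exists_EB c := by
    have h1 : E * tens 1 c.1 ∈ {x | ∃ c ∈ C, x = E * tens 1 c} := ⟨c.1, c.2, rfl⟩
    rw [← hsep.mul_eq] at h1
    obtain ⟨b, hb, h⟩ := h1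
    exact ⟨⟨b, hb⟩, legHom_injective hA (by rw [S.legHom_EB, S.legHom_EC, h])⟩

/-- The right action of `E`, as a separability datum for the opposite algebras. -/
def rightDatum (hB : SitsNondegenerately B) (hC : SitsNondegenerately C) :
    SeparabilityDatum B C where
  mB := (LinearMap.mul ℂ B).flip
  mC := (LinearMap.mul ℂ C).flip
  EB := S.EB'
  EC := S.EC'
  mB_assoc x y z := (mul_assoc z y x).symm
  mC_assoc x y z := (mul_assoc z y x).symm
  mB_nondeg := hB.mul_right_nondeg hA
  mC_nondeg := hC.mul_right_nondeg hA
  mB_nondeg' := hB.mul_left_nondeg hA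
  mC_nondeg' := hC.mul_left_nondeg hA
  EB_mul b b' := legHom_injective hA (by
    refine Eq.trans ?_ (legHom_mul_left (S.EB' b) b').symm
    rw [S.legHom_EB', S.legHom_EB', ← mul_assoc, ← tens_mul_one]; rfl)
  EC_mul b b' := legHom_injective hA (by
    refine Eq.trans ?_ (legHom_mul_left' (S.EC' b) b').symm
    rw [S.legHom_EC', S.legHom_EC', ← mul_assoc, ← tens_one_mul]; rfl)
  EB_EC b c := legHom_injective hA (by
    refine (legHom_mul_left' (S.EB' b) c).trans (Eq.trans ?_ (legHom_mul_left (S.EC' c) b).symm)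
    rw [S.legHom_EC', S.legHom_EB', ← mul_assoc, ← mul_assoc, tens_comm])
  idem b := legHom_injective hA (by
    have h1 : ∀ w : B ⊗[ℂ] C, legHom B C (TensorProduct.lift (LinearMap.mk₂ ℂ
        (fun u v ↦ ((LinearMap.mul ℂ C).flip.flip v).lTensor B (S.EB' u))
        (fun u u' v ↦ by simp) (fun r u v ↦ by simp)
        (fun u v v' ↦ by simp [LinearMap.lTensor_add])
        (fun r u v ↦ by simp [LinearMap.lTensor_smul])) w) = legHom B C w * E := fun w ↦
      tensor_congr (F := legHom B C ∘ₗ TensorProduct.lift _)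
        (G := LinearMap.mulRight ℂ E ∘ₗ legHom B C) (fun u v ↦ by
          refine (legHom_mul_left' (S.EB' u) v).trans ?_
          rw [S.legHom_EB', ← mul_assoc, tens_mul_tens]
          simp) w
    rw [h1, S.legHom_EB', mul_assoc, hsep.idem])
  full_B := S.full_EC' hsep hA hC
  full_C := S.full_EB' hsep
  exists_EC b := by
    have h1 : tens b.1 1 * E ∈ {x | ∃ b ∈ B, x = tens b 1 * E} := ⟨b.1, b.2, rfl⟩
    rw [hsep.eq_mul] at h1
    obtain ⟨c, hc, h⟩ := h1
    exact ⟨⟨c, hc⟩, legHom_injective hA (by rw [S.legHom_EB', S.legHom_EC', h])⟩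
  exists_EB c := by
    have h1 : tens 1 c.1 * E ∈ {x | ∃ c ∈ C, x = tens 1 c * E} := ⟨c.1, c.2, rfl⟩
    rw [← hsep.eq_mul] at h1
    obtain ⟨b, hb, h⟩ := h1
    exact ⟨⟨b, hb⟩, legHom_injective hA (by rw [S.legHom_EB', S.legHom_EC', h])⟩

end SeparabilityMaps

end WeakMultiplierHopf

end

noncomputable section

namespace WeakMultiplierHopf

variable {A : Type*} [NonUnitalRing A] [Module ℂ A] [IsScalarTower ℂ A A] [SMulCommClass ℂ A A]
variable {Δ : A →ₙₐ[ℂ] Mult (A ⊗[ℂ] A)} {E : Mult (A ⊗[ℂ] A)}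
variable {B C : NonUnitalSubalgebra ℂ (Mult A)}

/-! ### The coproduct commutes with the legs of its canonical idempotent -/

section EqZero

variable {R : Type*} [NonUnitalRing R] [Module ℂ R] [IsScalarTower ℂ R R] [SMulCommClass ℂ R R]
variable {U V X : Type*} [AddCommGroup U] [Module ℂ U] [AddCommGroup V] [Module ℂ V]

/-- A family `D` of multipliers indexed by `U` vanishes if it vanishes after pairing with elements
`e x` of `U ⊗ V` whose left leg is all of `U`. -/
theorem eq_zero_of_left_leg (hA : IsNondegenerateAlg A) (hR : IsNondegenerateAlg R)
    {e : X → U ⊗[ℂ] V} (he : ∀ g : U →ₗ[ℂ] ℂ, (∀ x, slice₁ g (e x) = 0) → g = 0)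
    {act : V →ₗ[ℂ] A →ₗ[ℂ] A} (hact : ∀ v, (∀ y, act v y = 0) → v = 0)
    {D : U →ₗ[ℂ] Mult R}
    (h : ∀ x y, TensorProduct.lift (tens.compl₁₂ D (toMult A ∘ₗ act.flip y)) (e x) = 0) (u : U) :
    D u = 0 := by
  refine hR.ext_lact fun s ↦ eq_zero_of_dual fun f ↦ ?_
  suffices hg : f ∘ₗ (lactHom R).flip s ∘ₗ D = 0 from LinearMap.congr_fun hg u
  refine he _ fun x ↦ hact _ fun y ↦ hA.1 _ fun y' ↦ ?_
  have key : ∀ w : U ⊗[ℂ] V, act (slice₁ (f ∘ₗ (lactHom R).flip s ∘ₗ D) w) y * y' =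
      slice₁ f ((TensorProduct.lift (tens.compl₁₂ D (toMult A ∘ₗ act.flip y)) w).lact
        (s ⊗ₜ y')) := fun w ↦
    tensor_congr (F := LinearMap.mulRight ℂ y' ∘ₗ act.flip y ∘ₗ
        slice₁ (f ∘ₗ (lactHom R).flip s ∘ₗ D))
      (G := slice₁ f ∘ₗ (lactHom (R ⊗[ℂ] A)).flip (s ⊗ₜ y') ∘ₗ
        TensorProduct.lift (tens.compl₁₂ D (toMult A ∘ₗ act.flip y)))
      (fun u v ↦ by simp [tens_lact]) w
  rw [key, h]
  exact map_zero (slice₁ f)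

theorem eq_zero_of_right_leg (hA : IsNondegenerateAlg A) (hR : IsNondegenerateAlg R)
    {e : X → U ⊗[ℂ] V} (he : ∀ g : V →ₗ[ℂ] ℂ, (∀ x, slice₂ g (e x) = 0) → g = 0)
    {act : U →ₗ[ℂ] A →ₗ[ℂ] A} (hact : ∀ v, (∀ y, act v y = 0) → v = 0)
    {D : V →ₗ[ℂ] Mult R}
    (h : ∀ x y, TensorProduct.lift (tens.compl₁₂ (toMult A ∘ₗ act.flip y) D) (e x) = 0) (v : V) :
    D v = 0 := by
  refine hR.ext_lact fun s ↦ eq_zero_of_dual fun f ↦ ?_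
  suffices hg : f ∘ₗ (lactHom R).flip s ∘ₗ D = 0 from LinearMap.congr_fun hg v
  refine he _ fun x ↦ hact _ fun y ↦ hA.1 _ fun y' ↦ ?_
  have key : ∀ w : U ⊗[ℂ] V, act (slice₂ (f ∘ₗ (lactHom R).flip s ∘ₗ D) w) y * y' =
      slice₂ f ((TensorProduct.lift (tens.compl₁₂ (toMult A ∘ₗ act.flip y) D) w).lact
        (y' ⊗ₜ s)) := fun w ↦
    tensor_congr (F := LinearMap.mulRight ℂ y' ∘ₗ act.flip y ∘ₗ
        slice₂ (f ∘ₗ (lactHom R).flip s ∘ₗ D))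
      (G := slice₂ f ∘ₗ (lactHom (A ⊗[ℂ] R)).flip (y' ⊗ₜ s) ∘ₗ
        TensorProduct.lift (tens.compl₁₂ (toMult A ∘ₗ act.flip y) D))
      (fun u v ↦ by simp [tens_lact]) w
  rw [key, h]
  exact map_zero (slice₂ f)

end EqZero

theorem inl_lact (hA : IsNondegenerateAlg A) (m : Mult A) (a : A) :
    inl (m.lact a) = tens m 1 * inl a := by
  rw [inl, inl, tens_mul_tens, hA.mul_toMult, one_mul]

theorem inr_lact (hA : IsNondegenerateAlg A) (m : Mult A) (a : A) :
    inr (m.lact a) = tens 1 m * inr a := by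
  rw [inr, inr, tens_mul_tens, hA.mul_toMult, one_mul]

theorem inl_ract (hA : IsNondegenerateAlg A) (m : Mult A) (a : A) :
    inl (m.ract a) = inl a * tens m 1 := by
  rw [inl, inl, tens_mul_tens, hA.toMult_mul, one_mul]

theorem inr_ract (hA : IsNondegenerateAlg A) (m : Mult A) (a : A) :
    inr (m.ract a) = inr a * tens 1 m := by
  rw [inr, inr, tens_mul_tens, hA.toMult_mul, one_mul]

theorem tens_inl_comm (m : Mult A) (a : A) : tens 1 m * inl a = inl a * tens 1 m := by
  simp only [inl, tens_mul_tens, one_mul, mul_one]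

theorem tens_inr_comm (m : Mult A) (a : A) : tens m 1 * inr a = inr a * tens m 1 := by
  simp only [inr, tens_mul_tens, one_mul, mul_one]

/-- A regular coproduct whose canonical idempotent is a regular separability idempotent. -/
structure SeparableSetting (Δ : A →ₙₐ[ℂ] Mult (A ⊗[ℂ] A)) (E : Mult (A ⊗[ℂ] A))
    (B C : NonUnitalSubalgebra ℂ (Mult A)) : Prop extends CoproductSetting Δ E where
  full : IsFull Δ
  sitsB : SitsNondegenerately B
  sitsC : SitsNondegenerately C
  sep : IsRegularSeparabilityIdempotent B C E

namespace SeparableSetting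

variable (h : SeparableSetting Δ E B C)

include h

theorem nondeg₂ : IsNondegenerateAlg (A ⊗[ℂ] A) := h.nondeg.tensor h.nondeg

/-- `Δ(bx) = (1 ⊗ b)Δ(x)` for `b ∈ B`: both sides agree after pairing with `E(1 ⊗ c)`. -/
theorem coproduct_lact_left (b : B) (x : A) : Δ (b.1.lact x) = tens 1 b.1 * Δ x := by
  obtain ⟨S⟩ := h.sep.nonempty_maps h.nondeg
  refine sub_eq_zero.mp (eq_zero_of_left_leg (D := (Δ : A →ₗ[ℂ] _) ∘ₗ (lactOn B).flip x -
      LinearMap.mulRight ℂ (Δ x) ∘ₗ tens (A := A) (B := A) 1 ∘ₗ incl B) h.nondeg h.nondeg₂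
    (S.full_EC h.sep) (fun c hc ↦ eq_zero_of_lactOn (B := C) h.nondeg hc) (fun c y ↦ ?_) b)
  have key : ∀ w, TensorProduct.lift (tens.compl₁₂ ((Δ : A →ₗ[ℂ] _) ∘ₗ (lactOn B).flip x -
      LinearMap.mulRight ℂ (Δ x) ∘ₗ tens (A := A) (B := A) 1 ∘ₗ incl B)
      (toMult A ∘ₗ (lactOn C).flip y)) w = deltaId Δ ((legHom B C w).lact (x ⊗ₜ y)) -
      leg₂₃ (legHom B C w) * deltaId Δ (x ⊗ₜ y) := fun w ↦
    tensor_congr (G := deltaId Δ ∘ₗ (lactHom _).flip (x ⊗ₜ y) ∘ₗ legHom B C -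
        LinearMap.mulRight ℂ (deltaId Δ (x ⊗ₜ y)) ∘ₗ reassoc.toLinearMap ∘ₗ tens 1 ∘ₗ legHom B C)
      (fun u v ↦ by
        have h1 : reassoc (tens 1 (tens u.1 v.1)) = tens (tens 1 u.1) v.1 := leg₂₃_tens _ _
        simp [tens_lact, deltaId_tmul, h1, tens_mul_tens, h.nondeg.mul_toMult]) w
  rw [key, S.legHom_EC, Mult.mul_lact, h.deltaId_lact, leg₂₃_mul, mul_assoc, ← mul_sub, leg₂₃_tens,
    tens_lact, TensorProduct.map_tmul, deltaId_tmul, deltaId_tmul, tens_mul_tens,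
    h.nondeg.mul_toMult, tens_one_one, one_mul]
  exact (congrArg _ (sub_self _)).trans (mul_zero _)

/-- `Δ(xb) = Δ(x)(1 ⊗ b)` for `b ∈ B`. -/
theorem coproduct_ract_left (b : B) (x : A) : Δ (b.1.ract x) = Δ x * tens 1 b.1 := by
  obtain ⟨S⟩ := h.sep.nonempty_maps h.nondeg
  refine sub_eq_zero.mp (eq_zero_of_left_leg (D := (Δ : A →ₗ[ℂ] _) ∘ₗ (ractOn B).flip x -
      LinearMap.mulLeft ℂ (Δ x) ∘ₗ tens (A := A) (B := A) 1 ∘ₗ incl B) h.nondeg h.nondeg₂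
    (S.full_EC' h.sep h.nondeg h.sitsC) (fun c hc ↦ eq_zero_of_ractOn (B := C) h.nondeg hc)
    (fun c y ↦ ?_) b)
  have key : ∀ w, TensorProduct.lift (tens.compl₁₂ ((Δ : A →ₗ[ℂ] _) ∘ₗ (ractOn B).flip x -
      LinearMap.mulLeft ℂ (Δ x) ∘ₗ tens (A := A) (B := A) 1 ∘ₗ incl B)
      (toMult A ∘ₗ (ractOn C).flip y)) w = deltaId Δ ((legHom B C w).ract (x ⊗ₜ y)) -
      deltaId Δ (x ⊗ₜ y) * leg₂₃ (legHom B C w) := fun w ↦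
    tensor_congr (G := deltaId Δ ∘ₗ (ractHom _).flip (x ⊗ₜ y) ∘ₗ legHom B C -
        LinearMap.mulLeft ℂ (deltaId Δ (x ⊗ₜ y)) ∘ₗ reassoc.toLinearMap ∘ₗ tens 1 ∘ₗ legHom B C)
      (fun u v ↦ by
        have h1 : reassoc (tens 1 (tens u.1 v.1)) = tens (tens 1 u.1) v.1 := leg₂₃_tens _ _
        simp [tens_ract, deltaId_tmul, h1, tens_mul_tens, h.nondeg.toMult_mul]) w
  rw [key, S.legHom_EC', Mult.mul_ract, h.deltaId_ract, leg₂₃_mul, ← mul_assoc, ← sub_mul,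
    leg₂₃_tens, tens_ract, TensorProduct.map_tmul, deltaId_tmul, deltaId_tmul, tens_mul_tens,
    h.nondeg.toMult_mul, tens_one_one, mul_one]
  exact (congrArg (· * _) (sub_self _)).trans (zero_mul _)

/-- `Δ(cy) = (c ⊗ 1)Δ(y)` for `c ∈ C`. -/
theorem coproduct_lact_right (c : C) (y : A) : Δ (c.1.lact y) = tens c.1 1 * Δ y := by
  obtain ⟨S⟩ := h.sep.nonempty_maps h.nondeg
  refine sub_eq_zero.mp (eq_zero_of_right_leg (D := (Δ : A →ₗ[ℂ] _) ∘ₗ (lactOn C).flip y -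
      LinearMap.mulRight ℂ (Δ y) ∘ₗ (tens (A := A) (B := A)).flip 1 ∘ₗ incl C) h.nondeg h.nondeg₂
    (S.full_EB h.sep h.nondeg h.sitsB) (fun c hc ↦ eq_zero_of_lactOn (B := B) h.nondeg hc)
    (fun b x ↦ ?_) c)
  have key : ∀ w, reassoc (TensorProduct.lift (tens.compl₁₂ (toMult A ∘ₗ (lactOn B).flip x)
      ((Δ : A →ₗ[ℂ] _) ∘ₗ (lactOn C).flip y -
        LinearMap.mulRight ℂ (Δ y) ∘ₗ (tens (A := A) (B := A)).flip 1 ∘ₗ incl C)) w) =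
      idDelta Δ ((legHom B C w).lact (x ⊗ₜ y)) -
      leg₁₂ (legHom B C w) * idDelta Δ (x ⊗ₜ y) := fun w ↦
    tensor_congr (F := reassoc.toLinearMap ∘ₗ TensorProduct.lift _)
      (G := idDelta Δ ∘ₗ (lactHom _).flip (x ⊗ₜ y) ∘ₗ legHom B C -
        LinearMap.mulRight ℂ (idDelta Δ (x ⊗ₜ y)) ∘ₗ tens.flip 1 ∘ₗ legHom B C)
      (fun u v ↦ by
        have h1 : tens (tens u.1 v.1) (1 : Mult A) = reassoc (tens u.1 (tens v.1 1)) :=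
          (reassoc_tens _ _ _).symm
        simp [tens_lact, idDelta_tmul, h1, ← map_mul, tens_mul_tens, h.nondeg.mul_toMult]) w
  apply reassoc_injective
  rw [key, S.legHom_EB, Mult.mul_lact, h.idDelta_lact, leg₁₂_mul, mul_assoc, ← mul_sub, leg₁₂_tens,
    ← reassoc_tens, tens_lact, TensorProduct.map_tmul, idDelta_tmul, idDelta_tmul, ← map_mul,
    tens_mul_tens, h.nondeg.mul_toMult, tens_one_one, one_mul, map_zero]
  exact (congrArg _ (sub_self _)).trans (mul_zero _)

/-- `Δ(yc) = Δ(y)(c ⊗ 1)` for `c ∈ C`. -/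
theorem coproduct_ract_right (c : C) (y : A) : Δ (c.1.ract y) = Δ y * tens c.1 1 := by
  obtain ⟨S⟩ := h.sep.nonempty_maps h.nondeg
  refine sub_eq_zero.mp (eq_zero_of_right_leg (D := (Δ : A →ₗ[ℂ] _) ∘ₗ (ractOn C).flip y -
      LinearMap.mulLeft ℂ (Δ y) ∘ₗ (tens (A := A) (B := A)).flip 1 ∘ₗ incl C) h.nondeg h.nondeg₂
    (S.full_EB' h.sep) (fun c hc ↦ eq_zero_of_ractOn (B := B) h.nondeg hc) (fun b x ↦ ?_) c)
  have key : ∀ w, reassoc (TensorProduct.lift (tens.compl₁₂ (toMult A ∘ₗ (ractOn B).flip x)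
      ((Δ : A →ₗ[ℂ] _) ∘ₗ (ractOn C).flip y -
        LinearMap.mulLeft ℂ (Δ y) ∘ₗ (tens (A := A) (B := A)).flip 1 ∘ₗ incl C)) w) =
      idDelta Δ ((legHom B C w).ract (x ⊗ₜ y)) -
      idDelta Δ (x ⊗ₜ y) * leg₁₂ (legHom B C w) := fun w ↦
    tensor_congr (F := reassoc.toLinearMap ∘ₗ TensorProduct.lift _)
      (G := idDelta Δ ∘ₗ (ractHom _).flip (x ⊗ₜ y) ∘ₗ legHom B C -
        LinearMap.mulLeft ℂ (idDelta Δ (x ⊗ₜ y)) ∘ₗ tens.flip 1 ∘ₗ legHom B C)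
      (fun u v ↦ by
        have h1 : tens (tens u.1 v.1) (1 : Mult A) = reassoc (tens u.1 (tens v.1 1)) :=
          (reassoc_tens _ _ _).symm
        simp [tens_ract, idDelta_tmul, h1, ← map_mul, tens_mul_tens, h.nondeg.toMult_mul]) w
  apply reassoc_injective
  rw [key, S.legHom_EB', Mult.mul_ract, h.idDelta_ract, leg₁₂_mul, ← mul_assoc, ← sub_mul,
    leg₁₂_tens, ← reassoc_tens, tens_ract, TensorProduct.map_tmul, idDelta_tmul, idDelta_tmul,
    ← map_mul, tens_mul_tens, h.nondeg.toMult_mul, tens_one_one, mul_one, map_zero]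
  exact (congrArg (· * _) (sub_self _)).trans (zero_mul _)

end SeparableSetting

end WeakMultiplierHopf

end

noncomputable section

namespace WeakMultiplierHopf

variable {A : Type*} [NonUnitalRing A] [Module ℂ A] [IsScalarTower ℂ A A] [SMulCommClass ℂ A A]
variable {Δ : A →ₙₐ[ℂ] Mult (A ⊗[ℂ] A)} {E : Mult (A ⊗[ℂ] A)}
variable {B C : NonUnitalSubalgebra ℂ (Mult A)}

/-! ### The left and the right datum of a coproduct -/

namespace CanonicalMaps

variable (M : CanonicalMaps Δ)

theorem full_T (hfull : IsFull Δ) (f : A →ₗ[ℂ] ℂ) (h : ∀ a b, slice₁ f (M.T a b) = 0) : f = 0 := by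
  have hV := hfull.left (LinearMap.ker f) fun a b ↦ by
    obtain ⟨s, hs⟩ := exists_rTensor_subtype (N := LinearMap.ker f) (t := M.T a b)
      fun g ↦ by rw [LinearMap.mem_ker, ← apply_slice₁, h, map_zero]
    rw [← M.toMult_T, ← hs]
    refine Submodule.mem_map_of_mem ?_
    clear hs
    induction s using TensorProduct.induction_on with
    | zero => rw [map_zero]; exact zero_mem _
    | add s t hs ht => rw [map_add]; exact add_mem hs ht
    | tmul x y => exact Submodule.apply_mem_map₂ _ x.2 Submodule.mem_top
  exact LinearMap.ker_eq_top.mp hV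

theorem full_T' (hfull : IsFull Δ) (f : A →ₗ[ℂ] ℂ) (h : ∀ c a, slice₂ f (M.T' c a) = 0) :
    f = 0 := by
  have hV := hfull.right (LinearMap.ker f) fun c a ↦ by
    obtain ⟨s, hs⟩ := exists_lTensor_subtype (N := LinearMap.ker f) (t := M.T' c a)
      fun g ↦ by rw [LinearMap.mem_ker, apply_slice₁, h, map_zero]
    rw [← M.toMult_T', ← hs]
    refine Submodule.mem_map_of_mem ?_
    clear hs
    induction s using TensorProduct.induction_on with
    | zero => rw [map_zero]; exact zero_mem _
    | add s t hs ht => rw [map_add]; exact add_mem hs ht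
    | tmul x y => exact Submodule.apply_mem_map₂ _ Submodule.mem_top y.2
  exact LinearMap.ker_eq_top.mp hV

section

variable (hA : IsNondegenerateAlg A)

include hA

theorem coproductAct_left (a : A) (t : A ⊗[ℂ] A) :
    coproductAct (LinearMap.mul ℂ A) M.T a t = (Δ a).lact t :=
  tensor_congr (fun p q ↦ (hA.tensor hA).toMult_injective <| by
    refine (toMult_mul_inl hA (M.T a q) p).symm.trans ?_
    rw [M.toMult_T, ← (hA.tensor hA).mul_toMult, ← inl_mul_inr, mul_assoc, inl_inr_comm]) t

theorem coproductAct_right (a : A) (t : A ⊗[ℂ] A) :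
    coproductAct (LinearMap.mul ℂ A).flip M.K'.flip a t = (Δ a).ract t :=
  tensor_congr (fun p q ↦ (hA.tensor hA).toMult_injective <| by
    refine (inl_mul_toMult hA (M.K' q a) p).symm.trans ?_
    rw [M.toMult_K', ← (hA.tensor hA).toMult_mul, ← inl_mul_inr, mul_assoc]) t

theorem full_K (hfull : IsFull Δ) (f : A →ₗ[ℂ] ℂ) (h : ∀ a b, slice₂ f (M.K a b) = 0) : f = 0 :=
  M.full_T' hfull f fun c a ↦ hA.1 _ fun p ↦ by
    have h1 := congrArg (slice₂ f) (M.T'_mul_right hA c a p)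
    rw [slice₂_rTensor, slice₂_rTensor, h, map_zero] at h1
    exact h1

theorem full_K' (hfull : IsFull Δ) (f : A →ₗ[ℂ] ℂ) (h : ∀ c a, slice₁ f (M.K' c a) = 0) : f = 0 :=
  M.full_T hfull f fun a p ↦ hA.2 _ fun c ↦ by
    have h1 := congrArg (slice₁ f) (M.K'_mul_right hA c a p)
    rw [slice₁_lTensor, slice₁_lTensor, h, map_zero] at h1
    exact h1.symm

end

end CanonicalMaps

namespace SeparableSetting

variable (h : SeparableSetting Δ E B C) (M : CanonicalMaps Δ) (S : SeparabilityMaps B C E)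

/-- The maps `Δ(a)(1 ⊗ b)` and `Δ(a)(b ⊗ 1)` form a one-sided datum. -/
def left : OneSidedDatum A B C where
  sep := S.leftDatum h.sep h.nondeg h.sitsB h.sitsC
  mul := LinearMap.mul ℂ A
  lB := lactOn B
  rB := ractOn B
  lC := lactOn C
  rC := ractOn C
  T := M.T
  K := M.K
  E := E.lact
  mul_assoc := mul_assoc
  nondeg := h.nondeg.1
  lB_inj _ := eq_zero_of_lactOn h.nondeg
  lC_inj _ := eq_zero_of_lactOn h.nondeg
  lB_mB _ _ _ := rfl
  lC_mC _ _ _ := rfl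
  lB_mul b := h.nondeg.lact_mul b.1
  lC_mul c := h.nondeg.lact_mul c.1
  mul_rB b a a' := (h.nondeg.ract_mul b.1 a a').symm
  mul_rC c a a' := (h.nondeg.ract_mul c.1 a a').symm
  rB_mul b a a' := (b.1.compat a a').symm
  rC_mul c a a' := (c.1.compat a a').symm
  span_lB := h.sitsB.range_lactOn
  span_lC := h.sitsC.range_lactOn
  span_rB := h.sitsB.range_ractOn
  span_rC := h.sitsC.range_ractOn
  full_T := M.full_T h.full
  full_K := M.full_K h.nondeg h.full
  T_K := M.T_mul_left h.nondeg
  T_mul a b p := h.nondeg₂.toMult_injective <| by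
    refine Eq.trans ?_ (CanonicalMaps.toMult_mul_inr h.nondeg (M.T a b) p)
    rw [M.toMult_T, M.toMult_T, mul_assoc, ← inr_mul]
    rfl
  K_mul a b p := h.nondeg₂.toMult_injective <| by
    refine Eq.trans ?_ (CanonicalMaps.toMult_mul_inl h.nondeg (M.K a b) p)
    rw [M.toMult_K, M.toMult_K, mul_assoc, ← inl_mul]
    rfl
  mul_T a b p := h.nondeg₂.toMult_injective <| by
    rw [M.coproductAct_left h.nondeg, ← h.nondeg₂.mul_toMult, M.toMult_T, M.toMult_T, ← mul_assoc,
      ← map_mul]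
    rfl
  mul_K a b p := h.nondeg₂.toMult_injective <| by
    rw [M.coproductAct_left h.nondeg, ← h.nondeg₂.mul_toMult, M.toMult_K, M.toMult_K, ← mul_assoc,
      ← map_mul]
    rfl
  E_T a b := h.nondeg₂.toMult_injective <| by
    rw [← h.nondeg₂.mul_toMult, M.toMult_T, ← mul_assoc, h.canonical.mul_coproduct h.nondeg]
  E_K a b := h.nondeg₂.toMult_injective <| by
    rw [← h.nondeg₂.mul_toMult, M.toMult_K, ← mul_assoc, h.canonical.mul_coproduct h.nondeg]
  E_mem := h.canonical.lact_induction fun a p b ↦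
    Submodule.subset_span ⟨a, b, p, (M.coproductAct_left h.nondeg a (p ⊗ₜ b)).symm⟩
  E_lB b p q := by
    refine Eq.trans ?_ (legHom_lact (S.EB b) p q)
    rw [S.legHom_EB]; rfl
  E_lC c p q := by
    refine Eq.trans ?_ (legHom_lact (S.EC c) p q)
    rw [S.legHom_EC]; rfl
  T_lC_eq b c hbc a q := h.nondeg₂.toMult_injective <| by
    refine Eq.trans ?_ (toMult_mul_tens_left h.nondeg h.nondeg b.1 (M.T a q))
    have hbc' : E * tens b.1 1 = E * tens 1 c.1 := by
      rw [← S.legHom_EB, ← S.legHom_EC]; exact congrArg _ hbc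
    rw [lactOn_apply, M.toMult_T, M.toMult_T, inr_lact h.nondeg, mul_assoc (Δ a), ← tens_inr_comm,
      ← h.canonical.coproduct_mul h.nondeg a, mul_assoc, mul_assoc, ← mul_assoc E, ← mul_assoc E,
      hbc']
  K_lB_eq b c hbc a p := h.nondeg₂.toMult_injective <| by
    refine Eq.trans ?_ (toMult_mul_tens_right h.nondeg h.nondeg c.1 (M.K a p))
    have hbc' : E * tens b.1 1 = E * tens 1 c.1 := by
      rw [← S.legHom_EB, ← S.legHom_EC]; exact congrArg _ hbc
    rw [lactOn_apply, M.toMult_K, M.toMult_K, inl_lact h.nondeg, mul_assoc (Δ a), ← tens_inl_comm,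
      ← h.canonical.coproduct_mul h.nondeg a, mul_assoc, mul_assoc, ← mul_assoc E, ← mul_assoc E,
      hbc']
  T_rB b a q := h.nondeg₂.toMult_injective <| by
    rw [M.toMult_T, M.toMult_T, ractOn_apply, lactOn_apply, h.coproduct_ract_left,
      inr_lact h.nondeg, mul_assoc]
  K_rC c a p := h.nondeg₂.toMult_injective <| by
    rw [M.toMult_K, M.toMult_K, ractOn_apply, lactOn_apply, h.coproduct_ract_right,
      inl_lact h.nondeg, mul_assoc]
  T_lC c a q := h.nondeg₂.toMult_injective <| by
    refine Eq.trans ?_ (tens_left_mul_toMult h.nondeg h.nondeg c.1 (M.T a q))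
    rw [M.toMult_T, M.toMult_T, lactOn_apply, h.coproduct_lact_right, mul_assoc]
  K_lC c a p := h.nondeg₂.toMult_injective <| by
    refine Eq.trans ?_ (tens_left_mul_toMult h.nondeg h.nondeg c.1 (M.K a p))
    rw [M.toMult_K, M.toMult_K, lactOn_apply, h.coproduct_lact_right, mul_assoc]
  T_lB b a q := h.nondeg₂.toMult_injective <| by
    refine Eq.trans ?_ (tens_right_mul_toMult h.nondeg h.nondeg b.1 (M.T a q))
    rw [M.toMult_T, M.toMult_T, lactOn_apply, h.coproduct_lact_left, mul_assoc]
  K_lB b a p := h.nondeg₂.toMult_injective <| by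
    refine Eq.trans ?_ (tens_right_mul_toMult h.nondeg h.nondeg b.1 (M.K a p))
    rw [M.toMult_K, M.toMult_K, lactOn_apply, h.coproduct_lact_left, mul_assoc]
  coassoc₂ φ a z r :=
    slice₂_of_assoc (M.assoc_K_T h.nondeg h.coproduct.toIsCoproduct a z r) φ
  coassoc₁ f a z r :=
    slice₁_of_assoc (M.assoc_K_T h.nondeg h.coproduct.toIsCoproduct a z r) f

/-- The maps `(1 ⊗ b)Δ(a)` and `(b ⊗ 1)Δ(a)` form a one-sided datum for the opposite products. -/
def right : OneSidedDatum A B C where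
  sep := S.rightDatum h.sep h.nondeg h.sitsB h.sitsC
  mul := (LinearMap.mul ℂ A).flip
  lB := ractOn B
  rB := lactOn B
  lC := ractOn C
  rC := lactOn C
  T := M.K'.flip
  K := M.T'.flip
  E := E.ract
  mul_assoc x y z := (mul_assoc z y x).symm
  nondeg := h.nondeg.2
  lB_inj _ := eq_zero_of_ractOn h.nondeg
  lC_inj _ := eq_zero_of_ractOn h.nondeg
  lB_mB _ _ _ := rfl
  lC_mC _ _ _ := rfl
  lB_mul b a a' := h.nondeg.ract_mul b.1 a' a
  lC_mul c a a' := h.nondeg.ract_mul c.1 a' a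
  mul_rB b a a' := (h.nondeg.lact_mul b.1 a' a).symm
  mul_rC c a a' := (h.nondeg.lact_mul c.1 a' a).symm
  rB_mul b a a' := b.1.compat a' a
  rC_mul c a a' := c.1.compat a' a
  span_lB := h.sitsB.range_ractOn
  span_lC := h.sitsC.range_ractOn
  span_rB := h.sitsB.range_lactOn
  span_rC := h.sitsC.range_lactOn
  full_T f hf := M.full_K' h.nondeg h.full f fun c a ↦ hf a c
  full_K f hf := M.full_T' h.full f fun c a ↦ hf a c
  T_K a b p := (M.T'_mul_left h.nondeg p a b).symm
  T_mul a b p := h.nondeg₂.toMult_injective <| by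
    refine Eq.trans ?_ (CanonicalMaps.inr_mul_toMult h.nondeg (M.K' b a) p)
    rw [LinearMap.flip_apply, M.toMult_K', M.toMult_K', ← mul_assoc, ← inr_mul]
    rfl
  K_mul a b p := h.nondeg₂.toMult_injective <| by
    refine Eq.trans ?_ (CanonicalMaps.inl_mul_toMult h.nondeg (M.T' b a) p)
    rw [LinearMap.flip_apply, M.toMult_T', M.toMult_T', ← mul_assoc, ← inl_mul]
    rfl
  mul_T a b p := h.nondeg₂.toMult_injective <| by
    rw [M.coproductAct_right h.nondeg, ← h.nondeg₂.toMult_mul]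
    change toMult _ (M.K' p (b * a)) = toMult _ (M.K' p b) * Δ a
    rw [M.toMult_K', M.toMult_K', mul_assoc, ← map_mul]
  mul_K a b p := h.nondeg₂.toMult_injective <| by
    rw [M.coproductAct_right h.nondeg, ← h.nondeg₂.toMult_mul]
    change toMult _ (M.T' p (b * a)) = toMult _ (M.T' p b) * Δ a
    rw [M.toMult_T', M.toMult_T', mul_assoc, ← map_mul]
  E_T a b := h.nondeg₂.toMult_injective <| by
    rw [← h.nondeg₂.toMult_mul, LinearMap.flip_apply, M.toMult_K', mul_assoc,
      h.canonical.coproduct_mul h.nondeg]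
  E_K a b := h.nondeg₂.toMult_injective <| by
    rw [← h.nondeg₂.toMult_mul, LinearMap.flip_apply, M.toMult_T', mul_assoc,
      h.canonical.coproduct_mul h.nondeg]
  E_mem := h.canonical.ract_induction fun a p b ↦
    Submodule.subset_span ⟨a, b, p, (M.coproductAct_right h.nondeg a (p ⊗ₜ b)).symm⟩
  E_lB b p q := by
    refine Eq.trans ?_ (legHom_ract (S.EB' b) p q)
    rw [S.legHom_EB']; rfl
  E_lC c p q := by
    refine Eq.trans ?_ (legHom_ract (S.EC' c) p q)
    rw [S.legHom_EC']; rfl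
  T_lC_eq b c hbc a q := h.nondeg₂.toMult_injective <| by
    refine Eq.trans ?_ (tens_left_mul_toMult h.nondeg h.nondeg b.1 (M.K' q a))
    have hbc' : tens b.1 1 * E = tens 1 c.1 * E := by
      rw [← S.legHom_EB', ← S.legHom_EC']; exact congrArg _ hbc
    rw [ractOn_apply, LinearMap.flip_apply, M.toMult_K', M.toMult_K', inr_ract h.nondeg,
      ← mul_assoc (tens b.1 1), tens_inr_comm, ← h.canonical.mul_coproduct h.nondeg a, mul_assoc,
      mul_assoc, ← mul_assoc _ E, ← mul_assoc _ E, hbc']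
  K_lB_eq b c hbc a p := h.nondeg₂.toMult_injective <| by
    refine Eq.trans ?_ (tens_right_mul_toMult h.nondeg h.nondeg c.1 (M.T' p a))
    have hbc' : tens b.1 1 * E = tens 1 c.1 * E := by
      rw [← S.legHom_EB', ← S.legHom_EC']; exact congrArg _ hbc
    rw [ractOn_apply, LinearMap.flip_apply, M.toMult_T', M.toMult_T', inl_ract h.nondeg,
      ← mul_assoc (tens 1 c.1), tens_inl_comm, ← h.canonical.mul_coproduct h.nondeg a, mul_assoc,
      mul_assoc, ← mul_assoc _ E, ← mul_assoc _ E, hbc']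
  T_rB b a q := h.nondeg₂.toMult_injective <| by
    rw [LinearMap.flip_apply, LinearMap.flip_apply, M.toMult_K', M.toMult_K', ractOn_apply,
      lactOn_apply, h.coproduct_lact_left, inr_ract h.nondeg, mul_assoc]
  K_rC c a p := h.nondeg₂.toMult_injective <| by
    rw [LinearMap.flip_apply, LinearMap.flip_apply, M.toMult_T', M.toMult_T', ractOn_apply,
      lactOn_apply, h.coproduct_lact_right, inl_ract h.nondeg, mul_assoc]
  T_lC c a q := h.nondeg₂.toMult_injective <| by
    refine Eq.trans ?_ (toMult_mul_tens_left h.nondeg h.nondeg c.1 (M.K' q a))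
    rw [LinearMap.flip_apply, M.toMult_K', M.toMult_K', ractOn_apply, h.coproduct_ract_right,
      mul_assoc]
  K_lC c a p := h.nondeg₂.toMult_injective <| by
    refine Eq.trans ?_ (toMult_mul_tens_left h.nondeg h.nondeg c.1 (M.T' p a))
    rw [LinearMap.flip_apply, M.toMult_T', M.toMult_T', ractOn_apply, h.coproduct_ract_right,
      mul_assoc]
  T_lB b a q := h.nondeg₂.toMult_injective <| by
    refine Eq.trans ?_ (toMult_mul_tens_right h.nondeg h.nondeg b.1 (M.K' q a))
    rw [LinearMap.flip_apply, M.toMult_K', M.toMult_K', ractOn_apply, h.coproduct_ract_left,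
      mul_assoc]
  K_lB b a p := h.nondeg₂.toMult_injective <| by
    refine Eq.trans ?_ (toMult_mul_tens_right h.nondeg h.nondeg b.1 (M.T' p a))
    rw [LinearMap.flip_apply, M.toMult_T', M.toMult_T', ractOn_apply, h.coproduct_ract_left,
      mul_assoc]
  coassoc₂ φ a z r :=
    slice₂_of_assoc (M.assoc_T'_K' h.nondeg h.coproduct.toIsCoproduct a z r) φ
  coassoc₁ f a z r :=
    slice₁_of_assoc (M.assoc_T'_K' h.nondeg h.coproduct.toIsCoproduct a z r) f

end SeparableSetting

end WeakMultiplierHopf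

end

noncomputable section

namespace WeakMultiplierHopf

variable {A : Type*} [NonUnitalRing A] [Module ℂ A] [IsScalarTower ℂ A A] [SMulCommClass ℂ A A]
variable {Δ : A →ₙₐ[ℂ] Mult (A ⊗[ℂ] A)} {E : Mult (A ⊗[ℂ] A)}
variable {B C : NonUnitalSubalgebra ℂ (Mult A)}

/-! ### Integrals are invariant functionals -/

/-- It suffices to check invariance on elements `ac` with `c ∈ C`, as `AC = A`. -/
theorem OneSidedDatum.isInvariant_of_lC {V X Y : Type*} [AddCommGroup V] [Module ℂ V]
    [AddCommGroup X] [Module ℂ X] [AddCommGroup Y] [Module ℂ Y] (D : OneSidedDatum V X Y)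
    {φ : V →ₗ[ℂ] ℂ} (h : ∀ a c, ∃ c', ∀ p, slice₂ φ (D.K a (D.lC c p)) = D.lC c' p) :
    D.IsInvariant φ := by
  have hle : (⊤ : Submodule ℂ V) ≤ (LinearMap.range D.lC).comap (D.K.compr₂ (slice₂ φ)) := by
    rw [← D.span_rC]
    rintro _ ⟨t, rfl⟩
    induction t using TensorProduct.induction_on with
    | zero => rw [map_zero]; exact zero_mem _
    | add s t hs ht => rw [map_add]; exact add_mem hs ht
    | tmul c a =>
      obtain ⟨c', hc'⟩ := h a c
      exact ⟨c', LinearMap.ext fun p ↦ by simp [D.K_rC, hc']⟩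
  intro a
  obtain ⟨c, hc⟩ := hle (Submodule.mem_top (x := a))
  exact ⟨c, fun p ↦ (LinearMap.congr_fun hc p).symm⟩

namespace SeparableSetting

variable (h : SeparableSetting Δ E B C) (M : CanonicalMaps Δ) (S : SeparabilityMaps B C E)

theorem left_isInvariant {φ : A →ₗ[ℂ] ℂ} (hφ : IsLeftIntegral Δ C φ) :
    (h.left M S).IsInvariant φ :=
  OneSidedDatum.isInvariant_of_lC _ fun a c ↦ by
    obtain ⟨y, hy, hs⟩ := hφ.invariant a
    exact ⟨⟨y * c.1, (hy c.1 c.2).1⟩, fun p ↦ ((hs (c.1.lact p) _).1 (M.toMult_K a _)).symm⟩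

theorem right_isInvariant {φ : A →ₗ[ℂ] ℂ} (hφ : IsLeftIntegral Δ C φ) :
    (h.right M S).IsInvariant φ :=
  OneSidedDatum.isInvariant_of_lC _ fun a c ↦ by
    obtain ⟨y, hy, hs⟩ := hφ.invariant a
    exact ⟨⟨c.1 * y, (hy c.1 c.2).2⟩, fun p ↦ ((hs (c.1.ract p) _).2 (M.toMult_T' _ a)).symm⟩

theorem left_cop_isInvariant {ψ : A →ₗ[ℂ] ℂ} (hψ : IsRightIntegral Δ B ψ) :
    (h.left M S).cop.IsInvariant ψ :=
  OneSidedDatum.isInvariant_of_lC _ fun a b ↦ by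
    obtain ⟨x, hx, hs⟩ := hψ.invariant a
    exact ⟨⟨x * b.1, (hx b.1 b.2).1⟩, fun p ↦ (slice₂_comm ψ (M.T a (b.1.lact p))).trans
      ((hs (b.1.lact p) _).1 (M.toMult_T a _)).symm⟩

theorem right_cop_isInvariant {ψ : A →ₗ[ℂ] ℂ} (hψ : IsRightIntegral Δ B ψ) :
    (h.right M S).cop.IsInvariant ψ :=
  OneSidedDatum.isInvariant_of_lC _ fun a b ↦ by
    obtain ⟨x, hx, hs⟩ := hψ.invariant a
    exact ⟨⟨b.1 * x, (hx b.1 b.2).2⟩, fun p ↦ (slice₂_comm ψ (M.K' (b.1.ract p) a)).trans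
      ((hs (b.1.ract p) _).2 (M.toMult_K' _ a)).symm⟩

end SeparableSetting

/-- The invariant functionals of a datum are faithful. -/
structure OneSidedDatum.IsFaithful {V X Y : Type*} [AddCommGroup V] [Module ℂ V]
    [AddCommGroup X] [Module ℂ X] [AddCommGroup Y] [Module ℂ Y] (D : OneSidedDatum V X Y) :
    Prop where
  left : ∀ x, (∀ φ, D.IsInvariant φ → ∀ b, φ (D.mul x b) = 0) → x = 0
  right : ∀ x, (∀ ψ, D.cop.IsInvariant ψ → ∀ b, ψ (D.mul b x) = 0) → x = 0

namespace SeparableSetting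

variable (h : SeparableSetting Δ E B C) (M : CanonicalMaps Δ) (S : SeparabilityMaps B C E)
  (hleft : IsFaithfulSet {φ : A →ₗ[ℂ] ℂ | IsLeftIntegral Δ C φ})
  (hright : IsFaithfulSet {ψ : A →ₗ[ℂ] ℂ | IsRightIntegral Δ B ψ})

include hleft hright

theorem left_isFaithful : (h.left M S).IsFaithful where
  left x hx := hleft.1 x fun _ hφ ↦ hx _ (h.left_isInvariant M S hφ)
  right x hx := hright.2 x fun _ hψ ↦ hx _ (h.left_cop_isInvariant M S hψ)

theorem left_cop_isFaithful : (h.left M S).cop.IsFaithful where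
  left x hx := hright.1 x fun _ hψ ↦ hx _ (h.left_cop_isInvariant M S hψ)
  right x hx := hleft.2 x fun φ hφ ↦ hx φ fun a ↦
    (h.left_isInvariant M S hφ a).imp fun c hc p ↦ by
      simpa [OneSidedDatum.cop, slice₂_comm, slice₁_comm] using hc p

theorem right_isFaithful : (h.right M S).IsFaithful where
  left x hx := hleft.2 x fun _ hφ ↦ hx _ (h.right_isInvariant M S hφ)
  right x hx := hright.1 x fun _ hψ ↦ hx _ (h.right_cop_isInvariant M S hψ)

theorem right_cop_isFaithful : (h.right M S).cop.IsFaithful where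
  left x hx := hright.2 x fun _ hψ ↦ hx _ (h.right_cop_isInvariant M S hψ)
  right x hx := hleft.1 x fun φ hφ ↦ hx φ fun a ↦
    (h.right_isInvariant M S hφ a).imp fun c hc p ↦ by
      simpa [OneSidedDatum.cop, slice₂_comm, slice₁_comm] using hc p

end SeparableSetting

end WeakMultiplierHopf

end

noncomputable section

namespace WeakMultiplierHopf

variable {A : Type*} [NonUnitalRing A] [Module ℂ A] [IsScalarTower ℂ A A] [SMulCommClass ℂ A A]
variable {Δ : A →ₙₐ[ℂ] Mult (A ⊗[ℂ] A)} {E : Mult (A ⊗[ℂ] A)}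
variable {B C : Type*} [AddCommGroup B] [Module ℂ B] [AddCommGroup C] [Module ℂ C]

/-! ### Ranges and kernels of the canonical maps, and the counit -/

namespace CanonicalMaps

variable (M : CanonicalMaps Δ)

theorem canT₁_eq (t : A ⊗[ℂ] A) : canT₁ Δ t = toMult _ (TensorProduct.lift M.T t) :=
  tensor_congr (G := toMult _ ∘ₗ TensorProduct.lift M.T) (fun a b ↦ (M.toMult_T a b).symm) t

theorem canT₂_eq (t : A ⊗[ℂ] A) : canT₂ Δ t = toMult _ (TensorProduct.lift M.T' t) :=
  tensor_congr (G := toMult _ ∘ₗ TensorProduct.lift M.T') (fun a b ↦ (M.toMult_T' a b).symm) t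

/-- The element `Δ₁₃(a)(1 ⊗ t)` of `A ⊗ A ⊗ A`. -/
def T₁₃ (a : A) : A ⊗[ℂ] A →ₗ[ℂ] (A ⊗[ℂ] A) ⊗[ℂ] A :=
  (TensorProduct.rightComm ℂ A A A).toLinearMap ∘ₗ (M.T a).rTensor A ∘ₗ
    (TensorProduct.comm ℂ A A).toLinearMap

/-- The element `(t ⊗ 1)Δ₁₃(a)` of `A ⊗ A ⊗ A`. -/
def T₁₃' (a : A) : A ⊗[ℂ] A →ₗ[ℂ] (A ⊗[ℂ] A) ⊗[ℂ] A :=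
  (TensorProduct.rightComm ℂ A A A).toLinearMap ∘ₗ (M.T'.flip a).rTensor A

theorem toMult_T₁₃ (a : A) (t : A ⊗[ℂ] A) :
    toMult _ (M.T₁₃ a t) = leg₁₃ (Δ a) * leg₂₃ (toMult _ t) := by
  refine tensor_congr (F := toMult ((A ⊗[ℂ] A) ⊗[ℂ] A) ∘ₗ M.T₁₃ a)
    (G := LinearMap.mulLeft ℂ (leg₁₃ (Δ a)) ∘ₗ (reassoc (A := A)).toLinearMap ∘ₗ
      tens (A := A) 1 ∘ₗ toMult _)
    (fun b c ↦ ?_) t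
  have h1 : reassoc (tens (1 : Mult A) (toMult (A ⊗[ℂ] A) (b ⊗ₜ c))) =
      transport (A := (A ⊗[ℂ] A) ⊗[ℂ] A) (B := (A ⊗[ℂ] A) ⊗[ℂ] A)
        (TensorProduct.rightComm ℂ A A A) (by exact rightComm_mul A)
        (tens (inr c) (toMult A b)) := by
    rw [← tens_toMult, reassoc_tens]
    exact Mult.ext (TensorProduct.ext_threefold fun _ _ _ ↦ rfl)
      (TensorProduct.ext_threefold fun _ _ _ ↦ rfl)
  simp only [LinearMap.comp_apply, LinearMap.mulLeft_apply, AlgHom.toLinearMap_apply, h1, leg₁₃,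
    ← map_mul, tens_mul_tens, one_mul, ← M.toMult_T, tens_toMult, transport_toMult]
  rfl

theorem toMult_T₁₃' (a : A) (t : A ⊗[ℂ] A) :
    toMult _ (M.T₁₃' a t) = leg₁₂ (toMult _ t) * leg₁₃ (Δ a) := by
  refine tensor_congr (F := toMult ((A ⊗[ℂ] A) ⊗[ℂ] A) ∘ₗ M.T₁₃' a)
    (G := LinearMap.mulRight ℂ (leg₁₃ (Δ a)) ∘ₗ (tens (B := A)).flip 1 ∘ₗ toMult _)
    (fun b c ↦ ?_) t
  have h1 : tens (toMult (A ⊗[ℂ] A) (b ⊗ₜ c)) (1 : Mult A) =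
      transport (A := (A ⊗[ℂ] A) ⊗[ℂ] A) (B := (A ⊗[ℂ] A) ⊗[ℂ] A)
        (TensorProduct.rightComm ℂ A A A) (by exact rightComm_mul A)
        (tens (inl b) (toMult A c)) := by
    rw [← tens_toMult]
    exact Mult.ext (TensorProduct.ext_threefold fun _ _ _ ↦ rfl)
      (TensorProduct.ext_threefold fun _ _ _ ↦ rfl)
  simp only [LinearMap.comp_apply, LinearMap.mulRight_apply, LinearMap.flip_apply, h1, leg₁₃,
    ← map_mul, tens_mul_tens, mul_one, ← M.toMult_T', tens_toMult, transport_toMult]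
  rfl

variable {D : OneSidedDatum A B C}

theorem slice₂_T₁₃ (hT : D.T = M.T) (θ : A →ₗ[ℂ] ℂ) (a : A) (t : A ⊗[ℂ] A) :
    slice₂ θ (M.T₁₃ a t) = D.sliceT θ a t := by
  refine tensor_congr (F := slice₂ θ ∘ₗ M.T₁₃ a) (G := D.sliceT θ a) (fun b c ↦ ?_) t
  rw [OneSidedDatum.sliceT_tmul, hT]
  exact tensor_congr (F := slice₂ θ ∘ₗ (TensorProduct.rightComm ℂ A A A).toLinearMap ∘ₗ
      (TensorProduct.mk ℂ _ A).flip b) (G := (TensorProduct.mk ℂ A A).flip b ∘ₗ slice₂ θ)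
    (fun x y ↦ by simp [TensorProduct.smul_tmul']) _

theorem slice₁_T₁₃' (hT : ∀ a c, D.T a c = TensorProduct.comm ℂ A A (M.T' c a)) (θ : A →ₗ[ℂ] ℂ)
    (a : A) (t : A ⊗[ℂ] A) : slice₁ θ (TensorProduct.assoc ℂ A A A (M.T₁₃' a t)) =
      TensorProduct.comm ℂ A A (D.sliceT θ a (TensorProduct.comm ℂ A A t)) := by
  refine tensor_congr (F := slice₁ θ ∘ₗ (TensorProduct.assoc ℂ A A A).toLinearMap ∘ₗ M.T₁₃' a)
    (G := (TensorProduct.comm ℂ A A).toLinearMap ∘ₗ D.sliceT θ a ∘ₗ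
      (TensorProduct.comm ℂ A A).toLinearMap) (fun b c ↦ ?_) t
  have h1 : D.sliceT θ a (c ⊗ₜ b) = slice₁ θ (M.T' b a) ⊗ₜ c := by
    rw [OneSidedDatum.sliceT_tmul, hT, slice₂_comm]
  simp only [LinearMap.comp_apply, LinearEquiv.coe_coe, TensorProduct.comm_tmul, h1]
  exact tensor_congr (F := slice₁ θ ∘ₗ (TensorProduct.assoc ℂ A A A).toLinearMap ∘ₗ
      (TensorProduct.rightComm ℂ A A A).toLinearMap ∘ₗ (TensorProduct.mk ℂ _ A).flip c)
    (G := TensorProduct.mk ℂ A A c ∘ₗ slice₁ θ) (fun x y ↦ by simp) _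

theorem range_canT₁ (hT : D.T = M.T) (hE : D.E = E.lact) (hD : D.IsFaithful) :
    LinearMap.range (canT₁ Δ) = (LinearMap.range E.lact).map (toMult (A ⊗[ℂ] A)) := by
  apply le_antisymm
  · rintro _ ⟨t, rfl⟩
    refine ⟨TensorProduct.lift M.T t, ⟨TensorProduct.lift M.T t, ?_⟩, (M.canT₁_eq t).symm⟩
    rw [← hE, ← hT]
    exact tensor_congr (F := D.E ∘ₗ TensorProduct.lift D.T)
      (G := TensorProduct.lift D.T) D.E_T t
  · rintro _ ⟨s, hs, rfl⟩
    rw [← hE] at hs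
    obtain ⟨t, rfl⟩ := D.range_E_le hD.left hs
    refine ⟨t, ?_⟩
    rw [M.canT₁_eq, ← hT]
    rfl

theorem lift_T' (hT : ∀ a c, D.T a c = TensorProduct.comm ℂ A A (M.T' c a)) (t : A ⊗[ℂ] A) :
    TensorProduct.lift M.T' t =
      TensorProduct.comm ℂ A A (D.can (TensorProduct.comm ℂ A A t)) :=
  tensor_congr (G := (TensorProduct.comm ℂ A A).toLinearMap ∘ₗ D.can ∘ₗ
    (TensorProduct.comm ℂ A A).toLinearMap) (fun c a ↦ by simp [hT]) t

theorem range_canT₂ (hT : ∀ a c, D.T a c = TensorProduct.comm ℂ A A (M.T' c a))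
    (hE : ∀ t, D.E t = TensorProduct.comm ℂ A A (E.ract (TensorProduct.comm ℂ A A t)))
    (hD : D.IsFaithful) :
    LinearMap.range (canT₂ Δ) = (LinearMap.range E.ract).map (toMult (A ⊗[ℂ] A)) := by
  apply le_antisymm
  · rintro _ ⟨t, rfl⟩
    refine ⟨TensorProduct.lift M.T' t, ⟨TensorProduct.lift M.T' t, ?_⟩, (M.canT₂_eq t).symm⟩
    rw [M.lift_T' hT]
    apply (TensorProduct.comm ℂ A A).injective
    rw [← hE, comm_comm]
    exact tensor_congr (F := D.E ∘ₗ D.can) (G := D.can) D.E_T _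
  · rintro _ ⟨s, ⟨t, rfl⟩, rfl⟩
    obtain ⟨u, hu⟩ := D.range_E_le hD.left ⟨TensorProduct.comm ℂ A A t, rfl⟩
    refine ⟨TensorProduct.comm ℂ A A u, ?_⟩
    rw [M.canT₂_eq, M.lift_T' hT, comm_comm, hu, hE, comm_comm, comm_comm]

variable (hA : IsNondegenerateAlg A)

include hA

theorem exists_G₁ (hT : D.T = M.T) (hE : D.E = E.lact) (hD : D.IsFaithful) :
    ∃ G₁ : A ⊗[ℂ] A →ₗ[ℂ] A ⊗[ℂ] A, IsG₁ Δ E G₁ ∧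
      LinearMap.ker (canT₁ Δ) = LinearMap.range (LinearMap.id - G₁) := by
  obtain ⟨G, hG, hG'⟩ := D.exists_G
  refine ⟨G, fun a b c w hw ↦ ?_, ?_⟩
  · have h3 := ((hA.tensor hA).tensor hA).toMult_injective (hw.trans (M.toMult_T₁₃ a _).symm)
    rw [mul_assoc, in₂₃, ← leg₂₃_mul, (hA.tensor hA).mul_toMult, ← M.toMult_T₁₃, h3]
    refine congrArg _ (sub_eq_zero.mp (eq_zero_of_slice₂ fun θ ↦ ?_))
    rw [map_sub, slice₂_rTensor, M.slice₂_T₁₃ hT, M.slice₂_T₁₃ hT, hG, hE, sub_self]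
  · rw [← D.ker_can hD.right hG']
    ext t
    rw [LinearMap.mem_ker, LinearMap.mem_ker, M.canT₁_eq,
      map_eq_zero_iff _ (hA.tensor hA).toMult_injective, OneSidedDatum.can, hT]

theorem exists_G₂ (hT : ∀ a c, D.T a c = TensorProduct.comm ℂ A A (M.T' c a))
    (hE : ∀ t, D.E t = TensorProduct.comm ℂ A A (E.ract (TensorProduct.comm ℂ A A t)))
    (hD : D.IsFaithful) :
    ∃ G₂ : A ⊗[ℂ] A →ₗ[ℂ] A ⊗[ℂ] A, IsG₂ Δ E G₂ ∧
      LinearMap.ker (canT₂ Δ) = LinearMap.range (LinearMap.id - G₂) := by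
  obtain ⟨G, hG, hG'⟩ := D.exists_G
  refine ⟨(TensorProduct.comm ℂ A A).toLinearMap ∘ₗ G ∘ₗ (TensorProduct.comm ℂ A A).toLinearMap,
    fun a b c w hw ↦ ?_, ?_⟩
  · have h3 := ((hA.tensor hA).tensor hA).toMult_injective (hw.trans (M.toMult_T₁₃' c _).symm)
    rw [in₁₂, ← leg₁₂_mul, (hA.tensor hA).toMult_mul, ← M.toMult_T₁₃', h3]
    refine congrArg _ ((LinearEquiv.symm_apply_eq _).mpr
      (sub_eq_zero.mp (eq_zero_of_slice₁ fun θ ↦ ?_)))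
    rw [map_sub, slice₁_lTensor, M.slice₁_T₁₃' hT, M.slice₁_T₁₃' hT]
    have h4 : TensorProduct.comm ℂ A A (E.ract (a ⊗ₜ b)) =
        D.E (TensorProduct.comm ℂ A A (a ⊗ₜ b)) := by rw [hE, comm_comm]
    rw [h4, ← hG, LinearMap.comp_apply, LinearMap.comp_apply, LinearEquiv.coe_coe, comm_comm,
      sub_self]
  · have hker := D.ker_can hD.right hG'
    ext t
    rw [LinearMap.mem_ker, M.canT₂_eq, map_eq_zero_iff _ (hA.tensor hA).toMult_injective,
      M.lift_T' hT, LinearEquiv.map_eq_zero_iff, ← LinearMap.mem_ker, hker]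
    constructor
    · rintro ⟨s, hs⟩
      refine ⟨TensorProduct.comm ℂ A A s, (TensorProduct.comm ℂ A A).injective ?_⟩
      rw [← hs]
      simp
    · rintro ⟨s, rfl⟩
      exact ⟨TensorProduct.comm ℂ A A s, by simp⟩

/-- A left counit is a right counit, by coassociativity and fullness. -/
theorem exists_isCounit (hΔ : IsCoproduct Δ) (hT : D.T = M.T) (hmul : D.mul = LinearMap.mul ℂ A)
    (hD : D.IsFaithful) : ∃ ε : A →ₗ[ℂ] ℂ, IsCounit Δ ε := by
  obtain ⟨ε, hε⟩ := D.exists_counit hD.left hD.right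
  rw [hT, hmul] at hε
  have hright : ∀ c x, slice₂ ε (M.T' c x) = c * x := fun c x ↦ by
    refine sub_eq_zero.mp (eq_zero_of_dual fun f ↦ ?_)
    refine LinearMap.congr_fun (D.full_T (f ∘ₗ (slice₂ ε ∘ₗ M.T' c - LinearMap.mulLeft ℂ c))
      fun a b ↦ ?_) x
    have h1 : (slice₁ ε).lTensor A (TensorProduct.assoc ℂ A A A
        ((M.T' c).rTensor A (M.T a b))) = (slice₂ ε ∘ₗ M.T' c).rTensor A (M.T a b) := by
      rw [LinearMap.rTensor_comp_apply]
      refine tensor_congr (F := (slice₁ ε).lTensor A ∘ₗ (TensorProduct.assoc ℂ A A A).toLinearMap)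
        (G := (slice₂ ε).rTensor A) (fun u z ↦ ?_) _
      exact tensor_congr (F := (slice₁ ε).lTensor A ∘ₗ (TensorProduct.assoc ℂ A A A).toLinearMap ∘ₗ
          (TensorProduct.mk ℂ _ A).flip z)
        (G := (slice₂ ε).rTensor A ∘ₗ (TensorProduct.mk ℂ _ A).flip z)
        (fun x y ↦ by simp) u
    have h2 : slice₁ ε ∘ₗ M.T.flip b = LinearMap.mulRight ℂ b := LinearMap.ext fun x ↦ hε x b
    rw [M.coassoc_T' hA hΔ, ← LinearMap.lTensor_comp_apply, h2, M.T'_mul_right' hA] at h1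
    rw [hT, LinearMap.comp_sub, sub_eq_add_neg, slice₁_add_left, ← neg_one_smul ℂ, slice₁_smul_left,
      ← slice₁_rTensor, ← slice₁_rTensor, ← h1, neg_one_smul, add_neg_cancel]
  refine ⟨ε, fun a b t ht ↦ ?_, fun a b t ht ↦ ?_⟩
  · rw [← M.toMult_T] at ht
    rw [(hA.tensor hA).toMult_injective ht]
    exact hε a b
  · rw [← M.toMult_T'] at ht
    rw [(hA.tensor hA).toMult_injective ht]
    exact hright a b

end CanonicalMaps

end WeakMultiplierHopf

end

noncomputable section

namespace WeakMultiplierHopf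

variable {A : Type*} [NonUnitalRing A] [Module ℂ A] [IsScalarTower ℂ A A] [SMulCommClass ℂ A A]
variable {Δ : A →ₙₐ[ℂ] Mult (A ⊗[ℂ] A)} {E : Mult (A ⊗[ℂ] A)}

/-! ### The opposite coproduct -/

theorem flipMult_tens (x y : Mult A) : flipMult (tens x y) = tens y x :=
  Mult.ext (TensorProduct.ext' fun _ _ ↦ rfl) (TensorProduct.ext' fun _ _ ↦ rfl)

theorem flipMult_inl (a : A) : flipMult (inl a) = inr a := flipMult_tens _ _

theorem flipMult_inr (a : A) : flipMult (inr a) = inl a := flipMult_tens _ _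

theorem flipMult_toMult (t : A ⊗[ℂ] A) :
    flipMult (toMult _ t) = toMult _ (TensorProduct.comm ℂ A A t) :=
  transport_toMult _ _ t

theorem coopposite_apply (a : A) : coopposite Δ a = flipMult (Δ a) := rfl

variable (A) in
/-- The reversal `(x ⊗ y) ⊗ z ↦ (z ⊗ y) ⊗ x` of `A ⊗ A ⊗ A`. -/
def revTensor : (A ⊗[ℂ] A) ⊗[ℂ] A ≃ₗ[ℂ] (A ⊗[ℂ] A) ⊗[ℂ] A :=
  (TensorProduct.comm ℂ (A ⊗[ℂ] A) A) ≪≫ₗ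
    (TensorProduct.congr (LinearEquiv.refl ℂ A) (TensorProduct.comm ℂ A A)) ≪≫ₗ
    (TensorProduct.assoc ℂ A A A).symm

theorem revTensor_tmul (x y z : A) : revTensor A ((x ⊗ₜ y) ⊗ₜ z) = (z ⊗ₜ y) ⊗ₜ x := rfl

theorem revTensor_mul (s t : (A ⊗[ℂ] A) ⊗[ℂ] A) :
    revTensor A (s * t) = revTensor A s * revTensor A t := by
  have key : (LinearMap.mul ℂ ((A ⊗[ℂ] A) ⊗[ℂ] A)).compr₂ (revTensor A).toLinearMap =
      (LinearMap.mul ℂ ((A ⊗[ℂ] A) ⊗[ℂ] A)).compl₁₂ (revTensor A).toLinearMap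
        (revTensor A).toLinearMap := by
    refine TensorProduct.ext_threefold fun x y z ↦ TensorProduct.ext_threefold fun x' y' z' ↦ ?_
    simp [revTensor_tmul]
  exact LinearMap.congr_fun₂ key s t

/-- The reversal of the legs of `M(A ⊗ A ⊗ A)`. -/
def rev : Mult ((A ⊗[ℂ] A) ⊗[ℂ] A) →ₐ[ℂ] Mult ((A ⊗[ℂ] A) ⊗[ℂ] A) :=
  transport (revTensor A) revTensor_mul

theorem revTensor_assoc_symm (x : A) (t : A ⊗[ℂ] A) :
    revTensor A ((TensorProduct.assoc ℂ A A A).symm (x ⊗ₜ t)) = TensorProduct.comm ℂ A A t ⊗ₜ x :=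
  tensor_congr (F := (revTensor A).toLinearMap ∘ₗ (TensorProduct.assoc ℂ A A A).symm.toLinearMap ∘ₗ
      TensorProduct.mk ℂ A (A ⊗[ℂ] A) x)
    (G := (TensorProduct.mk ℂ (A ⊗[ℂ] A) A).flip x ∘ₗ (TensorProduct.comm ℂ A A).toLinearMap)
    (fun _ _ ↦ rfl) t

theorem rev_reassoc (x : Mult A) (m : Mult (A ⊗[ℂ] A)) :
    rev (reassoc (tens x m)) = tens (flipMult m) x :=
  Mult.ext (TensorProduct.ext_threefold fun a b c ↦ revTensor_assoc_symm (x.lact c) (m.lact (b ⊗ₜ a)))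
    (TensorProduct.ext_threefold fun a b c ↦ revTensor_assoc_symm (x.ract c) (m.ract (b ⊗ₜ a)))

theorem rev_tens (x : Mult A) (m : Mult (A ⊗[ℂ] A)) :
    rev (tens m x) = reassoc (tens x (flipMult m)) :=
  Mult.ext (TensorProduct.ext_threefold fun _ _ _ ↦ rfl)
    (TensorProduct.ext_threefold fun _ _ _ ↦ rfl)

theorem rev_leg₂₃ (m : Mult (A ⊗[ℂ] A)) : rev (leg₂₃ m) = leg₁₂ (flipMult m) := rev_reassoc 1 m

theorem rev_leg₁₂ (m : Mult (A ⊗[ℂ] A)) : rev (leg₁₂ m) = leg₂₃ (flipMult m) := rev_tens 1 m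

theorem rev_idDelta (t : A ⊗[ℂ] A) :
    rev (idDelta Δ t) = deltaId (coopposite Δ) (TensorProduct.comm ℂ A A t) :=
  tensor_congr (F := rev.toLinearMap ∘ₗ idDelta Δ)
    (G := deltaId (coopposite Δ) ∘ₗ (TensorProduct.comm ℂ A A).toLinearMap)
    (fun x y ↦ rev_reassoc (toMult A x) (Δ y)) t

theorem rev_deltaId (t : A ⊗[ℂ] A) :
    rev (deltaId Δ t) = idDelta (coopposite Δ) (TensorProduct.comm ℂ A A t) :=
  tensor_congr (F := rev.toLinearMap ∘ₗ deltaId Δ)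
    (G := idDelta (coopposite Δ) ∘ₗ (TensorProduct.comm ℂ A A).toLinearMap)
    (fun x y ↦ rev_tens (toMult A y) (Δ x)) t

theorem flipMult_lact (m : Mult (A ⊗[ℂ] A)) (t : A ⊗[ℂ] A) :
    (flipMult m).lact (TensorProduct.comm ℂ A A t) = TensorProduct.comm ℂ A A (m.lact t) := by
  change TensorProduct.comm ℂ A A (m.lact ((TensorProduct.comm ℂ A A).symm
    (TensorProduct.comm ℂ A A t))) = _
  rw [LinearEquiv.symm_apply_apply]

theorem flipMult_ract (m : Mult (A ⊗[ℂ] A)) (t : A ⊗[ℂ] A) :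
    (flipMult m).ract (TensorProduct.comm ℂ A A t) = TensorProduct.comm ℂ A A (m.ract t) := by
  change TensorProduct.comm ℂ A A (m.ract ((TensorProduct.comm ℂ A A).symm
    (TensorProduct.comm ℂ A A t))) = _
  rw [LinearEquiv.symm_apply_apply]

theorem IsIdDeltaValue.coopposite {m : Mult (A ⊗[ℂ] A)} {X : Mult ((A ⊗[ℂ] A) ⊗[ℂ] A)}
    (h : IsIdDeltaValue Δ E m X) :
    IsDeltaIdValue (coopposite Δ) (flipMult E) (flipMult m) (rev X) where
  unit_mul := by rw [← rev_leg₂₃, ← map_mul, h.unit_mul]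
  mul_unit := by rw [← rev_leg₂₃, ← map_mul, h.mul_unit]
  mul_apply t := by
    obtain ⟨t, rfl⟩ := (TensorProduct.comm ℂ A A).surjective t
    rw [← rev_idDelta, ← map_mul, h.mul_apply, flipMult_lact, rev_idDelta]
  apply_mul t := by
    obtain ⟨t, rfl⟩ := (TensorProduct.comm ℂ A A).surjective t
    rw [← rev_idDelta, ← map_mul, h.apply_mul, flipMult_ract, rev_idDelta]

theorem IsDeltaIdValue.coopposite {m : Mult (A ⊗[ℂ] A)} {X : Mult ((A ⊗[ℂ] A) ⊗[ℂ] A)}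
    (h : IsDeltaIdValue Δ E m X) :
    IsIdDeltaValue (coopposite Δ) (flipMult E) (flipMult m) (rev X) where
  unit_mul := by rw [← rev_leg₁₂, ← map_mul, h.unit_mul]
  mul_unit := by rw [← rev_leg₁₂, ← map_mul, h.mul_unit]
  mul_apply t := by
    obtain ⟨t, rfl⟩ := (TensorProduct.comm ℂ A A).surjective t
    rw [← rev_deltaId, ← map_mul, h.mul_apply, flipMult_lact, rev_deltaId]
  apply_mul t := by
    obtain ⟨t, rfl⟩ := (TensorProduct.comm ℂ A A).surjective t
    rw [← rev_deltaId, ← map_mul, h.apply_mul, flipMult_ract, rev_deltaId]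

namespace CanonicalMaps

/-- The canonical maps of the opposite coproduct. -/
def cop (M : CanonicalMaps Δ) : CanonicalMaps (coopposite Δ) where
  T := M.K.compr₂ (TensorProduct.comm ℂ A A).toLinearMap
  K := M.T.compr₂ (TensorProduct.comm ℂ A A).toLinearMap
  T' := M.K'.compr₂ (TensorProduct.comm ℂ A A).toLinearMap
  K' := M.T'.compr₂ (TensorProduct.comm ℂ A A).toLinearMap
  toMult_T a b := by
    rw [coopposite_apply, ← flipMult_inl, ← map_mul, ← M.toMult_K, flipMult_toMult]; rfl
  toMult_K a b := by
    rw [coopposite_apply, ← flipMult_inr, ← map_mul, ← M.toMult_T, flipMult_toMult]; rfl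
  toMult_T' c a := by
    rw [coopposite_apply, ← flipMult_inr, ← map_mul, ← M.toMult_K', flipMult_toMult]; rfl
  toMult_K' c a := by
    rw [coopposite_apply, ← flipMult_inl, ← map_mul, ← M.toMult_T', flipMult_toMult]; rfl

variable (M : CanonicalMaps Δ) (hA : IsNondegenerateAlg A)

include M hA

theorem isCoproduct_coopposite (hΔ : IsCoproduct Δ) : IsCoproduct (coopposite Δ) where
  mem₁ a b := ⟨_, M.cop.toMult_T a b⟩
  mem₂ c a := ⟨_, M.cop.toMult_T' c a⟩
  coassoc a b c t u ht hu := by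
    rw [← M.cop.toMult_T] at ht
    rw [← M.cop.toMult_T'] at hu
    rw [(hA.tensor hA).toMult_injective ht, (hA.tensor hA).toMult_injective hu]
    change _ * deltaId (coopposite Δ) (TensorProduct.comm ℂ A A (M.K a b)) =
      idDelta (coopposite Δ) (TensorProduct.comm ℂ A A (M.K' c a)) * _
    rw [← rev_idDelta, ← rev_deltaId, ← flipMult_inr c, ← flipMult_inl b, ← rev_leg₂₃, ← rev_leg₁₂,
      ← map_mul, ← map_mul, M.coassoc_cop hA hΔ]

theorem isFull_coopposite (hfull : IsFull Δ) : IsFull (coopposite Δ) where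
  left V hV := by
    refine eq_top_of_forall_dual fun f hf ↦ M.full_K hA hfull f fun a b ↦ ?_
    obtain ⟨t, ht, ht'⟩ := hV a b
    rw [← M.cop.toMult_T] at ht'
    have h1 : t ∈ LinearMap.ker (slice₁ (W := A) f) :=
      (Submodule.map₂_le.mpr fun v hv w _ ↦ by simp [hf v hv]) ht
    rw [(hA.tensor hA).toMult_injective ht'] at h1
    exact (slice₁_comm f (M.K a b)).symm.trans h1
  right V hV := by
    refine eq_top_of_forall_dual fun f hf ↦ M.full_K' hA hfull f fun c a ↦ ?_
    obtain ⟨t, ht, ht'⟩ := hV c a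
    rw [← M.cop.toMult_T'] at ht'
    have h1 : t ∈ LinearMap.ker (slice₂ (V := A) f) :=
      (Submodule.map₂_le.mpr fun w _ v hv ↦ by simp [hf v hv]) ht
    rw [(hA.tensor hA).toMult_injective ht'] at h1
    exact (slice₂_comm f (M.K' c a)).symm.trans h1

end CanonicalMaps

/-! ### Weak multiplier Hopf algebras -/

namespace SeparableSetting

variable {B C : NonUnitalSubalgebra ℂ (Mult A)} (h : SeparableSetting Δ E B C)
  (hleft : IsFaithfulSet {φ : A →ₗ[ℂ] ℂ | IsLeftIntegral Δ C φ})
  (hright : IsFaithfulSet {ψ : A →ₗ[ℂ] ℂ | IsRightIntegral Δ B ψ})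

include h hleft hright

/-- Here `T₁` is the canonical map of the left datum, and `T₂` is that of the right datum for the
opposite coproduct. -/
theorem isWeakMultiplierHopfAlgebra : IsWeakMultiplierHopfAlgebra Δ := by
  obtain ⟨M⟩ := h.coproduct.nonempty_canonicalMaps h.nondeg
  obtain ⟨S⟩ := h.sep.nonempty_maps h.nondeg
  have h1 := h.left_isFaithful M S hleft hright
  have h2 := h.right_cop_isFaithful M S hleft hright
  exact
    { nondegenerate := h.nondeg
      idempotent := h.idem
      coproduct := h.coproduct.toIsCoproduct
      full := h.full
      counit := M.exists_isCounit h.nondeg h.coproduct.toIsCoproduct rfl rfl h1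
      canonical := ⟨E, h.canonical.idem, M.range_canT₁ rfl rfl h1,
        M.range_canT₂ (fun _ _ ↦ rfl) (fun _ ↦ rfl) h2, h.comm, h.value, h.idDelta_value,
        M.exists_G₁ h.nondeg rfl rfl h1, M.exists_G₂ h.nondeg (fun _ _ ↦ rfl) (fun _ ↦ rfl) h2⟩ }

/-- Here `T₁` is the canonical map of the left datum for the opposite coproduct, and `T₂` is that of
the right datum. -/
theorem isWeakMultiplierHopfAlgebra_coopposite :
    IsWeakMultiplierHopfAlgebra (coopposite Δ) := by
  obtain ⟨M⟩ := h.coproduct.nonempty_canonicalMaps h.nondeg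
  obtain ⟨S⟩ := h.sep.nonempty_maps h.nondeg
  have h1 := h.left_cop_isFaithful M S hleft hright
  have h2 := h.right_isFaithful M S hleft hright
  have hΔ := M.isCoproduct_coopposite h.nondeg h.coproduct.toIsCoproduct
  have hE1 : (h.left M S).cop.E = (flipMult E).lact := rfl
  have hE2 : ∀ t, (h.right M S).E t = TensorProduct.comm ℂ A A
      ((flipMult E).ract (TensorProduct.comm ℂ A A t)) := fun t ↦ by
    rw [flipMult_ract, comm_comm]; rfl
  have hT2 : ∀ a c, (h.right M S).T a c = TensorProduct.comm ℂ A A (M.cop.T' c a) := fun a c ↦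
    (comm_comm (M.K' c a)).symm
  -- Reversal of the legs exchanges the two given expressions for the value of `Δ ⊗ ι` at `E`.
  have hP : rev (leg₂₃ E * leg₁₂ E) = leg₂₃ (flipMult E) * leg₁₂ (flipMult E) := by
    rw [h.comm, map_mul, rev_leg₁₂, rev_leg₂₃]
  exact
    { nondegenerate := h.nondeg
      idempotent := h.idem
      coproduct := hΔ
      full := M.isFull_coopposite h.nondeg h.full
      counit := M.cop.exists_isCounit h.nondeg hΔ rfl rfl h1
      canonical := ⟨flipMult E, by rw [← map_mul, h.canonical.idem], M.cop.range_canT₁ rfl hE1 h1,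
        M.cop.range_canT₂ hT2 hE2 h2, by rw [← hP, map_mul, rev_leg₁₂, rev_leg₂₃],
        hP ▸ h.idDelta_value.coopposite, hP ▸ h.value.coopposite,
        M.cop.exists_G₁ h.nondeg rfl hE1 h1, M.cop.exists_G₂ h.nondeg hT2 hE2 h2⟩ }

end SeparableSetting

end WeakMultiplierHopf

end

open WeakMultiplierHopf in
theorem theorem2p14 {A : Type*} [NonUnitalRing A] [Module ℂ A] [IsScalarTower ℂ A A]
    [SMulCommClass ℂ A A] (hnd : IsNondegenerateAlg A) (hid : IsIdempotentAlg A)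
    (Δ : A →ₙₐ[ℂ] Mult (A ⊗[ℂ] A)) (hreg : IsRegularCoproduct Δ) (hfull : IsFull Δ)
    (E : Mult (A ⊗[ℂ] A)) (hE : IsCanonicalIdempotent Δ E)
    (hΔE : IsDeltaIdValue Δ E E (leg₂₃ E * leg₁₂ E))
    (hcomm : leg₂₃ E * leg₁₂ E = leg₁₂ E * leg₂₃ E)
    (B C : NonUnitalSubalgebra ℂ (Mult A))
    (hB : SitsNondegenerately B) (hC : SitsNondegenerately C)
    (hsep : IsRegularSeparabilityIdempotent B C E)
    (hleft : IsFaithfulSet {φ : A →ₗ[ℂ] ℂ | IsLeftIntegral Δ C φ})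
    (hright : IsFaithfulSet {ψ : A →ₗ[ℂ] ℂ | IsRightIntegral Δ B ψ}) :
    IsRegularWeakMultiplierHopfAlgebra Δ :=
  have h : SeparableSetting Δ E B C := ⟨⟨hnd, hid, hreg, hE, hΔE, hcomm⟩, hfull, hB, hC, hsep⟩
  ⟨hreg, h.isWeakMultiplierHopfAlgebra hleft hright,
    h.isWeakMultiplierHopfAlgebra_coopposite hleft hright⟩
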